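/- Work over $\mathbb{C}(q)$, put $\xi=q-q^{-1}$. For $N\ge 0$ let $I_{N|N}=\{-N,\dots,-1,1,\dots,N\}$, with $|i|=0$ for $i>0$ and $|i|=1$ for $i<0$; the matrix unit $E_{ij}$ has parity $|i|+|j|$, and all tensor products of superspaces obey the sign rule $(a\otimes b)(c\otimes d)=(-1)^{|b||c|}ac\otimes bd$. Let $\varphi(i,j)=(-1)^{|j|}(\delta_{i,j}+\delta_{i,-j})$ and $$S=\sum_{i,j\in I_{N|N}}q^{\varphi(i,j)}E_{ii}\otimes E_{jj}+\xi\sum_{i<j}(-1)^{|i|}(E_{ji}+E_{-j,-i})\otimes E_{ij},$$ $$S^{-1}=\sum_{i,j\in I_{N|N}}q^{-\varphi(i,j)}E_{ii}\otimes E_{jj}-\xi\sum_{i<j}(-1)^{|i|}(E_{ji}+E_{-j,-i})\otimes E_{ij}.$$ Superscripts without brackets denote matrix tensor factors, superscripts in brackets denote algebra tensor factors. The quantum coordinate superalgebra $\mathsf{A}_{r,n}$ is generated by $t_{ia}$ ($i\in I_{r|r}$, $a\in I_{n|n}$) of parity $|i|+|a|$ with relations $t_{ia}=t_{-i,-a}$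 and $S^{12}T^{1[3]}T^{2[3]}=T^{2[3]}T^{1[3]}S^{12}$, where $T=\sum E_{ia}\otimes t_{ia}$; put $T_+=\sum_{i=1}^r\sum_{a}E_{ia}\otimes t_{ia}$. The dual superalgebra $\bar{\mathsf{A}}_{s,n}$ is generated by $\bar t_{\alpha b}$ ($\alpha\in I_{s|s}$, $b\in I_{n|n}$) of parity $|\alpha|+|b|$ with relations $\bar t_{\alpha b}=(-1)^{|\alpha|+|b|}\bar t_{-\alpha,-b}$ and $\bar T^{1[3]}\bar T^{2[3]}S^{12}=S^{12}\bar T^{2[3]}\bar T^{1[3]}$, where $\bar T=\sum(-1)^{|b|(|\alpha|+|b|)}E_{b\alpha}\otimes\bar t_{\alpha b}$. (1) For all $r,s$ there is exactly one linear map $\Omega:\mathsf{A}_{r,s}\otimes\mathsf{A}_{r,s}\to\mathsf{A}_{r,s}\otimes\mathsf{A}_{r,s}$ with $\Omega(f\otimes1)=f\otimes1$ and $\Omega(1\otimes f)=1\otimes f$ for all $f$, with $\Omega(T_+^{1[3]}T_+^{2[4]})=T_+^{1[3]}T_+^{2[4]}S^{12}$, and with $$\Omega\circ(\mathrm{mul}\otimes1)=(\mathrm{mul}\otimes1)\Omega^{[1][3]}\Omega^{[2][3]},\qquad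 \Omega\circ(1\otimes\mathrm{mul})=(1\otimes\mathrm{mul})\Omega^{[1][3]}\Omega^{[1][2]}.$$ (2) Let $n\ge\max(r,s)$. There is exactly one linear map $\Upsilon:\bar{\mathsf{A}}_{s,n}\otimes\mathsf{A}_{r,n}\to\mathsf{A}_{r,n}\otimes\bar{\mathsf{A}}_{s,n}$ with $\Upsilon(1\otimes f)=f\otimes1$, $\Upsilon(\bar g\otimes1)=1\otimes\bar g$, $\Upsilon(\bar T^{1[3]}T_+^{2[4]})=T_+^{2[3]}(S^{-1})^{12}\bar T^{1[4]}$, $\Upsilon(1\otimes\mathrm{mul})=(\mathrm{mul}\otimes1)(1\otimes\Upsilon)(\Upsilon\otimes1)$ and $\Upsilon(\mathrm{mul}\otimes1)=(1\otimes\mathrm{mul})(\Upsilon\otimes1)(1\otimes\Upsilon)$; it equips $\mathcal{O}_{r,s}=\mathsf{A}_{r,n}\otimes\bar{\mathsf{A}}_{s,n}$ with the braided multiplication $(\mathrm{mul}\otimes\mathrm{mul})\circ(1\otimes\Upsilon\otimes1)$, also denoted $\mathrm{mul}$. Write $\mathsf{A}_n=\mathsf{A}_{n,n}$, $\bar{\mathsf{A}}_n=\bar{\mathsf{A}}_{n,n}$.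 There are exactly one superalgebra homomorphism $\Delta^\circ:\mathsf{A}_n\to\mathsf{A}_n\otimes\mathsf{A}_n$ with $\Delta^\circ(t_{i\alpha})=\sum_{b}(-1)^{(|i|+|b|)(|b|+|\alpha|)}t_{ib}\otimes t_{b\alpha}$ and exactly one superalgebra anti-homomorphism $\mathcal{S}^\circ:\mathsf{A}_n\to\bar{\mathsf{A}}_n$ (that is, $\mathcal{S}^\circ(fg)=(-1)^{|f||g|}\mathcal{S}^\circ(g)\mathcal{S}^\circ(f)$, $\mathcal{S}^\circ(1)=1$) with $\mathcal{S}^\circ(t_{ia})=(-1)^{|i|(|i|+|a|)}\bar t_{ai}$. With respect to the natural maps $\mathsf{A}_{r,s}\to\mathsf{A}_n$, $\mathsf{A}_{r,n}\to\mathsf{A}_n$, $\bar{\mathsf{A}}_{s,n}\to\bar{\mathsf{A}}_n$, which send generators to the generators of the same name, the map $(1\otimes\mathcal{S}^\circ)\circ\Delta^\circ$ restricts to exactly one linear map $\tilde\Delta_{r,s}:\mathsf{A}_{r,s}\to\mathcal{O}_{r,s}$, and for all $f,g\in\mathsf{A}_{r,s}$ $$\tilde\Delta_{r,s}(fg)=\mathrm{mul}\circ(\tilde\Delta_{r,s}\otimes\tilde\Delta_{r,s})\circ\Omega(f\otimes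 g).$$ -/

import Mathlib

open TensorProduct

namespace QueerInv

noncomputable section

/-! ### Base field, index sets and supermatrices -/

/-- The base field `ℂ(q)`. -/
abbrev Kq : Type := RatFunc ℂ

/-- The indeterminate `q`. -/
def qv : Kq := RatFunc.X

/-- `ξ = q - q⁻¹`. -/
def xi : Kq := qv - qv⁻¹

/-- The index set `I_{N|N} = {-N, …, -1, 1, …, N}`, ordered as a set of integers. -/
abbrev Idx (N : ℕ) : Type := ↥((Finset.Icc (-(N : ℤ)) (N : ℤ)).erase 0)

instance instNegIdx (N : ℕ) : Neg (Idx N) :=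
  ⟨fun i => ⟨-(i : ℤ), by
    have := i.2
    simp only [Finset.mem_erase, Finset.mem_Icc] at this ⊢
    omega⟩⟩

/-- The positive indices `{1, …, r}` inside `I_{r|r}`. -/
abbrev IdxPos (r : ℕ) : Type := {i : Idx r // 0 < (i : ℤ)}

/-- An index type whose elements carry a parity, `0` (even) or `1` (odd). -/
class SuperIndex (ι : Type) where
  /-- the parity of an index -/
  par : ι → ℕ

open SuperIndex

/-- `|i| = 0` for `i > 0` and `|i| = 1` for `i < 0`. -/
instance instSuperIndexIdx (N : ℕ) : SuperIndex (Idx N) :=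
  ⟨fun i => if (i : ℤ) < 0 then 1 else 0⟩

instance instSuperIndexIdxPos (r : ℕ) : SuperIndex (IdxPos r) :=
  ⟨fun i => par i.1⟩

/-- An even element `∑ E_{ik} ⊗ E_{jl} ⊗ X i k j l` of `Hom ⊗ Hom ⊗ M`, where `M` is a superspace,
the matrix unit `E_{ik}` has parity `|i| + |k|`, and the entry `X i k j l` has parity
`|i| + |k| + |j| + |l|`.  The matrices need not be square. -/
abbrev SuperMat (ι κ ι' κ' M : Type) : Type := ι → κ → ι' → κ' → M

/-- The product of two even supermatrices, by the sign rule `(a ⊗ b)(c ⊗ d) = (-1)^{|b||c|} ac ⊗ bd`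
in the triple super tensor product: the entry `X i p j u` moves past `E_{pk} ⊗ E_{ul}`,
and `E_{ju}` moves past `E_{pk}`.  Entries are multiplied by means of `m`. -/
def superMul {ι κ μ ι' κ' μ' M N P : Type} [Fintype μ] [Fintype μ']
    [SuperIndex ι] [SuperIndex κ] [SuperIndex μ] [SuperIndex ι'] [SuperIndex κ'] [SuperIndex μ']
    [AddCommMonoid M] [Module Kq M] [AddCommMonoid N] [Module Kq N]
    [AddCommMonoid P] [Module Kq P]
    (m : M →ₗ[Kq] N →ₗ[Kq] P) (X : SuperMat ι μ ι' μ' M) (Y : SuperMat μ κ μ' κ' N) :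
    SuperMat ι κ ι' κ' P :=
  fun i k j l => ∑ p, ∑ u,
    ((-1 : Kq) ^ ((par i + par p + par j + par u) * (par p + par k + par u + par l)
      + (par j + par u) * (par p + par k))) • m (X i p j u) (Y p k u l)

/-- The product `C ⋆ X` with a matrix of scalars on the left. -/
def scalarMul {ι κ μ ι' κ' μ' M : Type} [Fintype μ] [Fintype μ']
    [SuperIndex ι] [SuperIndex κ] [SuperIndex μ] [SuperIndex ι'] [SuperIndex κ'] [SuperIndex μ']
    [AddCommMonoid M] [Module Kq M]
    (C : SuperMat ι μ ι' μ' Kq) (X : SuperMat μ κ μ' κ' M) : SuperMat ι κ ι' κ' M :=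
  superMul (LinearMap.lsmul Kq M) C X

/-- The product `X ⋆ C` with a matrix of scalars on the right. -/
def mulScalar {ι κ μ ι' κ' μ' M : Type} [Fintype μ] [Fintype μ']
    [SuperIndex ι] [SuperIndex κ] [SuperIndex μ] [SuperIndex ι'] [SuperIndex κ'] [SuperIndex μ']
    [AddCommMonoid M] [Module Kq M]
    (X : SuperMat ι μ ι' μ' M) (C : SuperMat μ κ μ' κ' Kq) : SuperMat ι κ ι' κ' M :=
  superMul (LinearMap.lsmul Kq M).flip X C

/-- `X^{1}`: the matrix `∑ E_{ik} ⊗ 1 ⊗ X i k`, where `1` is the identity on the index type `ν`. -/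
def leg1 {ι κ M : Type} (ν : Type) [DecidableEq ν] [Zero M] (X : ι → κ → M) :
    SuperMat ι κ ν ν M :=
  fun i k j l => if j = l then X i k else 0

/-- `X^{2}`: the matrix `∑ 1 ⊗ E_{jl} ⊗ X j l`, where `1` is the identity on the index type `ν`. -/
def leg2 {ι κ M : Type} (ν : Type) [DecidableEq ν] [Zero M] (X : ι → κ → M) :
    SuperMat ν ν ι κ M :=
  fun i k j l => if i = k then X j l else 0

/-- `φ(i,j) = (-1)^{|j|} (δ_{i,j} + δ_{i,-j})`. -/
def phi {N : ℕ} (i j : Idx N) : ℤ :=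
  (-1) ^ par j * ((if i = j then 1 else 0) + (if i = -j then 1 else 0))

/-- The matrix `S = ∑_{i,j} q^{φ(i,j)} E_{ii} ⊗ E_{jj}
  + ξ ∑_{i<j} (-1)^{|i|} (E_{ji} + E_{-j,-i}) ⊗ E_{ij}`; `Smat N i k j l` is the coefficient of
`E_{ik} ⊗ E_{jl}`. -/
def Smat (N : ℕ) : SuperMat (Idx N) (Idx N) (Idx N) (Idx N) Kq := fun i k j l =>
  (if i = k ∧ j = l then qv ^ phi i j else 0)
    + (if j < l then xi * (-1) ^ par j *
        ((if i = l ∧ k = j then 1 else 0) + (if i = -l ∧ k = -j then 1 else 0)) else 0)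

/-- The inverse matrix `S⁻¹ = ∑_{i,j} q^{-φ(i,j)} E_{ii} ⊗ E_{jj}
  - ξ ∑_{i<j} (-1)^{|i|} (E_{ji} + E_{-j,-i}) ⊗ E_{ij}`. -/
def SmatInv (N : ℕ) : SuperMat (Idx N) (Idx N) (Idx N) (Idx N) Kq := fun i k j l =>
  (if i = k ∧ j = l then qv ^ (-phi i j) else 0)
    - (if j < l then xi * (-1) ^ par j *
        ((if i = l ∧ k = j then 1 else 0) + (if i = -l ∧ k = -j then 1 else 0)) else 0)

/-! ### The quantum coordinate superalgebra and its dual -/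

/-- The free generating matrix `∑ E_{ia} ⊗ t_{ia}`. -/
def Tfree (r n : ℕ) (i : Idx r) (a : Idx n) : FreeAlgebra Kq (Idx r × Idx n) :=
  FreeAlgebra.ι Kq (i, a)

/-- The defining relations `t_{ia} = t_{-i,-a}` and `S^{12} T^{1[3]} T^{2[3]} = T^{2[3]} T^{1[3]} S^{12}`
(entry by entry). -/
inductive ARel (r n : ℕ) :
    FreeAlgebra Kq (Idx r × Idx n) → FreeAlgebra Kq (Idx r × Idx n) → Prop
  | neg (i : Idx r) (a : Idx n) : ARel r n (Tfree r n i a) (Tfree r n (-i) (-a))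
  | stt (i : Idx r) (a : Idx n) (j : Idx r) (b : Idx n) : ARel r n
      (scalarMul (Smat r)
        (superMul (LinearMap.mul Kq (FreeAlgebra Kq (Idx r × Idx n)))
          (leg1 (Idx r) (Tfree r n)) (leg2 (Idx n) (Tfree r n))) i a j b)
      (mulScalar
        (superMul (LinearMap.mul Kq (FreeAlgebra Kq (Idx r × Idx n)))
          (leg2 (Idx r) (Tfree r n)) (leg1 (Idx n) (Tfree r n))) (Smat n) i a j b)

/-- The quantum coordinate superalgebra `A_{r,n}`. -/
def A (r n : ℕ) : Type := RingQuot (ARel r n)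

instance instRingA (r n : ℕ) : Ring (A r n) := inferInstanceAs (Ring (RingQuot (ARel r n)))

instance instAlgebraA (r n : ℕ) : Algebra Kq (A r n) :=
  inferInstanceAs (Algebra Kq (RingQuot (ARel r n)))

/-- The quotient map from the free algebra to `A_{r,n}`. -/
def mkA (r n : ℕ) : FreeAlgebra Kq (Idx r × Idx n) →ₐ[Kq] A r n :=
  RingQuot.mkAlgHom Kq (ARel r n)

theorem mkA_rel {r n : ℕ} {x y : FreeAlgebra Kq (Idx r × Idx n)} (h : ARel r n x y) :
    mkA r n x = mkA r n y :=
  RingQuot.mkAlgHom_rel Kq h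

/-- The universal property of `A_{r,n}`. -/
def liftA {r n : ℕ} {B : Type} [Ring B] [Algebra Kq B]
    (F : FreeAlgebra Kq (Idx r × Idx n) →ₐ[Kq] B) (hF : ∀ ⦃x y⦄, ARel r n x y → F x = F y) :
    A r n →ₐ[Kq] B :=
  RingQuot.liftAlgHom Kq ⟨F, hF⟩

/-- The generator `t_{ia}` of `A_{r,n}`. -/
def t (r n : ℕ) (i : Idx r) (a : Idx n) : A r n :=
  mkA r n (Tfree r n i a)

/-- The matrix `T_+ = ∑_{i=1}^r ∑_a E_{ia} ⊗ t_{ia}`. -/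
def Tplus (r n : ℕ) (i : IdxPos r) (a : Idx n) : A r n := t r n i.1 a

/-- The free generating matrix `∑ (-1)^{|b|(|α|+|b|)} E_{bα} ⊗ t̄_{αb}`. -/
def TbarFree (s n : ℕ) (b : Idx n) (α : Idx s) : FreeAlgebra Kq (Idx s × Idx n) :=
  ((-1 : Kq) ^ (par b * (par α + par b))) • FreeAlgebra.ι Kq (α, b)

/-- The defining relations `t̄_{αb} = (-1)^{|α|+|b|} t̄_{-α,-b}` and
`T̄^{1[3]} T̄^{2[3]} S^{12} = S^{12} T̄^{2[3]} T̄^{1[3]}` (entry by entry). -/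
inductive AbarRel (s n : ℕ) :
    FreeAlgebra Kq (Idx s × Idx n) → FreeAlgebra Kq (Idx s × Idx n) → Prop
  | neg (α : Idx s) (b : Idx n) : AbarRel s n (FreeAlgebra.ι Kq (α, b))
      (((-1 : Kq) ^ (par α + par b)) • FreeAlgebra.ι Kq (-α, -b))
  | tts (a : Idx n) (α : Idx s) (b : Idx n) (β : Idx s) : AbarRel s n
      (mulScalar
        (superMul (LinearMap.mul Kq (FreeAlgebra Kq (Idx s × Idx n)))
          (leg1 (Idx n) (TbarFree s n)) (leg2 (Idx s) (TbarFree s n))) (Smat s) a α b β)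
      (scalarMul (Smat n)
        (superMul (LinearMap.mul Kq (FreeAlgebra Kq (Idx s × Idx n)))
          (leg2 (Idx n) (TbarFree s n)) (leg1 (Idx s) (TbarFree s n))) a α b β)

/-- The dual quantum coordinate superalgebra `Ā_{s,n}`. -/
def Abar (s n : ℕ) : Type := RingQuot (AbarRel s n)

instance instRingAbar (s n : ℕ) : Ring (Abar s n) :=
  inferInstanceAs (Ring (RingQuot (AbarRel s n)))

instance instAlgebraAbar (s n : ℕ) : Algebra Kq (Abar s n) :=
  inferInstanceAs (Algebra Kq (RingQuot (AbarRel s n)))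

/-- The quotient map from the free algebra to `Ā_{s,n}`. -/
def mkAbar (s n : ℕ) : FreeAlgebra Kq (Idx s × Idx n) →ₐ[Kq] Abar s n :=
  RingQuot.mkAlgHom Kq (AbarRel s n)

theorem mkAbar_rel {s n : ℕ} {x y : FreeAlgebra Kq (Idx s × Idx n)} (h : AbarRel s n x y) :
    mkAbar s n x = mkAbar s n y :=
  RingQuot.mkAlgHom_rel Kq h

/-- The universal property of `Ā_{s,n}`. -/
def liftAbar {s n : ℕ} {B : Type} [Ring B] [Algebra Kq B]
    (F : FreeAlgebra Kq (Idx s × Idx n) →ₐ[Kq] B) (hF : ∀ ⦃x y⦄, AbarRel s n x y → F x = F y) :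
    Abar s n →ₐ[Kq] B :=
  RingQuot.liftAlgHom Kq ⟨F, hF⟩

/-- The generator `t̄_{αb}` of `Ā_{s,n}`. -/
def tbar (s n : ℕ) (α : Idx s) (b : Idx n) : Abar s n :=
  mkAbar s n (FreeAlgebra.ι Kq (α, b))

/-- The matrix `T̄ = ∑ (-1)^{|b|(|α|+|b|)} E_{bα} ⊗ t̄_{αb}`. -/
def Tbar (s n : ℕ) (b : Idx n) (α : Idx s) : Abar s n :=
  ((-1 : Kq) ^ (par b * (par α + par b))) • tbar s n α b

/-! ### The parity automorphisms -/

section parity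

theorem par_neg {N : ℕ} (i : Idx N) : par (-i) = 1 - par i := by
  have h := i.2
  simp only [Finset.mem_erase, Finset.mem_Icc] at h
  change (if -(i : ℤ) < 0 then 1 else 0) = 1 - (if (i : ℤ) < 0 then 1 else 0)
  split_ifs <;> omega

theorem par_le {N : ℕ} (i : Idx N) : par i ≤ 1 := by
  change (if (i : ℤ) < 0 then 1 else 0) ≤ 1
  split_ifs <;> omega

theorem sign_congr {a b : ℕ} (h : a % 2 = b % 2) : (-1 : Kq) ^ a = (-1) ^ b := by
  rw [neg_one_pow_eq_pow_mod_two a, neg_one_pow_eq_pow_mod_two b, h]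

theorem Smat_even {N : ℕ} (i k j l : Idx N) (h : Smat N i k j l ≠ 0) :
    (par i + par k + par j + par l) % 2 = 0 := by
  by_contra hne
  apply h
  have hj := par_le j
  have hl := par_le l
  have h1 : ¬ (i = k ∧ j = l) := by rintro ⟨rfl, rfl⟩; omega
  have h2 : ¬ (i = l ∧ k = j) := by rintro ⟨rfl, rfl⟩; omega
  have h3 : ¬ (i = -l ∧ k = -j) := by
    rintro ⟨rfl, rfl⟩
    rw [par_neg, par_neg] at hne
    omega
  simp [Smat, h1, h2, h3]

/-- `X` consists of entries on which `σ` acts by the sign of their parity. -/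
def Homog {ι κ ι' κ' M M' : Type} [SuperIndex ι] [SuperIndex κ] [SuperIndex ι'] [SuperIndex κ']
    [AddCommMonoid M] [Module Kq M] [AddCommMonoid M'] [Module Kq M']
    (π σ : M →ₗ[Kq] M') (X : SuperMat ι κ ι' κ' M) : Prop :=
  ∀ i k j l, σ (X i k j l) = ((-1 : Kq) ^ (par i + par k + par j + par l)) • π (X i k j l)

theorem Homog.superMul {ι κ μ ι' κ' μ' M N P M' N' P' : Type} [Fintype μ] [Fintype μ']
    [SuperIndex ι] [SuperIndex κ] [SuperIndex μ] [SuperIndex ι'] [SuperIndex κ'] [SuperIndex μ']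
    [AddCommMonoid M] [Module Kq M] [AddCommMonoid N] [Module Kq N]
    [AddCommMonoid P] [Module Kq P]
    [AddCommMonoid M'] [Module Kq M'] [AddCommMonoid N'] [Module Kq N']
    [AddCommMonoid P'] [Module Kq P']
    {m : M →ₗ[Kq] N →ₗ[Kq] P} {m' : M' →ₗ[Kq] N' →ₗ[Kq] P'}
    {X : SuperMat ι μ ι' μ' M} {Y : SuperMat μ κ μ' κ' N}
    {πM σM : M →ₗ[Kq] M'} {πN σN : N →ₗ[Kq] N'} {πP σP : P →ₗ[Kq] P'}
    (hπ : ∀ x y, πP (m x y) = m' (πM x) (πN y)) (hσ : ∀ x y, σP (m x y) = m' (σM x) (σN y))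
    (hX : Homog πM σM X) (hY : Homog πN σN Y) : Homog πP σP (superMul m X Y) := by
  intro i k j l
  simp only [QueerInv.superMul, map_sum, map_smul, Finset.smul_sum, hσ, hπ]
  refine Finset.sum_congr rfl fun p _ => Finset.sum_congr rfl fun u _ => ?_
  rw [hX, hY]
  simp only [map_smul, LinearMap.smul_apply, smul_smul]
  congr 1
  simp only [← pow_add]
  apply sign_congr
  omega

theorem Homog.leg1 {ι κ M M' : Type} (ν : Type) [DecidableEq ν] [SuperIndex ι] [SuperIndex κ]
    [SuperIndex ν] [AddCommMonoid M] [Module Kq M] [AddCommMonoid M'] [Module Kq M']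
    {π σ : M →ₗ[Kq] M'} {X : ι → κ → M}
    (h : ∀ i k, σ (X i k) = ((-1 : Kq) ^ (par i + par k)) • π (X i k)) :
    Homog π σ (leg1 ν X) := by
  intro i k j l
  by_cases hjl : j = l
  · subst hjl
    simp only [QueerInv.leg1, if_true, h]
    congr 1
    apply sign_congr
    omega
  · simp [QueerInv.leg1, hjl]

theorem Homog.leg2 {ι κ M M' : Type} (ν : Type) [DecidableEq ν] [SuperIndex ι] [SuperIndex κ]
    [SuperIndex ν] [AddCommMonoid M] [Module Kq M] [AddCommMonoid M'] [Module Kq M']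
    {π σ : M →ₗ[Kq] M'} {X : ι → κ → M}
    (h : ∀ i k, σ (X i k) = ((-1 : Kq) ^ (par i + par k)) • π (X i k)) :
    Homog π σ (leg2 ν X) := by
  intro i k j l
  by_cases hik : i = k
  · subst hik
    simp only [QueerInv.leg2, if_true, h]
    congr 1
    apply sign_congr
    omega
  · simp [QueerInv.leg2, hik]

theorem Homog.Smat (N : ℕ) :
    Homog (LinearMap.id : Kq →ₗ[Kq] Kq) LinearMap.id (Smat N) := by
  intro i k j l
  by_cases h : QueerInv.Smat N i k j l = 0
  · simp [h]
  · have := Smat_even i k j l h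
    rw [sign_congr (b := 0) (by omega)]
    simp

theorem Homog.scalarMul {N : ℕ} {κ κ' M M' : Type} [SuperIndex κ] [SuperIndex κ']
    [AddCommMonoid M] [Module Kq M] [AddCommMonoid M'] [Module Kq M']
    {π σ : M →ₗ[Kq] M'} {X : SuperMat (Idx N) κ (Idx N) κ' M} (hX : Homog π σ X) :
    Homog π σ (scalarMul (QueerInv.Smat N) X) :=
  Homog.superMul (m' := LinearMap.lsmul Kq M') (by simp) (by simp) (Homog.Smat N) hX

theorem Homog.mulScalar {N : ℕ} {ι ι' M M' : Type} [SuperIndex ι] [SuperIndex ι']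
    [AddCommMonoid M] [Module Kq M] [AddCommMonoid M'] [Module Kq M']
    {π σ : M →ₗ[Kq] M'} {X : SuperMat ι (Idx N) ι' (Idx N) M} (hX : Homog π σ X) :
    Homog π σ (mulScalar X (QueerInv.Smat N)) :=
  Homog.superMul (m' := (LinearMap.lsmul Kq M').flip) (by simp) (by simp) hX (Homog.Smat N)

end parity

/-- The assignment `t_{ia} ↦ (-1)^{|i|+|a|} t_{ia}` on the free algebra. -/
def parityFreeA (r n : ℕ) : FreeAlgebra Kq (Idx r × Idx n) →ₐ[Kq] A r n :=
  FreeAlgebra.lift Kq fun x => ((-1 : Kq) ^ (par x.1 + par x.2)) • t r n x.1 x.2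

theorem parityFreeA_rel (r n : ℕ) ⦃x y : FreeAlgebra Kq (Idx r × Idx n)⦄ (h : ARel r n x y) :
    parityFreeA r n x = parityFreeA r n y := by
  have hrel := mkA_rel h
  have hT : ∀ i a, (parityFreeA r n).toLinearMap (Tfree r n i a) =
      ((-1 : Kq) ^ (par i + par a)) • (mkA r n).toLinearMap
        (Tfree r n i a) := by
    intro i a
    simp [parityFreeA, Tfree, t]
  have hm : ∀ f : FreeAlgebra Kq (Idx r × Idx n) →ₐ[Kq] A r n, ∀ x y,
      f.toLinearMap (LinearMap.mul Kq (FreeAlgebra Kq (Idx r × Idx n)) x y) =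
        LinearMap.mul Kq (A r n) (f.toLinearMap x) (f.toLinearMap y) := by
    intro f x y
    simp
  cases h with
  | neg i a =>
    have h1 := hT i a
    have h2 := hT (-i) (-a)
    simp only [AlgHom.toLinearMap_apply] at h1 h2
    rw [h1, h2, hrel, par_neg, par_neg]
    congr 1
    apply sign_congr
    have := par_le i
    have := par_le a
    omega
  | stt i a j b =>
    have h1 := Homog.scalarMul (Homog.superMul (m' := LinearMap.mul Kq (A r n))
      (hm _) (hm _) (Homog.leg1 (Idx r) hT) (Homog.leg2 (Idx n) hT)) i a j b
    have h2 := Homog.mulScalar (Homog.superMul (m' := LinearMap.mul Kq (A r n))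
      (hm _) (hm _) (Homog.leg2 (Idx r) hT) (Homog.leg1 (Idx n) hT)) i a j b
    simp only [AlgHom.toLinearMap_apply] at h1 h2
    rw [h1, h2, hrel]

/-- The parity automorphism `f ↦ (-1)^{|f|} f` of the superalgebra `A_{r,n}`. -/
def parityA (r n : ℕ) : A r n →ₐ[Kq] A r n :=
  liftA (parityFreeA r n) (parityFreeA_rel r n)

/-! ### Inclusions between the superalgebras of different sizes -/

section inclusion

/-- The inclusion `I_{M|M} ⊆ I_{N|N}` for `M ≤ N`. -/
def emb {M N : ℕ} (h : M ≤ N) (i : Idx M) : Idx N :=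
  ⟨(i : ℤ), by
    have := i.2
    simp only [Finset.mem_erase, Finset.mem_Icc] at this ⊢
    omega⟩

theorem emb_injective {M N : ℕ} (h : M ≤ N) : Function.Injective (emb h) := by
  intro i j hij
  exact Subtype.ext (congrArg (fun x : Idx N => (x : ℤ)) hij)

theorem emb_neg {M N : ℕ} (h : M ≤ N) (i : Idx M) : emb h (-i) = -emb h i := rfl

theorem par_emb {M N : ℕ} (h : M ≤ N) (i : Idx M) : par (emb h i) = par i := rfl

theorem Smat_emb {M N : ℕ} (h : M ≤ N) (i k j l : Idx M) :
    Smat N (emb h i) (emb h k) (emb h j) (emb h l) = Smat M i k j l := by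
  have hlt : emb h j < emb h l ↔ j < l := Iff.rfl
  simp only [Smat, phi, ← emb_neg, (emb_injective h).eq_iff, hlt, par_emb]

theorem neg_neg_idx {N : ℕ} (i : Idx N) : - -i = i := Subtype.ext (neg_neg (i : ℤ))

theorem Smat_left_range {M N : ℕ} (h : M ≤ N) (i j : Idx M) (p u : Idx N)
    (hS : Smat N (emb h i) p (emb h j) u ≠ 0) :
    p ∈ Set.range (emb h) ∧ u ∈ Set.range (emb h) := by
  by_contra hne
  apply hS
  have h1 : ¬ (emb h i = p ∧ emb h j = u) := by
    rintro ⟨rfl, rfl⟩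
    exact hne ⟨⟨_, rfl⟩, ⟨_, rfl⟩⟩
  have h2 : ¬ (emb h i = u ∧ p = emb h j) := by
    rintro ⟨rfl, rfl⟩
    exact hne ⟨⟨_, rfl⟩, ⟨_, rfl⟩⟩
  have h3 : ¬ (emb h i = -u ∧ p = -emb h j) := by
    rintro ⟨hu, rfl⟩
    exact hne ⟨⟨-j, rfl⟩, ⟨-i, by rw [emb_neg, hu, neg_neg_idx]⟩⟩
  simp [Smat, h1, h2, h3]

theorem Smat_right_range {M N : ℕ} (h : M ≤ N) (k l : Idx M) (p u : Idx N)
    (hS : Smat N p (emb h k) u (emb h l) ≠ 0) :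
    p ∈ Set.range (emb h) ∧ u ∈ Set.range (emb h) := by
  by_contra hne
  apply hS
  have h1 : ¬ (p = emb h k ∧ u = emb h l) := by
    rintro ⟨rfl, rfl⟩
    exact hne ⟨⟨_, rfl⟩, ⟨_, rfl⟩⟩
  have h2 : ¬ (p = emb h l ∧ emb h k = u) := by
    rintro ⟨rfl, rfl⟩
    exact hne ⟨⟨_, rfl⟩, ⟨_, rfl⟩⟩
  have h3 : ¬ (p = -emb h l ∧ emb h k = -u) := by
    rintro ⟨rfl, hu⟩
    exact hne ⟨⟨-l, rfl⟩, ⟨-k, by rw [emb_neg, hu, neg_neg_idx]⟩⟩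
  simp [Smat, h1, h2, h3]

theorem sum_emb {M N : ℕ} (h : M ≤ N) {P : Type} [AddCommMonoid P] (g : Idx N → Idx N → P)
    (hg : ∀ p u, g p u ≠ 0 → p ∈ Set.range (emb h) ∧ u ∈ Set.range (emb h)) :
    ∑ p, ∑ u, g p u = ∑ p, ∑ u, g (emb h p) (emb h u) := by
  symm
  refine Fintype.sum_of_injective (emb h) (emb_injective h) _ _ (fun p hp => ?_) fun p => ?_
  · refine Finset.sum_eq_zero fun u _ => ?_
    by_contra hne
    exact hp (hg p u hne).1
  · refine Fintype.sum_of_injective (emb h) (emb_injective h) _ _ (fun u hu => ?_) fun u => rfl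
    by_contra hne
    exact hu (hg _ u hne).2

theorem scalarMul_emb {M N M₁ N₁ M₂ N₂ : ℕ} (h : M ≤ N) (h₁ : M₁ ≤ N₁) (h₂ : M₂ ≤ N₂)
    {B C : Type} [AddCommMonoid B] [Module Kq B] [AddCommMonoid C] [Module Kq C]
    (f : B →ₗ[Kq] C) (X : SuperMat (Idx M) (Idx M₁) (Idx M) (Idx M₂) B)
    (Y : SuperMat (Idx N) (Idx N₁) (Idx N) (Idx N₂) C)
    (hXY : ∀ p k u l, f (X p k u l) = Y (emb h p) (emb h₁ k) (emb h u) (emb h₂ l))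
    (i : Idx M) (k : Idx M₁) (j : Idx M) (l : Idx M₂) :
    f (scalarMul (Smat M) X i k j l) =
      scalarMul (Smat N) Y (emb h i) (emb h₁ k) (emb h j) (emb h₂ l) := by
  simp only [scalarMul, superMul, map_sum, map_smul]
  rw [sum_emb h]
  · refine Finset.sum_congr rfl fun p _ => Finset.sum_congr rfl fun u _ => ?_
    simp [Smat_emb, par_emb, hXY]
  · intro p u hne
    refine Smat_left_range h i j p u fun h0 => hne ?_
    simp [h0]

theorem mulScalar_emb {M N M₁ N₁ M₂ N₂ : ℕ} (h : M ≤ N) (h₁ : M₁ ≤ N₁) (h₂ : M₂ ≤ N₂)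
    {B C : Type} [AddCommMonoid B] [Module Kq B] [AddCommMonoid C] [Module Kq C]
    (f : B →ₗ[Kq] C) (X : SuperMat (Idx M₁) (Idx M) (Idx M₂) (Idx M) B)
    (Y : SuperMat (Idx N₁) (Idx N) (Idx N₂) (Idx N) C)
    (hXY : ∀ i p j u, f (X i p j u) = Y (emb h₁ i) (emb h p) (emb h₂ j) (emb h u))
    (i : Idx M₁) (k : Idx M) (j : Idx M₂) (l : Idx M) :
    f (mulScalar X (Smat M) i k j l) =
      mulScalar Y (Smat N) (emb h₁ i) (emb h k) (emb h₂ j) (emb h l) := by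
  simp only [mulScalar, superMul, map_sum, map_smul]
  rw [sum_emb h]
  · refine Finset.sum_congr rfl fun p _ => Finset.sum_congr rfl fun u _ => ?_
    simp [Smat_emb, par_emb, hXY]
  · intro p u hne
    refine Smat_right_range h k l p u fun h0 => hne ?_
    simp [h0]

theorem superMul_leg12 {ι κ : Type} [Fintype ι] [Fintype κ] [DecidableEq ι] [DecidableEq κ]
    [SuperIndex ι] [SuperIndex κ] {B : Type} [Ring B] [Algebra Kq B] (X : ι → κ → B)
    (i : ι) (a : κ) (j : ι) (b : κ) :
    superMul (LinearMap.mul Kq B) (leg1 ι X) (leg2 κ X) i a j b =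
      ((-1 : Kq) ^ ((par i + par a + par j + par j) * (par a + par a + par j + par b)
        + (par j + par j) * (par a + par a))) • (X i a * X j b) := by
  rw [superMul, Finset.sum_eq_single a, Finset.sum_eq_single j]
  · simp [leg1, leg2]
  · intro u _ hu
    simp [leg1, Ne.symm hu]
  · simp
  · intro p _ hp
    simp [leg2, hp]
  · simp

theorem superMul_leg21 {ι κ : Type} [Fintype ι] [Fintype κ] [DecidableEq ι] [DecidableEq κ]
    [SuperIndex ι] [SuperIndex κ] {B : Type} [Ring B] [Algebra Kq B] (X : ι → κ → B)
    (i : ι) (a : κ) (j : ι) (b : κ) :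
    superMul (LinearMap.mul Kq B) (leg2 ι X) (leg1 κ X) i a j b =
      ((-1 : Kq) ^ ((par i + par i + par j + par b) * (par i + par a + par b + par b)
        + (par j + par b) * (par i + par a))) • (X j b * X i a) := by
  rw [superMul, Finset.sum_eq_single i, Finset.sum_eq_single b]
  · simp [leg1, leg2]
  · intro u _ hu
    simp [leg1, hu]
  · simp
  · intro p _ hp
    simp [leg2, Ne.symm hp]
  · simp

section

variable {r r' n n' : ℕ} (hr : r ≤ r') (hn : n ≤ n') {B B' C : Type}
  [Ring B] [Algebra Kq B] [Ring B'] [Algebra Kq B'] [Ring C] [Algebra Kq C]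
  (F : B →ₐ[Kq] C) (G : B' →ₐ[Kq] C) (X : Idx r → Idx n → B) (X' : Idx r' → Idx n' → B')

theorem superMul_leg12_emb (h : ∀ i a, F (X i a) = G (X' (emb hr i) (emb hn a)))
    (i : Idx r) (a : Idx n) (j : Idx r) (b : Idx n) :
    F (superMul (LinearMap.mul Kq B) (leg1 _ X) (leg2 _ X) i a j b) =
      G (superMul (LinearMap.mul Kq B') (leg1 _ X') (leg2 _ X')
        (emb hr i) (emb hn a) (emb hr j) (emb hn b)) := by
  rw [superMul_leg12, superMul_leg12]
  simp only [map_smul, map_mul, h, par_emb]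

theorem superMul_leg21_emb (h : ∀ i a, F (X i a) = G (X' (emb hr i) (emb hn a)))
    (i : Idx r) (a : Idx n) (j : Idx r) (b : Idx n) :
    F (superMul (LinearMap.mul Kq B) (leg2 _ X) (leg1 _ X) i a j b) =
      G (superMul (LinearMap.mul Kq B') (leg2 _ X') (leg1 _ X')
        (emb hr i) (emb hn a) (emb hr j) (emb hn b)) := by
  rw [superMul_leg21, superMul_leg21]
  simp only [map_smul, map_mul, h, par_emb]

end

theorem map_scalarMul {N N₁ N₂ : ℕ}
    {B C : Type} [AddCommMonoid B] [Module Kq B] [AddCommMonoid C] [Module Kq C]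
    (f : B →ₗ[Kq] C) (X : SuperMat (Idx N) (Idx N₁) (Idx N) (Idx N₂) B)
    (i : Idx N) (k : Idx N₁) (j : Idx N) (l : Idx N₂) :
    f (scalarMul (Smat N) X i k j l) = scalarMul (Smat N) (fun i k j l => f (X i k j l)) i k j l := by
  simp [scalarMul, superMul]

theorem map_mulScalar {N N₁ N₂ : ℕ}
    {B C : Type} [AddCommMonoid B] [Module Kq B] [AddCommMonoid C] [Module Kq C]
    (f : B →ₗ[Kq] C) (X : SuperMat (Idx N₁) (Idx N) (Idx N₂) (Idx N) B)
    (i : Idx N₁) (k : Idx N) (j : Idx N₂) (l : Idx N) :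
    f (mulScalar X (Smat N) i k j l) = mulScalar (fun i k j l => f (X i k j l)) (Smat N) i k j l := by
  simp [mulScalar, superMul]

end inclusion

/-- The assignment `t_{ia} ↦ t_{ia}` on the free algebra. -/
def inclFreeA {r r' n n' : ℕ} (hr : r ≤ r') (hn : n ≤ n') :
    FreeAlgebra Kq (Idx r × Idx n) →ₐ[Kq] A r' n' :=
  FreeAlgebra.lift Kq fun x => t r' n' (emb hr x.1) (emb hn x.2)

theorem inclFreeA_rel {r r' n n' : ℕ} (hr : r ≤ r') (hn : n ≤ n')
    ⦃x y : FreeAlgebra Kq (Idx r × Idx n)⦄ (h : ARel r n x y) :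
    inclFreeA hr hn x = inclFreeA hr hn y := by
  have hT : ∀ i a, inclFreeA hr hn (Tfree r n i a) =
      mkA r' n' (Tfree r' n' (emb hr i) (emb hn a)) := by
    intro i a
    simp [inclFreeA, Tfree, t]
  cases h with
  | neg i a =>
    rw [hT, hT, mkA_rel (ARel.neg _ _), emb_neg, emb_neg]
  | stt i a j b =>
    have key := mkA_rel (ARel.stt (emb hr i) (emb hn a) (emb hr j) (emb hn b))
    have e1 := (scalarMul_emb hr hn hn (inclFreeA hr hn).toLinearMap _ _
      (superMul_leg12_emb hr hn _ _ _ _ hT) i a j b).trans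
      (map_scalarMul (mkA r' n').toLinearMap _ _ _ _ _).symm
    have e2 := (mulScalar_emb hn hr hr (inclFreeA hr hn).toLinearMap _ _
      (superMul_leg21_emb hr hn _ _ _ _ hT) i a j b).trans
      (map_mulScalar (mkA r' n').toLinearMap _ _ _ _ _).symm
    exact e1.trans (key.trans e2.symm)

/-- The inclusion `A_{r,n} → A_{r',n'}`, `t_{ia} ↦ t_{ia}`, for `r ≤ r'` and `n ≤ n'`. -/
def inclA {r r' n n' : ℕ} (hr : r ≤ r') (hn : n ≤ n') : A r n →ₐ[Kq] A r' n' :=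
  liftA (inclFreeA hr hn) (inclFreeA_rel hr hn)

/-- The assignment `t̄_{αb} ↦ t̄_{αb}` on the free algebra. -/
def inclFreeAbar {s s' n n' : ℕ} (hs : s ≤ s') (hn : n ≤ n') :
    FreeAlgebra Kq (Idx s × Idx n) →ₐ[Kq] Abar s' n' :=
  FreeAlgebra.lift Kq fun x => tbar s' n' (emb hs x.1) (emb hn x.2)

theorem inclFreeAbar_rel {s s' n n' : ℕ} (hs : s ≤ s') (hn : n ≤ n')
    ⦃x y : FreeAlgebra Kq (Idx s × Idx n)⦄ (h : AbarRel s n x y) :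
    inclFreeAbar hs hn x = inclFreeAbar hs hn y := by
  have hι : ∀ α b, inclFreeAbar hs hn (FreeAlgebra.ι Kq (α, b)) =
      mkAbar s' n' (FreeAlgebra.ι Kq (emb hs α, emb hn b)) := by
    intro α b
    simp [inclFreeAbar, tbar]
  have hT : ∀ b α, inclFreeAbar hs hn (TbarFree s n b α) =
      mkAbar s' n' (TbarFree s' n' (emb hn b) (emb hs α)) := by
    intro b α
    simp only [TbarFree, map_smul, hι, par_emb]
  cases h with
  | neg α b =>
    rw [map_smul, hι, hι, mkAbar_rel (AbarRel.neg _ _), map_smul, emb_neg, emb_neg,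
      par_emb, par_emb]
  | tts a α b β =>
    have key := mkAbar_rel
      (AbarRel.tts (emb hn a) (emb hs α) (emb hn b) (emb hs β))
    have e1 := (mulScalar_emb hs hn hn (inclFreeAbar hs hn).toLinearMap _ _
      (superMul_leg12_emb hn hs _ _ _ _ hT) a α b β).trans
      (map_mulScalar (mkAbar s' n').toLinearMap _ _ _ _ _).symm
    have e2 := (scalarMul_emb hn hs hs (inclFreeAbar hs hn).toLinearMap _ _
      (superMul_leg21_emb hn hs _ _ _ _ hT) a α b β).trans
      (map_scalarMul (mkAbar s' n').toLinearMap _ _ _ _ _).symm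
    exact e1.trans (key.trans e2.symm)

/-- The inclusion `Ā_{s,n} → Ā_{s',n'}`, `t̄_{αb} ↦ t̄_{αb}`, for `s ≤ s'` and `n ≤ n'`. -/
def inclAbar {s s' n n' : ℕ} (hs : s ≤ s') (hn : n ≤ n') : Abar s n →ₐ[Kq] Abar s' n' :=
  liftAbar (inclFreeAbar hs hn) (inclFreeAbar_rel hs hn)

/-! ### Linear maps on tensor products -/

/-- The super permutation `A_{r,n} ⊗ A_{r,n} → A_{r,n} ⊗ A_{r,n}`, which sends `f ⊗ g` to
`(-1)^{|f||g|} g ⊗ f` for homogeneous `f`, `g`.  Here `(1 + σ)/2` and `(1 - σ)/2`, where `σ` is the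
parity automorphism, are the projections to the even part and to the odd part. -/
def superSwap (r n : ℕ) : A r n ⊗[Kq] A r n →ₗ[Kq] A r n ⊗[Kq] A r n :=
  let p0 : A r n →ₗ[Kq] A r n := (2 : Kq)⁻¹ • (LinearMap.id + (parityA r n).toLinearMap)
  let p1 : A r n →ₗ[Kq] A r n := (2 : Kq)⁻¹ • (LinearMap.id - (parityA r n).toLinearMap)
  (TensorProduct.comm Kq (A r n) (A r n)).toLinearMap ∘ₗ
    (TensorProduct.map p0 p0 + TensorProduct.map p0 p1 + TensorProduct.map p1 p0
      - TensorProduct.map p1 p1)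

section legs

variable {U V W U' V' W' : Type} [AddCommGroup U] [Module Kq U] [AddCommGroup V] [Module Kq V]
  [AddCommGroup W] [Module Kq W] [AddCommGroup U'] [Module Kq U'] [AddCommGroup V'] [Module Kq V']
  [AddCommGroup W'] [Module Kq W']

/-- `F ⊗ 1` on a triple tensor product. -/
def onLeft (F : U ⊗[Kq] V →ₗ[Kq] U' ⊗[Kq] V') :
    (U ⊗[Kq] V) ⊗[Kq] W →ₗ[Kq] (U' ⊗[Kq] V') ⊗[Kq] W :=
  LinearMap.rTensor W F

/-- `1 ⊗ F` on a triple tensor product. -/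
def onRight (F : V ⊗[Kq] W →ₗ[Kq] V' ⊗[Kq] W') :
    (U ⊗[Kq] V) ⊗[Kq] W →ₗ[Kq] (U ⊗[Kq] V') ⊗[Kq] W' :=
  (TensorProduct.assoc Kq U V' W').symm.toLinearMap ∘ₗ LinearMap.lTensor U F ∘ₗ
    (TensorProduct.assoc Kq U V W).toLinearMap

end legs

section mult

variable (U B C : Type) [AddCommGroup U] [Module Kq U] [Ring B] [Algebra Kq B] [Ring C]
  [Algebra Kq C]

/-- `mul ⊗ 1`. -/
def mulLeft : (B ⊗[Kq] B) ⊗[Kq] U →ₗ[Kq] B ⊗[Kq] U :=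
  LinearMap.rTensor U (LinearMap.mul' Kq B)

/-- `1 ⊗ mul`. -/
def mulRight : (U ⊗[Kq] B) ⊗[Kq] B →ₗ[Kq] U ⊗[Kq] B :=
  LinearMap.lTensor U (LinearMap.mul' Kq B) ∘ₗ (TensorProduct.assoc Kq U B B).toLinearMap

variable {B C}

/-- The multiplication `(mul ⊗ mul) ∘ (1 ⊗ Y ⊗ 1)` on `B ⊗ C` induced by `Y : C ⊗ B → B ⊗ C`. -/
def twistedMul (Y : C ⊗[Kq] B →ₗ[Kq] B ⊗[Kq] C) :
    (B ⊗[Kq] C) ⊗[Kq] (B ⊗[Kq] C) →ₗ[Kq] B ⊗[Kq] C :=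
  TensorProduct.map (LinearMap.mul' Kq B) (LinearMap.mul' Kq C) ∘ₗ
    (TensorProduct.assoc Kq B B (C ⊗[Kq] C)).symm.toLinearMap ∘ₗ
    LinearMap.lTensor B
      ((TensorProduct.assoc Kq B C C).toLinearMap ∘ₗ LinearMap.rTensor C Y ∘ₗ
        (TensorProduct.assoc Kq C B C).symm.toLinearMap) ∘ₗ
    (TensorProduct.assoc Kq B C (B ⊗[Kq] C)).toLinearMap

end mult

/-- `F^{[1][3]}`: the operator `F` on the first and the third tensor factor, obtained from `F ⊗ 1`
by moving the middle factor out of the way with the super permutation. -/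
def onOuter {r n : ℕ} (F : A r n ⊗[Kq] A r n →ₗ[Kq] A r n ⊗[Kq] A r n) :
    (A r n ⊗[Kq] A r n) ⊗[Kq] A r n →ₗ[Kq] (A r n ⊗[Kq] A r n) ⊗[Kq] A r n :=
  onRight (superSwap r n) ∘ₗ onLeft F ∘ₗ onRight (superSwap r n)

/-! ### The comultiplication, the antipode and the map `Δ̃` -/

/-- `Δ` is the comultiplication `Δ°` of `A_n`: the homomorphism of superalgebras from `A_n` to the
super tensor product `A_n ⊗ A_n` with
`Δ°(t_{iα}) = ∑_b (-1)^{(|i|+|b|)(|b|+|α|)} t_{ib} ⊗ t_{bα}`. -/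
structure IsComul (n : ℕ) (Δ : A n n →ₗ[Kq] A n n ⊗[Kq] A n n) : Prop where
  map_one : Δ 1 = 1 ⊗ₜ 1
  map_mul : ∀ f g, Δ (f * g) = twistedMul (superSwap n n) (Δ f ⊗ₜ Δ g)
  map_gen : ∀ i α, Δ (t n n i α) =
    ∑ b, ((-1 : Kq) ^ ((par i + par b) * (par b + par α))) • (t n n i b ⊗ₜ[Kq] t n n b α)

/-- `Sa` is the antipode map `S° : A_n → Ā_n`: the anti-homomorphism of superalgebras,
`S°(fg) = (-1)^{|f||g|} S°(g) S°(f)`, with `S°(t_{ia}) = (-1)^{|i|(|i|+|a|)} t̄_{ai}`. -/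
structure IsAntipode (n : ℕ) (Sa : A n n →ₗ[Kq] Abar n n) : Prop where
  map_one : Sa 1 = 1
  map_mul : ∀ f g, Sa (f * g) =
    LinearMap.mul' Kq (Abar n n) (TensorProduct.map Sa Sa (superSwap n n (f ⊗ₜ g)))
  map_gen : ∀ i a, Sa (t n n i a) = ((-1 : Kq) ^ (par i * (par i + par a))) • tbar n n a i

/-- `D : A_{r,s} → A_{r,n} ⊗ Ā_{s,n}` is the restriction of `(1 ⊗ Sa) ∘ Δ : A_n → A_n ⊗ Ā_n`. -/
def IsRestriction {r s n : ℕ} (hr : r ≤ n) (hs : s ≤ n)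
    (Δ : A n n →ₗ[Kq] A n n ⊗[Kq] A n n) (Sa : A n n →ₗ[Kq] Abar n n)
    (D : A r s →ₗ[Kq] A r n ⊗[Kq] Abar s n) : Prop :=
  ∀ f : A r s,
    TensorProduct.map (inclA hr (le_refl n)).toLinearMap (inclAbar hs (le_refl n)).toLinearMap (D f)
      = LinearMap.lTensor (A n n) Sa (Δ (inclA hr hs f))

/-! ### The braiding `Υ` and the operator `Ω` -/

/-- `Y` is the map `Υ : Ā_{s,n} ⊗ A_{r,n} → A_{r,n} ⊗ Ā_{s,n}` that defines the braided
multiplication on `O_{r,s} = A_{r,n} ⊗ Ā_{s,n}`. -/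
structure IsBraiding (r s n : ℕ) (Y : Abar s n ⊗[Kq] A r n →ₗ[Kq] A r n ⊗[Kq] Abar s n) :
    Prop where
  one_tmul : ∀ f, Y (1 ⊗ₜ f) = f ⊗ₜ 1
  tmul_one : ∀ g, Y (g ⊗ₜ 1) = 1 ⊗ₜ g
  /-- `Υ(T̄^{1[3]} T_+^{2[4]}) = T_+^{2[3]} (S⁻¹)^{12} T̄^{1[4]}` -/
  gen : ∀ (b : Idx n) (α : Idx s) (i : IdxPos r) (a : Idx n),
    Y (superMul (TensorProduct.mk Kq (Abar s n) (A r n))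
        (leg1 (IdxPos r) (Tbar s n)) (leg2 (Idx s) (Tplus r n)) b α i a)
      = superMul (TensorProduct.mk Kq (A r n) (Abar s n))
        (mulScalar (leg2 (Idx n) (Tplus r n)) (SmatInv n)) (leg1 (Idx n) (Tbar s n)) b α i a
  /-- `Υ ∘ (1 ⊗ mul) = (mul ⊗ 1) ∘ (1 ⊗ Υ) ∘ (Υ ⊗ 1)` -/
  mul_right : Y ∘ₗ mulRight (Abar s n) (A r n)
    = mulLeft (Abar s n) (A r n) ∘ₗ onRight Y ∘ₗ onLeft Y
  /-- `Υ ∘ (mul ⊗ 1) = (1 ⊗ mul) ∘ (Υ ⊗ 1) ∘ (1 ⊗ Υ)` -/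
  mul_left : Y ∘ₗ mulLeft (A r n) (Abar s n)
    = mulRight (A r n) (Abar s n) ∘ₗ onLeft Y ∘ₗ onRight Y

/-- The defining properties of the operator `Ω` on `A_{r,s} ⊗ A_{r,s}`. -/
structure IsOmega (r s : ℕ) (Ω : A r s ⊗[Kq] A r s →ₗ[Kq] A r s ⊗[Kq] A r s) : Prop where
  tmul_one : ∀ f, Ω (f ⊗ₜ 1) = f ⊗ₜ 1
  one_tmul : ∀ f, Ω (1 ⊗ₜ f) = 1 ⊗ₜ f
  /-- `Ω(T_+^{1[3]} T_+^{2[4]}) = T_+^{1[3]} T_+^{2[4]} S^{12}` -/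
  gen : ∀ (i : IdxPos r) (α : Idx s) (j : IdxPos r) (β : Idx s),
    Ω (superMul (TensorProduct.mk Kq (A r s) (A r s))
        (leg1 (IdxPos r) (Tplus r s)) (leg2 (Idx s) (Tplus r s)) i α j β)
      = mulScalar (superMul (TensorProduct.mk Kq (A r s) (A r s))
        (leg1 (IdxPos r) (Tplus r s)) (leg2 (Idx s) (Tplus r s))) (Smat s) i α j β
  /-- `Ω ∘ (mul ⊗ 1) = (mul ⊗ 1) ∘ Ω^{[1][3]} ∘ Ω^{[2][3]}` -/
  mul_left : Ω ∘ₗ mulLeft (A r s) (A r s)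
    = mulLeft (A r s) (A r s) ∘ₗ onOuter Ω ∘ₗ onRight Ω
  /-- `Ω ∘ (1 ⊗ mul) = (1 ⊗ mul) ∘ Ω^{[1][3]} ∘ Ω^{[1][2]}` -/
  mul_right : Ω ∘ₗ mulRight (A r s) (A r s)
    = mulRight (A r s) (A r s) ∘ₗ onOuter Ω ∘ₗ onLeft Ω

end

end QueerInv

open QueerInv

namespace QueerInv

noncomputable section

open SuperIndex

/-! ### Signs and parities -/

/-! The first point is to get rid of the super signs. Composing S with the super flip gives a matrix
`Hm` on pairs of indices. It satisfies a Hecke relation (`Hm_mul_Hm`), hence has the inverse `Hinv`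
= `Hm` - ξ, and it satisfies the braid relation (`braid_Hm`). Because t_{ia} = t_{-i,-a}, the
positive rows generate A_{r,n}, and between them the defining relations become the relations `RTT`
of an ordinary algebra with matrix `Hm`; the negative rows of Ā_{s,n} behave in the same way with a
matrix `Hbar`. So a homomorphism out of either algebra is just a family of row vectors that
satisfies `RTT` (`exists_hom_A`, `exists_hom_Abar`).

A map C ⊗ B → B ⊗ C that is compatible with units and multiplications (`IsTwist`) turns B ⊗ C into
an associative algebra. Such a map exists as soon as B and C have matrix representations that agree
on pairs of generators (`exists_isTwist`), and the braid relation supplies these representations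
(`RTT.matL`, `RTT.matR`). For two copies of A_{r,s} this gives a twist Ψ, and Ω is Ψ followed by the
super permutation; for Ā_{s,n} and A_{r,n} it gives Υ. Both are unique because the values on pairs
of generators propagate through products. Δ° is a homomorphism into the super tensor product,
regarded as a twisted one, and S° is a homomorphism into the super-opposite algebra. The restriction
of (1 ⊗ S°)Δ° is unique because the inclusions have retractions (`map_incl_injective`).

For the multiplicativity, write D for Δ̃_{r,s}. Up to parity operators, D(T_{iα} f) = ∑_b T_{ib}
D(f) t̄_{αb} (`Dmap_Tplus_mul`): left multiplication by a generator wraps D(f) from both ends, and Υ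
plays no role. The right-hand side of the theorem obeys the same recursion (`mulDmap_lAct`),
provided that a generator t̄ standing to the right of D(g) can be brought to its left. The lemma
`exchange` states that doing this by Υ corresponds to moving T past g by Ψ; it is proved by
induction on g from the quadratic relations of Ā_{s,n} and the value of Υ at generators. Induction
on f then gives `Dmap_mul`. -/

theorem sign_congr_zmod {a b : ℕ} (h : (a : ZMod 2) = (b : ZMod 2)) :
    (-1 : Kq) ^ a = (-1) ^ b :=
  sign_congr ((ZMod.natCast_eq_natCast_iff' a b 2).1 h)

theorem par_eq {N : ℕ} (a : Idx N) : par a = 0 ∨ par a = 1 := by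
  have := par_le a
  omega

theorem idx_ne_zero {N : ℕ} (a : Idx N) : (a : ℤ) ≠ 0 := (Finset.mem_erase.1 a.2).1

theorem coe_neg {N : ℕ} (a : Idx N) : ((-a : Idx N) : ℤ) = -(a : ℤ) := rfl

theorem par_of_pos {N : ℕ} {a : Idx N} (h : 0 < (a : ℤ)) : par a = 0 :=
  if_neg (not_lt.2 h.le)

theorem par_of_neg {N : ℕ} {a : Idx N} (h : (a : ℤ) < 0) : par a = 1 := if_pos h

theorem par_idxPos {N : ℕ} (a : IdxPos N) : par a = 0 := par_of_pos a.2

theorem pos_of_par {N : ℕ} {a : Idx N} (h : par a = 0) : 0 < (a : ℤ) := by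
  rcases lt_or_gt_of_ne (idx_ne_zero a) with h' | h'
  · simp [par_of_neg h'] at h
  · exact h'

theorem neg_of_par {N : ℕ} {a : Idx N} (h : par a = 1) : (a : ℤ) < 0 := by
  rcases lt_or_gt_of_ne (idx_ne_zero a) with h' | h'
  · exact h'
  · simp [par_of_pos h'] at h

theorem neg_inj_idx {N : ℕ} {a b : Idx N} : -a = -b ↔ a = b :=
  ⟨fun h => by rw [← neg_neg_idx a, h, neg_neg_idx], fun h => by rw [h]⟩

theorem neg_eq_iff_idx {N : ℕ} {a b : Idx N} : -a = b ↔ a = -b :=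
  ⟨fun h => by rw [← h, neg_neg_idx], fun h => by rw [h, neg_neg_idx]⟩

theorem ne_neg_idx {N : ℕ} (a : Idx N) : a ≠ -a := by
  intro h
  have h1 := congrArg (fun x : Idx N => (x : ℤ)) h
  simp only [coe_neg] at h1
  exact idx_ne_zero a (by omega)

theorem neg_lt_neg_idx {N : ℕ} {a b : Idx N} : -a < -b ↔ b < a := by
  change -(a : ℤ) < -(b : ℤ) ↔ (b : ℤ) < a
  omega

theorem neg_lt_idx {N : ℕ} {a b : Idx N} : -a < b ↔ -b < a := by
  rw [← neg_lt_neg_idx, neg_neg_idx]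

theorem lt_neg_idx {N : ℕ} {a b : Idx N} : a < -b ↔ b < -a := by
  rw [← neg_lt_neg_idx, neg_neg_idx]

/-- Over `ZMod 2` the truncated subtraction of `par_neg` becomes a shift by one. Comparisons of
signs thereby turn into polynomial identities over `ZMod 2`, which are decided by exhaustion
throughout. -/
theorem par_neg_zmod {N : ℕ} (a : Idx N) : ((par (-a) : ℕ) : ZMod 2) = 1 + (par a : ZMod 2) := by
  rw [par_neg]
  rcases par_eq a with h | h <;> rw [h] <;> decide

theorem qv_ne_zero : qv ≠ 0 := RatFunc.X_ne_zero

/-! ### Row vectors and matrices of scalars -/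

/-- The row vector `X H` for a row vector `X` with entries in a module and a matrix of scalars. -/
def act {ι κ E : Type} [Fintype ι] [AddCommMonoid E] [Module Kq E] (X : ι → E)
    (H : Matrix ι κ Kq) : κ → E :=
  fun y => ∑ x, H x y • X x

theorem act_mul {ι κ μ E : Type} [Fintype ι] [Fintype κ] [AddCommMonoid E] [Module Kq E]
    (X : ι → E) (H : Matrix ι κ Kq) (K : Matrix κ μ Kq) : act X (H * K) = act (act X H) K := by
  funext y
  simp only [act, Matrix.mul_apply, Finset.sum_smul, Finset.smul_sum, smul_smul]
  rw [Finset.sum_comm]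
  refine Finset.sum_congr rfl fun x _ => Finset.sum_congr rfl fun z _ => ?_
  rw [mul_comm]

theorem act_single {ι κ : Type} [Fintype ι] [DecidableEq ι] (x : ι) (H : Matrix ι κ Kq) (y : κ) :
    act (Pi.single x (1 : Kq)) H y = H x y := by
  simp [act, Pi.single_apply]

/-- Scalar row vectors detect a matrix. Identities for `Hm` can therefore be checked with the
three-term formula `act_Hm` instead of sums over pairs of indices. -/
theorem matrix_ext_act {ι κ : Type} [Fintype ι] {H K : Matrix ι κ Kq}
    (h : ∀ X : ι → Kq, act X H = act X K) : H = K := by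
  classical
  ext x y
  rw [← act_single x H y, h, act_single]

theorem map_act {ι κ E F : Type} [Fintype ι] [AddCommMonoid E] [Module Kq E] [AddCommMonoid F]
    [Module Kq F] (f : E →ₗ[Kq] F) (X : ι → E) (H : Matrix ι κ Kq) (y : κ) :
    f (act X H y) = act (fun x => f (X x)) H y := by
  simp [act]

/-! ### The braid matrix -/

/-- The matrix `Š` obtained from `S` by composition with the super flip. -/
def Hm (n : ℕ) : Matrix (Idx n × Idx n) (Idx n × Idx n) Kq := fun x y =>
  (-1) ^ (par y.1 * par y.2 + par x.1 * (par x.2 + par y.1)) * Smat n x.2 y.1 x.1 y.2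

/-- The inverse of the matrix `Š`. -/
def Hinv (n : ℕ) : Matrix (Idx n × Idx n) (Idx n × Idx n) Kq := fun x y =>
  (-1) ^ (par x.2 * par y.2) * SmatInv n x.1 y.2 x.2 y.1

/-- Each column has at most three nonzero entries: the flip from the diagonal part of S, and one
entry from each of the two off-diagonal parts. The latter two never coincide, since no index equals
its negative. -/
theorem Hm_apply {n : ℕ} (x y : Idx n × Idx n) : Hm n x y =
    (if x = (y.2, y.1) then (-1) ^ (par y.1 * par y.2) * qv ^ phi y.1 y.2 else 0)
    + (if x = y then (if y.1 < y.2 then xi else 0) else 0)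
    + (if x = (-y.1, -y.2) then (if -y.1 < y.2 then xi * (-1) ^ par y.2 else 0) else 0) := by
  obtain ⟨u, p⟩ := x
  obtain ⟨a, b⟩ := y
  simp only [Hm, Smat, Prod.mk.injEq]
  rw [mul_add, add_assoc]
  congr 1
  · by_cases h : p = a ∧ u = b
    · obtain ⟨rfl, rfl⟩ := h
      simp only [and_self, if_true]
      congr 1
      apply sign_congr_zmod
      push_cast
      generalize (par p : ZMod 2) = x
      generalize (par u : ZMod 2) = y
      decide +revert
    · rw [if_neg h, if_neg (fun h' => h ⟨h'.2, h'.1⟩), mul_zero]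
  · have hex : (u = a ∧ p = b) → ¬ (u = -a ∧ p = -b) := by
      rintro ⟨rfl, rfl⟩ h
      exact ne_neg_idx u h.1
    by_cases h : u = a ∧ p = b
    · obtain ⟨rfl, rfl⟩ := h
      have h1 : ¬ (p = -p ∧ u = -u) := fun h => ne_neg_idx _ h.1
      have h2 : ¬ (u = -u ∧ p = -p) := fun h => ne_neg_idx _ h.1
      simp only [and_self, if_true, h1, h2, if_false, add_zero, mul_one]
      split_ifs
      · rw [mul_left_comm, ← pow_add, sign_congr_zmod (b := 0), pow_zero, mul_one]
        push_cast
        generalize (par p : ZMod 2) = x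
        generalize (par u : ZMod 2) = y
        decide +revert
      · simp
    · have h1 : ¬ (p = b ∧ a = u) := fun h' => h ⟨h'.2.symm, h'.1⟩
      simp only [h, h1, if_false, zero_add]
      by_cases h2 : u = -a ∧ p = -b
      · obtain ⟨rfl, rfl⟩ := h2
        simp only [neg_neg_idx, and_self, if_true, mul_one]
        split_ifs
        · rw [mul_left_comm, ← pow_add]
          congr 1
          apply sign_congr_zmod
          push_cast [par_neg_zmod]
          generalize (par a : ZMod 2) = x
          generalize (par b : ZMod 2) = y
          decide +revert
        · simp
      · have h3 : ¬ (p = -b ∧ a = -u) := fun h' => h2 ⟨by rw [h'.2, neg_neg_idx], h'.1⟩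
        simp [h2, h3]

theorem act_Hm {n : ℕ} {E : Type} [AddCommGroup E] [Module Kq E] (X : Idx n × Idx n → E)
    (a b : Idx n) : act X (Hm n) (a, b) =
      ((-1 : Kq) ^ (par a * par b) * qv ^ phi a b) • X (b, a) + (if a < b then xi else 0) • X (a, b)
      + (if -a < b then xi * (-1) ^ par b else 0) • X (-a, -b) := by
  simp only [act, Hm_apply, add_smul, Finset.sum_add_distrib, ite_smul, zero_smul,
    Finset.sum_ite_eq', Finset.mem_univ, if_true]

theorem phi_neg_left {n : ℕ} (a b : Idx n) : phi (-a) b = phi a b := by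
  simp only [phi, neg_eq_iff_idx, neg_neg_idx]
  ring

theorem phi_neg_right {n : ℕ} (a b : Idx n) : phi a (-b) = -phi a b := by
  simp only [phi, neg_neg_idx]
  rcases par_eq b with h | h <;> rw [par_neg, h] <;> ring

theorem phi_self {n : ℕ} (a : Idx n) : phi a a = (-1) ^ par a := by
  simp [phi, ne_neg_idx]

theorem phi_neg_self {n : ℕ} (a : Idx n) : phi (-a) a = (-1) ^ par a := by
  rw [phi_neg_left, phi_self]

theorem phi_of_ne {n : ℕ} {a b : Idx n} (h : a ≠ b) (h' : a ≠ -b) : phi a b = 0 := by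
  simp [phi, h, h']

/-- The possible relative positions of two indices. -/
theorem idx_cases {n : ℕ} (a b : Idx n) : a = b ∨ a = -b ∨ (a ≠ b ∧ a ≠ -b) := by
  tauto

/-- Columns (a, b), (b, a), (-a, -b), (-b, -a) are closed under `Hm`, so this is a finite check. If
a = ±b, it uses q - q⁻¹ = ξ. Otherwise exactly one of a < b and b < a holds, and exactly one of -a <
b and a < -b, which makes the mixed terms cancel. -/
theorem Hm_mul_Hm (n : ℕ) : Hm n * Hm n = xi • Hm n + 1 := by
  apply matrix_ext_act
  intro X
  funext ⟨a, b⟩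
  have hadd : act X (xi • Hm n + 1) (a, b) = xi * act X (Hm n) (a, b) + X (a, b) := by
    have h : ∀ x, (xi • Hm n + 1) x (a, b) • X x =
        xi * (Hm n x (a, b) • X x) + if x = (a, b) then X x else 0 := by
      intro x
      rw [Matrix.add_apply, Matrix.smul_apply, Matrix.one_apply]
      split_ifs <;> simp <;> ring
    rw [act, Finset.sum_congr rfl fun x _ => h x, Finset.sum_add_distrib, ← Finset.mul_sum]
    simp [act]
  have hq := qv_ne_zero
  rw [act_mul, hadd]
  simp only [act_Hm, neg_neg_idx, smul_eq_mul, neg_lt_neg_idx]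
  rcases idx_cases a b with rfl | rfl | ⟨h1, h2⟩
  · rcases par_eq a with h | h
    · have h3 : -a < a := by have := pos_of_par h; change -(a : ℤ) < a; omega
      have h4 : ¬ a < -a := not_lt.2 h3.le
      simp [phi_self, par_neg, h, h3, h4, xi]
      field_simp
      ring
    · have h3 : a < -a := by have := neg_of_par h; change (a : ℤ) < -a; omega
      have h4 : ¬ -a < a := not_lt.2 h3.le
      simp [phi_self, par_neg, h, h3, h4, xi]
      field_simp
      ring
  · rcases par_eq b with h | h
    · have h3 : -b < b := by have := pos_of_par h; change -(b : ℤ) < b; omega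
      have h4 : ¬ b < -b := not_lt.2 h3.le
      simp [phi_self, phi_neg_left, phi_neg_right, par_neg, neg_neg_idx, h, h3, h4, xi]
      field_simp
      ring
    · have h3 : b < -b := by have := neg_of_par h; change (b : ℤ) < -b; omega
      have h4 : ¬ -b < b := not_lt.2 h3.le
      simp [phi_self, phi_neg_left, phi_neg_right, par_neg, neg_neg_idx, h, h3, h4, xi]
      field_simp
      ring
  · have h1' : b ≠ a := Ne.symm h1
    have h2' : b ≠ -a := fun h => h2 (by rw [h, neg_neg_idx])
    have e1 := phi_of_ne h1 h2
    have e2 := phi_of_ne h1' h2'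
    have e3 : (a < b ∧ ¬ b < a) ∨ (b < a ∧ ¬ a < b) := by
      rcases lt_or_gt_of_ne h1 with h | h
      · exact Or.inl ⟨h, not_lt.2 h.le⟩
      · exact Or.inr ⟨h, not_lt.2 h.le⟩
    have e4 : (-b < a) ↔ (-a < b) := neg_lt_idx
    have e5 : (a < -b) ↔ ¬ (-a < b) := by
      have h : (a : ℤ) ≠ -b := fun h => h2 (Subtype.ext h)
      change (a : ℤ) < -b ↔ ¬ (-a : ℤ) < b
      omega
    rcases e3 with e3 | e3 <;> rcases par_eq a with ha | ha <;> rcases par_eq b with hb | hb <;>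
      by_cases h5 : -a < b <;>
      simp [e1, e2, phi_neg_left, phi_neg_right, par_neg, ha, hb, e3, e4, e5, h5] <;> ring

/-- The flip stands on the other side of S⁻¹ than of S, as the inverse of a product requires. In
this arrangement `Hinv` has the same three-term shape as `Hm`, and the two can be compared term by
term. -/
theorem SmatInv_swap {n : ℕ} (a b c u : Idx n) : Hinv n (b, u) (a, c) =
    (if (b, u) = (c, a) then (-1) ^ (par a * par c) * qv ^ (-phi c a) else 0)
    - (if (b, u) = (a, c) then (if c < a then xi else 0) else 0)
    + (if (b, u) = (-a, -c) then (if -c < a then xi * (-1) ^ par c else 0) else 0) := by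
  simp only [Hinv, SmatInv, Prod.mk.injEq]
  rw [mul_sub, sub_add]
  congr 1
  · by_cases h : b = c ∧ u = a
    · obtain ⟨rfl, rfl⟩ := h
      simp only [and_self, if_true]
    · rw [if_neg h, if_neg h, mul_zero]
  · by_cases h : b = a ∧ u = c
    · obtain ⟨rfl, rfl⟩ := h
      have h1 : ¬ (b = -b ∧ u = -u) := fun h => ne_neg_idx _ h.1
      simp only [and_self, if_true, h1, if_false, add_zero, mul_one, sub_zero]
      split_ifs
      · rw [mul_left_comm, ← pow_add, sign_congr_zmod (b := 0), pow_zero, mul_one]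
        push_cast
        generalize (par u : ZMod 2) = y
        decide +revert
      · simp
    · have h1 : ¬ (b = a ∧ c = u) := fun h' => h ⟨h'.1, h'.2.symm⟩
      simp only [h, h1, if_false, zero_add, zero_sub]
      by_cases h2 : b = -a ∧ u = -c
      · obtain ⟨rfl, rfl⟩ := h2
        simp only [neg_neg_idx, and_self, if_true, mul_one]
        split_ifs
        · rw [mul_left_comm, ← pow_add, ← mul_neg, ← neg_one_mul ((-1 : Kq) ^ par c), ← pow_succ']
          congr 1
          apply sign_congr_zmod
          push_cast [par_neg_zmod]
          generalize (par c : ZMod 2) = y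
          decide +revert
        · simp
      · have h3 : ¬ (b = -a ∧ c = -u) := fun h' => h2 ⟨h'.1, by rw [h'.2, neg_neg_idx]⟩
        simp [h2, h3]

theorem qv_zpow_phi {n : ℕ} (a : Idx n) :
    (-1 : Kq) ^ (par a * par a) * qv ^ (-phi a a) = (-1) ^ (par a * par a) * qv ^ phi a a - xi := by
  rw [phi_self]
  rcases par_eq a with h | h <;> simp [h, xi] <;> ring

/-- By the Hecke relation the inverse of `Hm` has to be `Hm` - ξ; here the explicit formula for S⁻¹
is matched with it. Away from the diagonal a < c and c < a are complementary, and for a = c the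
difference ξ comes from q^{±1}. -/
theorem Hinv_eq (n : ℕ) : Hinv n = Hm n - xi • 1 := by
  ext ⟨b, u⟩ ⟨a, c⟩
  rw [SmatInv_swap, Matrix.sub_apply, Hm_apply, Matrix.smul_apply, Matrix.one_apply, smul_eq_mul]
  have e4 : (-c < a) ↔ (-a < c) := neg_lt_idx
  simp only [e4]
  rw [add_sub_right_comm]
  congr 1
  rcases idx_cases a c with rfl | rfl | ⟨h1, h2⟩
  · by_cases h : (b, u) = (a, a)
    · simp only [h, if_true, lt_irrefl, if_false, qv_zpow_phi]
      ring
    · simp [h]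
  · have h0 : ((c, -c) : Idx n × Idx n) ≠ (-c, c) := fun h => ne_neg_idx c (Prod.ext_iff.1 h).1
    have e1 : phi c (-c) = -phi (-c) c := by rw [phi_neg_right, phi_neg_left]
    have e2 : (-c < c) ↔ ¬ (c < -c) := by
      have h := idx_ne_zero c
      change (-c : ℤ) < c ↔ ¬ (c : ℤ) < -c
      omega
    by_cases h : (b, u) = (c, -c)
    · simp only [h, if_true, h0, if_false, e1, neg_neg]
      ring
    · by_cases h' : (b, u) = (-c, c)
      · rw [h'] at h ⊢
        by_cases h5 : c < -c <;> simp [h, e2, h5]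
      · simp [h, h']
  · have h1' : c ≠ a := Ne.symm h1
    have h2' : c ≠ -a := fun h => h2 (by rw [h, neg_neg_idx])
    have h3 : (a < c) ↔ ¬ (c < a) := by
      have h : (a : ℤ) ≠ c := fun h => h1 (Subtype.ext h)
      change (a : ℤ) < c ↔ ¬ (c : ℤ) < a
      omega
    simp only [phi_of_ne h1 h2, phi_of_ne h1' h2', neg_zero]
    by_cases h : (b, u) = (a, c)
    · rw [h]
      by_cases h5 : c < a <;> simp [h3, h5]
    · simp [h]

theorem Hm_mul_Hinv (n : ℕ) : Hm n * Hinv n = 1 := by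
  rw [Hinv_eq, mul_sub, Hm_mul_Hm]
  simp

theorem Hinv_mul_Hm (n : ℕ) : Hinv n * Hm n = 1 := by
  rw [Hinv_eq, sub_mul, Hm_mul_Hm]
  simp

/-! ### Matrices on three tensor factors -/

section triple

variable {V : Type} [Fintype V] [DecidableEq V]

/-- The matrix `H ⊗ 1`. -/
def tri12 (H : Matrix (V × V) (V × V) Kq) : Matrix (V × V × V) (V × V × V) Kq :=
  fun x y => if x.2.2 = y.2.2 then H (x.1, x.2.1) (y.1, y.2.1) else 0

/-- The matrix `1 ⊗ H`. -/
def tri23 (H : Matrix (V × V) (V × V) Kq) : Matrix (V × V × V) (V × V × V) Kq :=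
  fun x y => if x.1 = y.1 then H x.2 y.2 else 0

variable {E : Type} [AddCommMonoid E] [Module Kq E]

theorem act_tri12 (X : V × V × V → E) (H : Matrix (V × V) (V × V) Kq) (a b c : V) :
    act X (tri12 H) (a, b, c) = act (fun x => X (x.1, x.2, c)) H (a, b) := by
  simp only [act, tri12, Fintype.sum_prod_type, ite_smul, zero_smul, Finset.sum_ite_eq',
    Finset.mem_univ, if_true]

theorem act_tri23 (X : V × V × V → E) (H : Matrix (V × V) (V × V) Kq) (a b c : V) :
    act X (tri23 H) (a, b, c) = act (fun x => X (a, x)) H (b, c) := by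
  simp only [act, tri23]
  rw [Fintype.sum_prod_type]
  rw [Finset.sum_eq_single a]
  · simp
  · intro d _ hd
    simp [hd]
  · simp

theorem tri12_one : tri12 (1 : Matrix (V × V) (V × V) Kq) = 1 := by
  ext ⟨a, b, c⟩ ⟨a', b', c'⟩
  simp only [tri12, Matrix.one_apply, Prod.mk.injEq]
  split_ifs <;> tauto

theorem tri23_one : tri23 (1 : Matrix (V × V) (V × V) Kq) = 1 := by
  ext ⟨a, b, c⟩ ⟨a', b', c'⟩
  simp only [tri23, Matrix.one_apply, Prod.mk.injEq]
  split_ifs <;> tauto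

theorem tri12_mul (H K : Matrix (V × V) (V × V) Kq) : tri12 (H * K) = tri12 H * tri12 K := by
  apply matrix_ext_act
  intro X
  funext ⟨a, b, c⟩
  simp only [act_mul, act_tri12]

theorem tri23_mul (H K : Matrix (V × V) (V × V) Kq) : tri23 (H * K) = tri23 H * tri23 K := by
  apply matrix_ext_act
  intro X
  funext ⟨a, b, c⟩
  rw [act_tri23, act_mul, act_mul, act_tri23]
  congr 1
  funext x
  rw [act_tri23]

/-- The operator `X ↦ X H` on row vectors. -/
def actL {ι κ : Type} [Fintype ι] (H : Matrix ι κ Kq) : (ι → Kq) →ₗ[Kq] (κ → Kq) where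
  toFun X := act X H
  map_add' X Y := by
    funext y
    simp [act, mul_add, Finset.sum_add_distrib]
  map_smul' c X := by
    funext y
    simp only [act, Pi.smul_apply, smul_eq_mul, RingHom.id_apply, Finset.mul_sum]
    exact Finset.sum_congr rfl fun x _ => by ring

end triple

/-- The relations of the Hecke-Clifford superalgebra imply that the Clifford generators permute
the defect of the braid relation. -/
theorem hecke_clifford_braid {K R : Type} [CommRing K] [Ring R] [Algebra K R] {h₁ h₂ c₁ c₂ c₃ : R}
    {x : K}
    (s₁ : h₁ * h₁ = x • h₁ + 1) (s₂ : h₂ * h₂ = x • h₂ + 1)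
    (a₁ : c₁ * h₁ = h₁ * c₂) (a₂ : c₂ * h₁ = h₁ * c₁ - x • c₁ + x • c₂) (a₃ : c₃ * h₁ = h₁ * c₃)
    (b₁ : c₁ * h₂ = h₂ * c₁) (b₂ : c₂ * h₂ = h₂ * c₃) (b₃ : c₃ * h₂ = h₂ * c₂ - x • c₂ + x • c₃) :
    c₁ * (h₁ * h₂ * h₁ - h₂ * h₁ * h₂) = (h₁ * h₂ * h₁ - h₂ * h₁ * h₂) * c₃ ∧
    c₂ * (h₁ * h₂ * h₁ - h₂ * h₁ * h₂) = (h₁ * h₂ * h₁ - h₂ * h₁ * h₂) * c₂ ∧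
    c₃ * (h₁ * h₂ * h₁ - h₂ * h₁ * h₂) = (h₁ * h₂ * h₁ - h₂ * h₁ * h₂) * c₁ := by
  have a₁' : ∀ z, c₁ * (h₁ * z) = h₁ * (c₂ * z) := fun z => by rw [← mul_assoc, a₁, mul_assoc]
  have a₂' : ∀ z, c₂ * (h₁ * z) = h₁ * (c₁ * z) - x • (c₁ * z) + x • (c₂ * z) := fun z => by
    rw [← mul_assoc, a₂, add_mul, sub_mul, mul_assoc, smul_mul_assoc, smul_mul_assoc]
  have a₃' : ∀ z, c₃ * (h₁ * z) = h₁ * (c₃ * z) := fun z => by rw [← mul_assoc, a₃, mul_assoc]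
  have b₁' : ∀ z, c₁ * (h₂ * z) = h₂ * (c₁ * z) := fun z => by rw [← mul_assoc, b₁, mul_assoc]
  have b₂' : ∀ z, c₂ * (h₂ * z) = h₂ * (c₃ * z) := fun z => by rw [← mul_assoc, b₂, mul_assoc]
  have b₃' : ∀ z, c₃ * (h₂ * z) = h₂ * (c₂ * z) - x • (c₂ * z) + x • (c₃ * z) := fun z => by
    rw [← mul_assoc, b₃, add_mul, sub_mul, mul_assoc, smul_mul_assoc, smul_mul_assoc]
  have s₁' : ∀ z, h₁ * (h₁ * z) = x • (h₁ * z) + z := fun z => by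
    rw [← mul_assoc, s₁, add_mul, smul_mul_assoc, one_mul]
  have s₂' : ∀ z, h₂ * (h₂ * z) = x • (h₂ * z) + z := fun z => by
    rw [← mul_assoc, s₂, add_mul, smul_mul_assoc, one_mul]
  refine ⟨?_, ?_, ?_⟩
  -- For `c₁` the factor moves through both words by commutation alone; the other two generators
  -- also need the quadratic relations.
  · simp only [mul_sub, sub_mul, mul_assoc, a₁, b₁, b₂, a₃, a₁', a₂', a₃', b₁', b₂', b₃']
  all_goals
    simp only [mul_sub, sub_mul, mul_add, mul_assoc, a₁, a₂, a₃, b₁, b₂, b₃, a₁', a₂', a₃', b₁', b₂',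
      b₃', mul_smul_comm, s₁', s₂', s₁, s₂]
    module

/-! ### The braid relation -/

theorem neg_lt_self_iff_idx {n : ℕ} (a : Idx n) : -a < a ↔ ¬ a < -a := by
  have h := idx_ne_zero a
  change (-a : ℤ) < a ↔ ¬ (a : ℤ) < -a
  omega

theorem lt_iff_not_lt_idx {n : ℕ} {a b : Idx n} (h : a ≠ b) : b < a ↔ ¬ a < b := by
  have h : (a : ℤ) ≠ b := fun h' => h (Subtype.ext h')
  change (b : ℤ) < a ↔ ¬ (a : ℤ) < b
  omega

/-- This is the queer symmetry of S: the odd operator that negates an index, with its super sign,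
passes through `Hm` and moves to the neighbouring tensor factor. It is what allows the braid
relation to be reduced to negative indices. -/
theorem clifford_left {n : ℕ} (X : Idx n × Idx n → Kq) (a b : Idx n) :
    (-1) ^ par a * act X (Hm n) (-a, b) =
      act (fun x => (-1) ^ (par x.1 + par x.2) * X (x.1, -x.2)) (Hm n) (a, b) := by
  simp only [act_Hm, phi_neg_left, neg_neg_idx, smul_eq_mul]
  rcases par_eq a with ha | ha <;> rcases par_eq b with hb | hb <;> simp [par_neg, ha, hb] <;>
    split_ifs <;> ring

/-- In the opposite direction the operator is conjugated by the inverse matrix `Hm` - ξ rather than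
by `Hm`; this accounts for the two terms with ξ. -/
theorem clifford_right {n : ℕ} (X : Idx n × Idx n → Kq) (a b : Idx n) :
    (-1) ^ (par a + par b) * act X (Hm n) (a, -b) =
      act (fun x => (-1) ^ par x.1 * X (-x.1, x.2)) (Hm n) (a, b)
        - xi * ((-1) ^ par a * X (-a, b)) + xi * ((-1) ^ (par a + par b) * X (a, -b)) := by
  simp only [act_Hm, phi_neg_right, neg_neg_idx, smul_eq_mul, neg_lt_neg_idx]
  have hq := qv_ne_zero
  rcases idx_cases a b with rfl | rfl | ⟨h1, h2⟩
  · have h4 := neg_lt_self_iff_idx a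
    rcases par_eq a with h | h <;> by_cases h5 : a < -a <;>
      simp [phi_self, par_neg, h, h4, h5, xi] <;> field_simp <;> ring
  · have h4 := neg_lt_self_iff_idx b
    rcases par_eq b with h | h <;> by_cases h5 : b < -b <;>
      simp [phi_self, phi_neg_left, par_neg, neg_neg_idx, h, h4, h5, xi] <;> field_simp <;> ring
  · have h3 := lt_iff_not_lt_idx h1
    have h4 : a < -b ↔ ¬ -a < b := by
      rw [neg_lt_idx]
      exact lt_iff_not_lt_idx (Ne.symm h2)
    rcases par_eq a with ha | ha <;> rcases par_eq b with hb | hb <;> by_cases h5 : a < b <;>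
      by_cases h6 : -a < b <;>
      simp [phi_of_ne h1 h2, par_neg, ha, hb, h3, h4, h5, h6] <;> ring

/-- The operator that substitutes `f v` for the index `v` with a sign. -/
def flipOp {ι : Type} (e : ι → ℕ) (f : ι → ι) : Module.End Kq (ι → Kq) where
  toFun X v := (-1) ^ e v * X (f v)
  map_add' X Y := by
    funext v
    simp [mul_add]
  map_smul' c X := by
    funext v
    simp only [Pi.smul_apply, smul_eq_mul, RingHom.id_apply]
    ring

theorem flipOp_apply {ι : Type} (e : ι → ℕ) (f : ι → ι) (X : ι → Kq) (v : ι) :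
    flipOp e f X v = (-1) ^ e v * X (f v) := rfl

theorem actL_apply {ι κ : Type} [Fintype ι] (H : Matrix ι κ Kq) (X : ι → Kq) :
    actL H X = act X H := rfl

theorem act_Hm_sign {n : ℕ} (X : Idx n × Idx n → Kq) (a b : Idx n) :
    act (fun x => (-1 : Kq) ^ (par x.1 + par x.2) * X x) (Hm n) (a, b) =
      (-1) ^ (par a + par b) * act X (Hm n) (a, b) := by
  simp only [act_Hm, smul_eq_mul]
  rcases par_eq a with ha | ha <;> rcases par_eq b with hb | hb <;> simp [par_neg, ha, hb] <;> ring

theorem act_mul_left {ι κ : Type} [Fintype ι] (c : Kq) (X : ι → Kq) (H : Matrix ι κ Kq) (y : κ) :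
    act (fun x => c * X x) H y = c * act X H y := by
  simp only [act, smul_eq_mul, Finset.mul_sum]
  exact Finset.sum_congr rfl fun x _ => by ring

theorem hecke_tri {n : ℕ} (T : Matrix (Idx n × Idx n × Idx n) (Idx n × Idx n × Idx n) Kq)
    (hT : T * T = xi • T + 1) : actL T * actL T = xi • actL T + 1 := by
  apply LinearMap.ext
  intro X
  rw [Module.End.mul_apply, actL_apply, actL_apply, ← act_mul, hT]
  funext y
  simp only [act, Matrix.add_apply, Matrix.smul_apply, Matrix.one_apply, smul_eq_mul, add_mul,
    Finset.sum_add_distrib, LinearMap.add_apply, LinearMap.smul_apply, actL_apply, Pi.add_apply,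
    Pi.smul_apply, Finset.mul_sum, mul_assoc, ite_mul, one_mul, zero_mul, Finset.sum_ite_eq',
    Finset.mem_univ, if_true, Module.End.one_apply]

/-- For negative x, y the condition -x < y fails, so the third term of `act_Hm` disappears and `Hm`
is the Hecke matrix of type A with diagonal entries -q⁻¹. What remains is a check over the possible
orders of three indices. -/
theorem braid_of_neg {n : ℕ} (X : Idx n × Idx n × Idx n → Kq) (a b c : Idx n) (ha : par a = 1)
    (hb : par b = 1) (hc : par c = 1) :
    act X (tri12 (Hm n) * tri23 (Hm n) * tri12 (Hm n)) (a, b, c) =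
      act X (tri23 (Hm n) * tri12 (Hm n) * tri23 (Hm n)) (a, b, c) := by
  have key : ∀ (Z : Idx n × Idx n → Kq) (x y : Idx n), par x = 1 → par y = 1 →
      act Z (Hm n) (x, y) =
        (if x = y then - qv⁻¹ else -1) * Z (y, x) + (if x < y then xi else 0) * Z (x, y) := by
    intro Z x y hx hy
    have h1 := neg_of_par hx
    have h2 := neg_of_par hy
    have h3 : ¬ (-x < y) := by
      change ¬ (-(x : ℤ) < y)
      omega
    have h4 : x ≠ -y := by
      intro h
      have := congrArg (fun x : Idx n => (x : ℤ)) h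
      simp only [coe_neg] at this
      omega
    rw [act_Hm, if_neg h3]
    by_cases h : x = y
    · subst h
      simp [hx, phi_self]
    · simp [hx, hy, phi_of_ne h h4, h]
  have hq := qv_ne_zero
  simp only [act_mul, act_tri12, act_tri23, key, ha, hb, hc]
  have sgl : ∀ x y : Idx n, x < y → (x ≠ y ∧ y ≠ x ∧ ¬ y < x) := fun x y h =>
    ⟨h.ne, h.ne', not_lt.2 h.le⟩
  rcases lt_trichotomy a b with h1 | rfl | h1
  · rcases lt_trichotomy b c with h2 | rfl | h2
    · have h3 := h1.trans h2
      simp [h1, h2, h3, sgl _ _ h1, sgl _ _ h2, sgl _ _ h3]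
      ring
    · simp [h1, sgl _ _ h1, xi]
      field_simp
      ring
    · rcases lt_trichotomy a c with h3 | rfl | h3
      · simp [h1, h2, h3, sgl _ _ h1, sgl _ _ h2, sgl _ _ h3]
        ring
      · simp [h1, sgl _ _ h1, xi]
        field_simp
      · simp [h1, h2, sgl _ _ h1, sgl _ _ h2, sgl _ _ h3]
  · rcases lt_trichotomy a c with h2 | rfl | h2
    · simp [h2, sgl _ _ h2, xi]
      field_simp
      ring
    · simp
    · simp [h2, sgl _ _ h2, xi]
  · rcases lt_trichotomy b c with h2 | rfl | h2
    · rcases lt_trichotomy a c with h3 | rfl | h3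
      · simp [h1, h2, h3, sgl _ _ h1, sgl _ _ h2, sgl _ _ h3]
        ring
      · simp [h1, sgl _ _ h1, xi]
        field_simp
      · simp [h1, h2, sgl _ _ h1, sgl _ _ h2, sgl _ _ h3]
    · simp [h1, sgl _ _ h1, xi]
    · have h3 := h2.trans h1
      simp [sgl _ _ h1, sgl _ _ h2, sgl _ _ h3]

/-- A check over all signs and orders of three indices is avoided. The defect of the braid relation
vanishes in columns with negative indices by `braid_of_neg`, and it exchanges the Clifford operators
among themselves by `hecke_clifford_braid`. These operators change the sign of one index at a time,
so the defect vanishes in every column. -/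
theorem braid_Hm (n : ℕ) : tri12 (Hm n) * tri23 (Hm n) * tri12 (Hm n) =
    tri23 (Hm n) * tri12 (Hm n) * tri23 (Hm n) := by
  set h₁ : Module.End Kq (Idx n × Idx n × Idx n → Kq) := actL (tri12 (Hm n)) with hh₁
  set h₂ : Module.End Kq (Idx n × Idx n × Idx n → Kq) := actL (tri23 (Hm n)) with hh₂
  -- The exponents are those of an odd operator that passes the factors on its left, together with
  -- the parity of the factor on which it acts.
  set c₁ : Module.End Kq (Idx n × Idx n × Idx n → Kq) :=
    flipOp (fun v => par v.1) (fun v => (-v.1, v.2)) with hc₁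
  set c₂ : Module.End Kq (Idx n × Idx n × Idx n → Kq) :=
    flipOp (fun v => par v.1 + par v.2.1) (fun v => (v.1, -v.2.1, v.2.2)) with hc₂
  set c₃ : Module.End Kq (Idx n × Idx n × Idx n → Kq) :=
    flipOp (fun v => par v.1 + par v.2.1 + par v.2.2) (fun v => (v.1, v.2.1, -v.2.2)) with hc₃
  have s₁ : h₁ * h₁ = xi • h₁ + 1 := hecke_tri _ (by
    rw [← tri12_mul, Hm_mul_Hm]
    ext x y
    simp only [tri12, Matrix.add_apply, Matrix.smul_apply, Matrix.one_apply, smul_eq_mul, mul_ite,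
      mul_zero, Prod.mk.injEq, Prod.ext_iff]
    split_ifs <;> first | tauto | simp)
  have s₂ : h₂ * h₂ = xi • h₂ + 1 := hecke_tri _ (by
    rw [← tri23_mul, Hm_mul_Hm]
    ext x y
    simp only [tri23, Matrix.add_apply, Matrix.smul_apply, Matrix.one_apply, smul_eq_mul, mul_ite,
      mul_zero, Prod.ext_iff]
    split_ifs <;> first | tauto | simp)
  have a₁ : c₁ * h₁ = h₁ * c₂ := by
    refine LinearMap.ext fun X => funext fun ⟨a, b, c⟩ => ?_
    simp only [Module.End.mul_apply, hc₁, hc₂, hh₁, flipOp_apply, actL_apply, act_tri12]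
    exact clifford_left (fun x => X (x.1, x.2, c)) a b
  have a₂ : c₂ * h₁ = h₁ * c₁ - xi • c₁ + xi • c₂ := by
    refine LinearMap.ext fun X => funext fun ⟨a, b, c⟩ => ?_
    simp only [Module.End.mul_apply, hc₁, hc₂, hh₁, flipOp_apply, actL_apply, act_tri12,
      LinearMap.add_apply, LinearMap.sub_apply, LinearMap.smul_apply, Pi.add_apply, Pi.sub_apply,
      Pi.smul_apply, smul_eq_mul]
    exact clifford_right (fun x => X (x.1, x.2, c)) a b
  have a₃ : c₃ * h₁ = h₁ * c₃ := by
    refine LinearMap.ext fun X => funext fun ⟨a, b, c⟩ => ?_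
    simp only [Module.End.mul_apply, hc₃, hh₁, flipOp_apply, actL_apply, act_tri12]
    simp only [pow_add _ _ (par c), mul_assoc]
    rw [act_Hm_sign (fun x => (-1) ^ par c * X (x.1, x.2, -c)), act_mul_left]
  have b₁ : c₁ * h₂ = h₂ * c₁ := by
    refine LinearMap.ext fun X => funext fun ⟨a, b, c⟩ => ?_
    simp only [Module.End.mul_apply, hc₁, hh₂, flipOp_apply, actL_apply, act_tri23]
    rw [act_mul_left]
  have b₂ : c₂ * h₂ = h₂ * c₃ := by
    refine LinearMap.ext fun X => funext fun ⟨a, b, c⟩ => ?_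
    simp only [Module.End.mul_apply, hc₂, hc₃, hh₂, flipOp_apply, actL_apply, act_tri23, pow_add,
      mul_assoc]
    rw [act_mul_left]
    congr 1
    simpa only [pow_add, mul_assoc] using clifford_left (fun x => X (a, x)) b c
  have b₃ : c₃ * h₂ = h₂ * c₂ - xi • c₂ + xi • c₃ := by
    refine LinearMap.ext fun X => funext fun ⟨a, b, c⟩ => ?_
    simp only [Module.End.mul_apply, hc₂, hc₃, hh₂, flipOp_apply, actL_apply, act_tri23,
      LinearMap.add_apply, LinearMap.sub_apply, LinearMap.smul_apply, Pi.add_apply, Pi.sub_apply,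
      Pi.smul_apply, smul_eq_mul]
    have h := clifford_right (fun x => X (a, x)) b c
    simp only [add_assoc, pow_add _ (par a), mul_assoc]
    rw [act_mul_left (c := (-1) ^ par a)]
    linear_combination (-1) ^ par a * h
  obtain ⟨k₁, k₂, k₃⟩ := hecke_clifford_braid s₁ s₂ a₁ a₂ a₃ b₁ b₂ b₃
  set D := h₁ * h₂ * h₁ - h₂ * h₁ * h₂ with hD
  -- Acting on row vectors reverses products, which does no harm here because both words are
  -- palindromes.
  have hDX : ∀ X v, act X (tri12 (Hm n) * tri23 (Hm n) * tri12 (Hm n)) v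
      - act X (tri23 (Hm n) * tri12 (Hm n) * tri23 (Hm n)) v = D X v := fun X v => by
    simp only [act_mul]
    rfl
  have hne : ∀ m : ℕ, (-1 : Kq) ^ m ≠ 0 := fun m => pow_ne_zero _ (by norm_num)
  have z₀ : ∀ X a b c, par a = 1 → par b = 1 → par c = 1 → D X (a, b, c) = 0 := by
    intro X a b c ha hb hc
    have := braid_of_neg X a b c ha hb hc
    rwa [← sub_eq_zero, hDX] at this
  have z₁ : ∀ X a b c, par b = 1 → par c = 1 → D X (a, b, c) = 0 := by
    intro X a b c hb hc
    rcases par_eq a with ha | ha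
    · have h := congrFun (LinearMap.congr_fun k₁ X) (-a, b, c)
      simp only [Module.End.mul_apply] at h
      rw [z₀ (c₃ X) (-a) b c (by rw [par_neg, ha]) hb hc, hc₁, flipOp_apply] at h
      simpa [neg_neg_idx, hne] using h
    · exact z₀ X a b c ha hb hc
  have z₂ : ∀ X a b c, par c = 1 → D X (a, b, c) = 0 := by
    intro X a b c hc
    rcases par_eq b with hb | hb
    · have h := congrFun (LinearMap.congr_fun k₂ X) (a, -b, c)
      simp only [Module.End.mul_apply] at h
      rw [z₁ (c₂ X) a (-b) c (by rw [par_neg, hb]) hc, hc₂, flipOp_apply] at h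
      simpa [neg_neg_idx, hne] using h
    · exact z₁ X a b c hb hc
  have z₃ : ∀ X a b c, D X (a, b, c) = 0 := by
    intro X a b c
    rcases par_eq c with hc | hc
    · have h := congrFun (LinearMap.congr_fun k₃ X) (a, b, -c)
      simp only [Module.End.mul_apply] at h
      rw [z₂ (c₁ X) a b (-c) (by rw [par_neg, hc]), hc₃, flipOp_apply] at h
      simpa [neg_neg_idx, hne] using h
    · exact z₂ X a b c hc
  apply matrix_ext_act
  intro X
  funext ⟨a, b, c⟩
  rw [← sub_eq_zero, hDX, z₃ X a b c]

/-! ### Quadratic relations and matrix representations -/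

section RTT

/-- The relations `c_{ij} T_i ⊗ T_j + e_{ij} T_j ⊗ T_i = (T_j ⊗ T_i) H` between row vectors. -/
def RTT {I V E : Type} [Fintype V] [Ring E] [Algebra Kq E] (c e : I → I → Kq)
    (H : Matrix (V × V) (V × V) Kq) (T : I → V → E) : Prop :=
  ∀ i j a b, c i j • (T i a * T j b) + e i j • (T j a * T i b) =
    act (fun x : V × V => T j x.1 * T i x.2) H (a, b)

variable {I V E : Type} [Fintype V] [DecidableEq V] [Ring E] [Algebra Kq E]

/-- The row vector on three factors that is `X` on the last two, at the index `u` of the first. -/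
def extL (u : V) (X : V × V → E) : V × V × V → E := fun v => if v.1 = u then X v.2 else 0

/-- The row vector on three factors that is `X` on the first two, at the index `p` of the last. -/
def extR (p : V) (X : V × V → E) : V × V × V → E :=
  fun v => if v.2.2 = p then X (v.1, v.2.1) else 0

theorem act_extL (u : V) (X : V × V → E) (H : Matrix (V × V) (V × V) Kq) :
    act (extL u X) (tri23 H) = extL u (act X H) := by
  funext ⟨a, b, c⟩
  rw [act_tri23]
  by_cases h : a = u
  · simp [extL, h]
  · simp [extL, h, act]

theorem act_extR (p : V) (X : V × V → E) (H : Matrix (V × V) (V × V) Kq) :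
    act (extR p X) (tri12 H) = extR p (act X H) := by
  funext ⟨a, b, c⟩
  rw [act_tri12]
  by_cases h : c = p
  · simp [extR, h]
  · simp [extR, h, act]

/-- The matrix `∑_p K(u,p;a,β) T_p` with rows `u` and columns `β`. -/
def matL (K : Matrix (V × V) (V × V) Kq) (T : I → V → E) (i : I) (a : V) : Matrix V V E :=
  fun u β => ∑ p, K (u, p) (a, β) • T i p

/-- The matrix `∑_u K(u,p;α,a) T_u` with rows `α` and columns `p`. -/
def matR (K : Matrix (V × V) (V × V) Kq) (T : I → V → E) (i : I) (a : V) : Matrix V V E :=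
  fun α p => ∑ u, K (u, p) (α, a) • T i u

/-- The contracted index of the matrix product is the middle one shared by the two copies of `K`,
placed on the first two and on the last two of three factors. The row index `u` is kept as a frozen
first factor. -/
theorem matL_mul (K : Matrix (V × V) (V × V) Kq) (T : I → V → E) (i j : I) (a b u β : V) :
    (matL K T i a * matL K T j b) u β =
      act (extL u fun x => T i x.1 * T j x.2) (tri12 K * tri23 K) (a, b, β) := by
  rw [act_mul, act_tri23, Matrix.mul_apply]
  simp only [matL, act, Fintype.sum_prod_type]
  refine Finset.sum_congr rfl fun m _ => ?_
  rw [Finset.mul_sum]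
  refine Finset.sum_congr rfl fun p' _ => ?_
  rw [mul_smul_comm, Finset.sum_mul]
  congr 1
  symm
  rw [Finset.sum_eq_single u]
  · refine Finset.sum_congr rfl fun p _ => ?_
    rw [Finset.sum_eq_single p']
    · simp [tri12, extL]
    · intro x _ hx
      simp [tri12, hx]
    · simp
  · intro x _ hx
    simp [extL, hx]
  · simp

theorem matR_mul (K : Matrix (V × V) (V × V) Kq) (T : I → V → E) (i j : I) (a b α p : V) :
    (matR K T i a * matR K T j b) α p =
      act (extR p fun x => T i x.1 * T j x.2) (tri23 K * tri12 K) (α, a, b) := by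
  rw [act_mul, act_tri12, Matrix.mul_apply]
  simp only [matR, act, Fintype.sum_prod_type]
  rw [Finset.sum_comm]
  refine Finset.sum_congr rfl fun m _ => ?_
  rw [Finset.sum_mul]
  refine Finset.sum_congr rfl fun u _ => ?_
  rw [smul_mul_assoc, Finset.mul_sum]
  congr 1
  symm
  rw [Finset.sum_eq_single u]
  · refine Finset.sum_congr rfl fun u' _ => ?_
    rw [Finset.sum_eq_single p]
    · simp [tri23, extR]
    · intro x _ hx
      simp [extR, hx]
    · simp
  · intro x _ hx
    simp [tri23, hx]
  · simp

theorem act_linear {ι κ : Type} [Fintype ι] (c e : Kq) (X Y : ι → E) (H : Matrix ι κ Kq) (y : κ) :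
    c • act X H y + e • act Y H y = act (fun x => c • X x + e • Y x) H y := by
  simp only [act, Finset.smul_sum, ← Finset.sum_add_distrib, smul_add]
  refine Finset.sum_congr rfl fun x _ => ?_
  rw [smul_comm c, smul_comm e]

/-- By `matL_mul`, an entry of the left-hand side is the row vector of the quadratic relation,
extended by a frozen factor, times K₁₂K₂₃. The relation for `T` turns that vector into T_j ⊗ T_i
times H₂₃, and `hK` carries H₂₃ across to H₁₂ on the right. -/
theorem RTT.matL {c e : I → I → Kq} {H K : Matrix (V × V) (V × V) Kq} {T : I → V → E}
    (hT : RTT c e H T)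
    (hK : tri23 H * (tri12 K * tri23 K) = tri12 K * tri23 K * tri12 H) :
    RTT c e H (matL K T) := by
  intro i j a b
  ext u β
  have h1 : ∀ X : V × V → Matrix V V E,
      act X H (a, b) u β = act (fun x => X x u β) H (a, b) := fun X => by
    simp only [act, Matrix.sum_apply, Matrix.smul_apply]
  have h2 : (fun x : V × V × V => c i j • extL u (fun x => T i x.1 * T j x.2) x +
      e i j • extL u (fun x => T j x.1 * T i x.2) x) =
        extL u (act (fun x => T j x.1 * T i x.2) H) := by
    funext ⟨x, y, z⟩
    by_cases h : x = u
    · simpa [extL, h] using hT i j y z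
    · simp [extL, h]
  rw [h1]
  simp only [Matrix.add_apply, Matrix.smul_apply, matL_mul]
  rw [act_linear, h2, ← act_extL, ← act_mul, hK, act_mul, act_tri12]

/-- The mirror image of `RTT.matL`: the frozen factor is the last one, and H₁₂ moves across to H₂₃.
-/
theorem RTT.matR {c e : I → I → Kq} {H K : Matrix (V × V) (V × V) Kq} {T : I → V → E}
    (hT : RTT c e H T)
    (hK : tri12 H * (tri23 K * tri12 K) = tri23 K * tri12 K * tri23 H) :
    RTT c e H (matR K T) := by
  intro i j a b
  ext α p
  have h1 : ∀ X : V × V → Matrix V V E,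
      act X H (a, b) α p = act (fun x => X x α p) H (a, b) := fun X => by
    simp only [act, Matrix.sum_apply, Matrix.smul_apply]
  have h2 : (fun x : V × V × V => c i j • extR p (fun x => T i x.1 * T j x.2) x +
      e i j • extR p (fun x => T j x.1 * T i x.2) x) =
        extR p (act (fun x => T j x.1 * T i x.2) H) := by
    funext ⟨x, y, z⟩
    by_cases h : z = p
    · simpa [extR, h] using hT i j x y
    · simp [extR, h]
  rw [h1]
  simp only [Matrix.add_apply, Matrix.smul_apply, matR_mul]
  rw [act_linear, h2, ← act_extR, ← act_mul, hK, act_mul, act_tri23]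

end RTT

/-! ### The defining relations entry by entry -/

/-- Each condition is solved for the column indices `k` and `l`, so that the sums in a product with
S on the left collapse. `Smat_col` does the same for products with S on the right. -/
theorem Smat_row {n : ℕ} (i k j l : Idx n) : Smat n i k j l =
    (if k = i then if l = j then qv ^ phi i j else 0 else 0)
    + (if k = j then if l = i then if j < i then xi * (-1) ^ par j else 0 else 0 else 0)
    + (if k = -j then if l = -i then if j < -i then xi * (-1) ^ par j else 0 else 0 else 0) := by
  have h1 : (i = l ∧ k = j) ↔ (k = j ∧ l = i) := by tauto
  have h2 : (i = -l ∧ k = -j) ↔ (k = -j ∧ l = -i) := by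
    rw [← neg_eq_iff_idx]
    tauto
  have h3 : (i = k ∧ j = l) ↔ (k = i ∧ l = j) := by tauto
  simp only [Smat, h1, h2, h3, ite_and, add_assoc]
  congr 1
  by_cases e1 : k = j <;> by_cases e2 : l = i
  · subst e1 e2
    simp [ne_neg_idx]
  · subst e1
    simp [ne_neg_idx, e2]
  · subst e2
    simp [ne_neg_idx, e1]
  · by_cases e3 : k = -j <;> by_cases e4 : l = -i
    · subst e3 e4
      simp [e1, e2]
    all_goals simp [e1, e2, e3, e4]

theorem Smat_col {n : ℕ} (i k j l : Idx n) : Smat n i k j l =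
    (if i = k then if j = l then qv ^ phi k l else 0 else 0)
    + (if i = l then if j = k then if k < l then xi * (-1) ^ par k else 0 else 0 else 0)
    + (if i = -l then if j = -k then if -k < l then xi * (-1) ^ par (-k) else 0 else 0 else 0) := by
  have h1 : (i = l ∧ k = j) ↔ (i = l ∧ j = k) := by tauto
  have h2 : (i = -l ∧ k = -j) ↔ (i = -l ∧ j = -k) := by
    rw [eq_comm (a := k), neg_eq_iff_idx]
  rw [Smat]
  simp only [h1, h2, ite_and, add_assoc]
  congr 1
  · by_cases e1 : i = k
    · subst e1
      by_cases e2 : j = l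
      · subst e2
        rfl
      · simp [e2]
    · simp [e1]
  by_cases e1 : i = l <;> by_cases e2 : j = k
  · subst e1 e2
    simp [ne_neg_idx]
  · subst e1
    simp [ne_neg_idx, e2]
  · subst e2
    simp [ne_neg_idx, e1]
  · by_cases e3 : i = -l <;> by_cases e4 : j = -k
    · subst e3 e4
      simp [e1, e2]
    all_goals simp [e1, e2, e3, e4]

theorem scalarMul_Smat {n : ℕ} {κ κ' M : Type} [SuperIndex κ] [SuperIndex κ'] [AddCommMonoid M]
    [Module Kq M] (Y : SuperMat (Idx n) κ (Idx n) κ' M) (i : Idx n) (a : κ) (j : Idx n) (b : κ') :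
    scalarMul (Smat n) Y i a j b = qv ^ phi i j • Y i a j b
      + (if j < i then xi * (-1) ^ (par j + (par i + par j) * (par j + par a)) else 0) • Y j a i b
      + (if j < -i then xi * (-1) ^ (par j + (par i + par j + 1) * (par j + 1 + par a)) else 0)
        • Y (-j) a (-i) b := by
  simp only [scalarMul, superMul, Smat_row, LinearMap.lsmul_apply, add_smul, smul_add,
    Finset.sum_add_distrib, smul_smul, mul_ite, mul_zero, ite_smul, zero_smul, smul_ite, smul_zero,
    Finset.sum_ite_eq', Finset.mem_univ, if_true, Finset.sum_ite_irrel, Finset.sum_const_zero]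
  congr 1
  · congr 1
    · congr 1
      rw [sign_congr_zmod (b := 0), pow_zero, one_mul]
      push_cast
      generalize (par i : ZMod 2) = x
      generalize (par j : ZMod 2) = y
      generalize (par a : ZMod 2) = z
      generalize (par b : ZMod 2) = w
      decide +revert
    · split_ifs
      · congr 1
        rw [mul_left_comm, ← pow_add]
        congr 1
        apply sign_congr_zmod
        push_cast
        generalize (par i : ZMod 2) = x
        generalize (par j : ZMod 2) = y
        generalize (par a : ZMod 2) = z
        generalize (par b : ZMod 2) = w
        decide +revert
      · rfl
  · split_ifs
    · congr 1
      rw [mul_left_comm, ← pow_add]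
      congr 1
      apply sign_congr_zmod
      push_cast [par_neg_zmod]
      generalize (par i : ZMod 2) = x
      generalize (par j : ZMod 2) = y
      generalize (par a : ZMod 2) = z
      generalize (par b : ZMod 2) = w
      decide +revert
    · rfl

theorem mulScalar_Smat {n : ℕ} {ι ι' M : Type} [SuperIndex ι] [SuperIndex ι'] [AddCommMonoid M]
    [Module Kq M] (Y : SuperMat ι (Idx n) ι' (Idx n) M) (i : ι) (a : Idx n) (j : ι') (b : Idx n) :
    mulScalar Y (Smat n) i a j b = qv ^ phi a b • Y i a j b
      + (if a < b then xi * (-1) ^ (par a + (par j + par a) * (par a + par b)) else 0) • Y i b j a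
      + (if -a < b then xi * (-1) ^ (par a + 1 + (par j + par a + 1) * (par a + par b + 1)) else 0)
        • Y i (-b) j (-a) := by
  simp only [mulScalar, superMul, Smat_col, LinearMap.flip_apply, LinearMap.lsmul_apply, add_smul,
    smul_add, Finset.sum_add_distrib, smul_smul, mul_ite, mul_zero, ite_smul, zero_smul, smul_ite, smul_zero,
    Finset.sum_ite_eq', Finset.mem_univ, if_true, Finset.sum_ite_irrel, Finset.sum_const_zero]
  congr 1
  · congr 1
    · congr 1
      rw [sign_congr_zmod (b := 0), pow_zero, one_mul]
      push_cast
      generalize (par b : ZMod 2) = w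
      generalize (par a : ZMod 2) = z
      generalize ((par i : ℕ) : ZMod 2) = x
      generalize ((par j : ℕ) : ZMod 2) = y
      decide +revert
    · split_ifs
      · congr 1
        rw [mul_left_comm, ← pow_add]
        congr 1
        apply sign_congr_zmod
        push_cast
        generalize (par b : ZMod 2) = w
        generalize (par a : ZMod 2) = z
        generalize ((par i : ℕ) : ZMod 2) = x
        generalize ((par j : ℕ) : ZMod 2) = y
        decide +revert
      · rfl
  · split_ifs
    · congr 1
      rw [mul_left_comm, ← pow_add]
      congr 1
      apply sign_congr_zmod
      push_cast [par_neg_zmod]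
      generalize (par b : ZMod 2) = w
      generalize (par a : ZMod 2) = z
      generalize ((par i : ℕ) : ZMod 2) = x
      generalize ((par j : ℕ) : ZMod 2) = y
      decide +revert
    · rfl

section relations

variable {r n : ℕ} {E : Type} [AddCommGroup E] [Module Kq E] (B : Idx r → Idx n → Idx r → Idx n → E)

/-- The left-hand side of the defining relations in terms of symbols for the quadratic monomials. -/
def relL (i : Idx r) (a : Idx n) (j : Idx r) (b : Idx n) : E :=
  ((-1 : Kq) ^ ((par i + par a) * (par j + par b)) * qv ^ phi i j) • B i a j b
  + (if j < i then xi * (-1) ^ (par j + (par j + par a) * (par j + par b)) else 0) • B j a i b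
  + (if j < -i then xi * (-1) ^ (par j + (par j + par a + 1) * (par j + par b)) else 0)
    • B (-j) a (-i) b

/-- The right-hand side of the defining relations in terms of symbols for the quadratic
monomials. -/
def relR (i : Idx r) (a : Idx n) (j : Idx r) (b : Idx n) : E :=
  (qv ^ phi a b) • B j b i a
  + (if a < b then xi * (-1) ^ (par a + (par j + par a) * (par a + par b)) else 0) • B j a i b
  + (if -a < b then xi * (-1) ^ (par a + 1 + (par j + par a + 1) * (par a + par b + 1)) else 0)
    • B j (-a) i (-b)

/-- The correction term for a change of sign of the second pair of indices. -/
def relD (i : Idx r) (a : Idx n) (j : Idx r) (b : Idx n) : E :=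
  (xi * (-1) ^ (par j + (par j + par a) * (par j + par b))) • B j a i b
  + (xi * (-1) ^ (par j + (par j + par a + 1) * (par j + par b))) • B (-j) a (-i) b

variable {B}
variable (h₁ : ∀ i a j b, B (-i) (-a) j b = B i a j b) (h₂ : ∀ i a j b, B i a (-j) (-b) = B i a j b)

/-- Here `phi a b` is (-1)^{|b|}, so this is q - q⁻¹ = ξ or its negative. It absorbs the change of
the diagonal coefficient when an index is negated. -/
theorem qv_zpow_sub {n : ℕ} (a b : Idx n) (h : a = b ∨ a = -b) :
    qv ^ phi a b = qv ^ (-phi a b) + xi * (-1) ^ par b := by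
  rcases h with rfl | rfl
  · rw [phi_self]
    rcases par_eq a with h | h <;> simp [h, xi]
  · rw [phi_neg_self]
    rcases par_eq b with h | h <;> simp [h, xi]

include h₁ in
-- The last two terms trade places: the conditions j < i and j < -i are interchanged.
theorem relL_neg_left (i : Idx r) (a : Idx n) (j : Idx r) (b : Idx n) :
    relL B (-i) (-a) j b = relL B i a j b := by
  have e1 : B j (-a) (-i) b = B (-j) a (-i) b := by rw [← h₁ j, neg_neg_idx]
  have e2 : B (-j) (-a) i b = B j a i b := by rw [h₁]
  simp only [relL, phi_neg_left, neg_neg_idx, h₁, e1]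
  rw [add_right_comm]
  congr 1
  · congr 1
    · congr 2
      apply sign_congr_zmod
      push_cast [par_neg_zmod]
      generalize (par i : ZMod 2) = x
      generalize (par j : ZMod 2) = y
      generalize (par a : ZMod 2) = z
      generalize (par b : ZMod 2) = w
      decide +revert
    · congr 2
      congr 1
      apply sign_congr_zmod
      push_cast [par_neg_zmod]
      generalize (par j : ZMod 2) = y
      generalize (par a : ZMod 2) = z
      generalize (par b : ZMod 2) = w
      decide +revert
  · congr 2
    congr 1
    apply sign_congr_zmod
    push_cast [par_neg_zmod]
    generalize (par j : ZMod 2) = y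
    generalize (par a : ZMod 2) = z
    generalize (par b : ZMod 2) = w
    decide +revert

include h₁ h₂ in
theorem relR_neg_left (i : Idx r) (a : Idx n) (j : Idx r) (b : Idx n) :
    relR B (-i) (-a) j b = relR B i a j b := by
  have e1 : B j (-a) (-i) b = B j (-a) i (-b) := by rw [← h₂ j _ i, neg_neg_idx]
  simp only [relR, phi_neg_left, neg_neg_idx, h₂, e1]
  rw [add_right_comm]
  congr 1
  · congr 3
    congr 1
    apply sign_congr_zmod
    push_cast [par_neg_zmod]
    generalize (par j : ZMod 2) = y
    generalize (par a : ZMod 2) = z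
    generalize (par b : ZMod 2) = w
    decide +revert
  · congr 2
    congr 1
    apply sign_congr_zmod
    push_cast [par_neg_zmod]
    generalize (par j : ZMod 2) = y
    generalize (par a : ZMod 2) = z
    generalize (par b : ZMod 2) = w
    decide +revert

include h₁ h₂ in
-- Negating the second pair reverses the two inequalities, and by complementarity this amounts to
-- adding both terms of `relD`. The same correction occurs in `relR_neg_right`, so equality of the
-- two sides is unaffected by the change of sign.
theorem relL_neg_right (i : Idx r) (a : Idx n) (j : Idx r) (b : Idx n) :
    relL B i a j b = relL B i a (-j) (-b) + relD B i a j b := by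
  have e1 : B (-j) a i (-b) = B (-j) a (-i) b := by rw [← h₂ _ _ i, neg_neg_idx]
  simp only [relL, relD, phi_neg_right, neg_neg_idx, h₂, e1, neg_lt_neg_idx]
  have s1 : (-1 : Kq) ^ ((par i + par a) * (par (-j) + par (-b))) =
      (-1) ^ ((par i + par a) * (par j + par b)) := by
    apply sign_congr_zmod
    push_cast [par_neg_zmod]
    generalize (par i : ZMod 2) = x
    generalize (par j : ZMod 2) = y
    generalize (par a : ZMod 2) = z
    generalize (par b : ZMod 2) = w
    decide +revert
  have s2 : (-1 : Kq) ^ (par (-j) + (par (-j) + par a) * (par (-j) + par (-b))) =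
      -(-1) ^ (par j + (par j + par a + 1) * (par j + par b)) := by
    rw [← neg_one_mul ((-1 : Kq) ^ _), ← pow_succ']
    apply sign_congr_zmod
    push_cast [par_neg_zmod]
    generalize (par j : ZMod 2) = y
    generalize (par a : ZMod 2) = z
    generalize (par b : ZMod 2) = w
    decide +revert
  have s3 : (-1 : Kq) ^ (par (-j) + (par (-j) + par a + 1) * (par (-j) + par (-b))) =
      -(-1) ^ (par j + (par j + par a) * (par j + par b)) := by
    rw [← neg_one_mul ((-1 : Kq) ^ _), ← pow_succ']
    apply sign_congr_zmod
    push_cast [par_neg_zmod]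
    generalize (par j : ZMod 2) = y
    generalize (par a : ZMod 2) = z
    generalize (par b : ZMod 2) = w
    decide +revert
  rw [s1, s2, s3]
  rcases idx_cases i j with rfl | rfl | ⟨hn1, hn2⟩
  · have h4 := neg_lt_self_iff_idx i
    rw [qv_zpow_sub i i (Or.inl rfl)]
    simp only [lt_irrefl, if_false, h4]
    have s4 : (-1 : Kq) ^ (par i + (par i + par a) * (par i + par b)) =
        (-1) ^ ((par i + par a) * (par i + par b)) * (-1) ^ par i := by rw [pow_add, mul_comm]
    rw [s4]
    generalize (-1 : Kq) ^ ((par i + par a) * (par i + par b)) = k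
    generalize (-1 : Kq) ^ (par i + (par i + par a + 1) * (par i + par b)) = l
    generalize (-1 : Kq) ^ par i = m
    generalize qv ^ (-phi i i) = Q
    by_cases h5 : i < -i <;> simp only [h5, if_true, if_false, not_true, not_false_iff, zero_smul, mul_add, mul_neg,
        add_smul, neg_smul, mul_comm, mul_left_comm, mul_assoc] <;> abel
  · have h4 := neg_lt_self_iff_idx j
    rw [qv_zpow_sub (-j) j (Or.inr rfl)]
    simp only [lt_irrefl, if_false, h4, neg_neg_idx]
    have s4 : (-1 : Kq) ^ (par j + (par j + par a + 1) * (par j + par b)) =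
        (-1) ^ ((par (-j) + par a) * (par j + par b)) * (-1) ^ par j := by
      rw [← pow_add]
      apply sign_congr_zmod
      push_cast [par_neg_zmod]
      generalize (par j : ZMod 2) = y
      generalize (par a : ZMod 2) = z
      generalize (par b : ZMod 2) = w
      decide +revert
    rw [s4]
    generalize (-1 : Kq) ^ ((par (-j) + par a) * (par j + par b)) = k
    generalize (-1 : Kq) ^ (par j + (par j + par a) * (par j + par b)) = l
    generalize (-1 : Kq) ^ par j = m
    generalize qv ^ (-phi (-j) j) = Q
    by_cases h5 : j < -j <;> simp only [h5, if_true, if_false, not_true, not_false_iff, zero_smul, mul_add, mul_neg,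
        add_smul, neg_smul, mul_comm, mul_left_comm, mul_assoc] <;> abel
  · have h4 := lt_iff_not_lt_idx hn1
    have h5 : -j < i ↔ ¬ j < -i := by
      rw [lt_neg_idx]
      exact lt_iff_not_lt_idx hn2
    rw [phi_of_ne hn1 hn2, neg_zero]
    by_cases h6 : i < j <;> by_cases h7 : j < -i <;>
      simp only [h4, h5, h6, h7, if_true, if_false, not_true, not_false_iff, zero_smul, mul_neg,
        neg_smul] <;> abel

include h₁ h₂ in
theorem relR_neg_right (i : Idx r) (a : Idx n) (j : Idx r) (b : Idx n) :
    relR B i a j b = relR B i a (-j) (-b) + relD B i a j b := by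
  have e1 : B (-j) a i (-b) = B (-j) a (-i) b := by rw [← h₂ _ _ i, neg_neg_idx]
  have e2 : B j (-a) i (-b) = B (-j) a (-i) b := by rw [← h₁ j, ← h₂ _ _ i]; simp only [neg_neg_idx]
  simp only [relR, relD, phi_neg_right, neg_neg_idx, h₁, h₂, e1, e2, neg_lt_neg_idx]
  have s1 : (-1 : Kq) ^ (par a + (par j + par a) * (par a + par b)) =
      (-1) ^ (par j + (par j + par a) * (par j + par b)) := by
    apply sign_congr_zmod
    push_cast [par_neg_zmod]
    generalize (par j : ZMod 2) = y
    generalize (par a : ZMod 2) = z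
    generalize (par b : ZMod 2) = w
    decide +revert
  have s2 : (-1 : Kq) ^ (par a + 1 + (par j + par a + 1) * (par a + par b + 1)) =
      (-1) ^ (par j + (par j + par a + 1) * (par j + par b)) := by
    apply sign_congr_zmod
    push_cast [par_neg_zmod]
    generalize (par j : ZMod 2) = y
    generalize (par a : ZMod 2) = z
    generalize (par b : ZMod 2) = w
    decide +revert
  have s3 : (-1 : Kq) ^ (par a + (par (-j) + par a) * (par a + par (-b))) =
      -(-1) ^ (par j + (par j + par a + 1) * (par j + par b)) := by
    rw [← neg_one_mul ((-1 : Kq) ^ _), ← pow_succ']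
    apply sign_congr_zmod
    push_cast [par_neg_zmod]
    generalize (par j : ZMod 2) = y
    generalize (par a : ZMod 2) = z
    generalize (par b : ZMod 2) = w
    decide +revert
  have s4 : (-1 : Kq) ^ (par a + 1 + (par (-j) + par a + 1) * (par a + par (-b) + 1)) =
      -(-1) ^ (par j + (par j + par a) * (par j + par b)) := by
    rw [← neg_one_mul ((-1 : Kq) ^ _), ← pow_succ']
    apply sign_congr_zmod
    push_cast [par_neg_zmod]
    generalize (par j : ZMod 2) = y
    generalize (par a : ZMod 2) = z
    generalize (par b : ZMod 2) = w
    decide +revert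
  rw [s1, s2, s3, s4]
  rcases idx_cases a b with rfl | rfl | ⟨hn1, hn2⟩
  · have h4 := neg_lt_self_iff_idx a
    rw [qv_zpow_sub a a (Or.inl rfl)]
    simp only [lt_irrefl, if_false, h4]
    have s5 : (-1 : Kq) ^ (par j + (par j + par a) * (par j + par a)) = (-1) ^ par a := by
      apply sign_congr_zmod
      push_cast
      generalize (par j : ZMod 2) = y
      generalize (par a : ZMod 2) = z
      decide +revert
    rw [s5]
    generalize (-1 : Kq) ^ (par j + (par j + par a + 1) * (par j + par a)) = l
    generalize (-1 : Kq) ^ par a = m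
    generalize qv ^ (-phi a a) = Q
    by_cases h5 : a < -a <;> simp only [h5, if_true, if_false, not_true, not_false_iff, zero_smul, mul_add, mul_neg,
        add_smul, neg_smul, mul_comm, mul_left_comm, mul_assoc] <;> abel
  · have h4 := neg_lt_self_iff_idx b
    rw [qv_zpow_sub (-b) b (Or.inr rfl)]
    have e3 : B j b i (-b) = B (-j) (-b) (-i) b := by
      rw [← h₁ j, ← h₂ _ _ i, neg_neg_idx]
    simp only [lt_irrefl, if_false, h4, neg_neg_idx, e3]
    have s5 : (-1 : Kq) ^ (par j + (par j + par (-b) + 1) * (par j + par b)) = (-1) ^ par b := by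
      apply sign_congr_zmod
      push_cast [par_neg_zmod]
      generalize (par j : ZMod 2) = y
      generalize (par b : ZMod 2) = z
      decide +revert
    rw [s5]
    generalize (-1 : Kq) ^ (par j + (par j + par (-b)) * (par j + par b)) = l
    generalize (-1 : Kq) ^ par b = m
    generalize qv ^ (-phi (-b) b) = Q
    by_cases h5 : b < -b <;> simp only [h5, if_true, if_false, not_true, not_false_iff, zero_smul, mul_add, mul_neg,
        add_smul, neg_smul, mul_comm, mul_left_comm, mul_assoc] <;> abel
  · have h4 := lt_iff_not_lt_idx hn1
    have h5 : a < -b ↔ ¬ -a < b := by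
      rw [neg_lt_idx]
      exact lt_iff_not_lt_idx (Ne.symm hn2)
    rw [phi_of_ne hn1 hn2, neg_zero]
    by_cases h6 : a < b <;> by_cases h7 : -a < b <;>
      simp only [h4, h5, h6, h7, if_true, if_false, not_true, not_false_iff, zero_smul, mul_neg,
        neg_smul] <;> abel

include h₁ h₂ in
-- Either row index can be made positive: for the first one both sides are invariant, for the second
-- one both change by `relD`.
theorem rel_of_rows (h : ∀ (i : IdxPos r) a (j : IdxPos r) b, relL B i a j b = relR B i a j b)
    (i : Idx r) (a : Idx n) (j : Idx r) (b : Idx n) : relL B i a j b = relR B i a j b := by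
  have key : ∀ (i : IdxPos r) a (j : Idx r) b, relL B i a j b = relR B i a j b := by
    intro i a j b
    rcases par_eq j with hj | hj
    · exact h i a ⟨j, pos_of_par hj⟩ b
    · rw [relL_neg_right h₁ h₂, relR_neg_right h₁ h₂,
        h i a ⟨-j, pos_of_par (by rw [par_neg, hj])⟩ (-b)]
  rcases par_eq i with hi | hi
  · exact key ⟨i, pos_of_par hi⟩ a j b
  · rw [← relL_neg_left h₁, ← relR_neg_left h₁ h₂]
    exact key ⟨-i, pos_of_par (by rw [par_neg, hi])⟩ (-a) j b

include h₁ h₂ in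
-- The analogue for the second index of each pair, normalised to be negative. It serves Ā_{s,n},
-- whose matrix T̄ carries the rows α of the generators as columns.
theorem rel_of_cols (h : ∀ i (a : IdxPos n) j (b : IdxPos n),
      relL B i (-a.1) j (-b.1) = relR B i (-a.1) j (-b.1))
    (i : Idx r) (a : Idx n) (j : Idx r) (b : Idx n) : relL B i a j b = relR B i a j b := by
  have key : ∀ i (a : IdxPos n) (j : Idx r) b, relL B i (-a.1) j b = relR B i (-a.1) j b := by
    intro i a j b
    rcases par_eq b with hb | hb
    · rw [relL_neg_right h₁ h₂, relR_neg_right h₁ h₂, h i a (-j) ⟨b, pos_of_par hb⟩]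
    · have := h i a j ⟨-b, pos_of_par (by rw [par_neg, hb])⟩
      simpa only [neg_neg_idx] using this
  rcases par_eq a with ha | ha
  · rw [← relL_neg_left h₁, ← relR_neg_left h₁ h₂]
    exact key (-i) ⟨a, pos_of_par ha⟩ j b
  · have := key i ⟨-a, pos_of_par (by rw [par_neg, ha])⟩ j b
    simpa only [neg_neg_idx] using this

end relations

/-! ### Presentations by half of the generators -/

section link

variable {r n : ℕ} {E : Type} [Ring E] [Algebra Kq E] (X : Idx r → Idx n → E)

theorem scalarMul_leg12 (i : Idx r) (a : Idx n) (j : Idx r) (b : Idx n) :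
    scalarMul (Smat r) (superMul (LinearMap.mul Kq E) (leg1 (Idx r) X) (leg2 (Idx n) X)) i a j b =
      relL (fun i a j b => X i a * X j b) i a j b := by
  simp only [scalarMul_Smat, superMul_leg12, relL, smul_smul, ite_mul, zero_mul]
  congr 1
  · congr 1
    · congr 1
      rw [mul_comm]
      congr 1
      apply sign_congr_zmod
      push_cast
      generalize (par i : ZMod 2) = x
      generalize (par j : ZMod 2) = y
      generalize (par a : ZMod 2) = z
      generalize (par b : ZMod 2) = w
      decide +revert
    · split_ifs
      · rw [mul_assoc, ← pow_add]
        congr 2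
        apply sign_congr_zmod
        push_cast
        generalize (par i : ZMod 2) = x
        generalize (par j : ZMod 2) = y
        generalize (par a : ZMod 2) = z
        generalize (par b : ZMod 2) = w
        decide +revert
      · rfl
  · split_ifs
    · rw [mul_assoc, ← pow_add]
      congr 2
      apply sign_congr_zmod
      push_cast [par_neg_zmod]
      generalize (par i : ZMod 2) = x
      generalize (par j : ZMod 2) = y
      generalize (par a : ZMod 2) = z
      generalize (par b : ZMod 2) = w
      decide +revert
    · rfl

theorem mulScalar_leg21 (i : Idx r) (a : Idx n) (j : Idx r) (b : Idx n) :
    mulScalar (superMul (LinearMap.mul Kq E) (leg2 (Idx r) X) (leg1 (Idx n) X)) (Smat n) i a j b =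
      relR (fun i a j b => X i a * X j b) i a j b := by
  have h : ∀ i a j b, superMul (LinearMap.mul Kq E) (leg2 (Idx r) X) (leg1 (Idx n) X) i a j b =
      X j b * X i a := by
    intro i a j b
    rw [superMul_leg21, sign_congr_zmod (b := 0), pow_zero, one_smul]
    push_cast
    generalize (par i : ZMod 2) = x
    generalize (par j : ZMod 2) = y
    generalize (par a : ZMod 2) = z
    generalize (par b : ZMod 2) = w
    decide +revert
  simp only [mulScalar_Smat, h, relR]

/-- With the super-opposite product as the symbol for quadratic monomials, the relation T̄T̄S =
ST̄T̄ takes the shape `relL` = `relR` of the relation STT = TTS. One set of lemmas on changes of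
sign then handles both algebras. -/
theorem scalarMul_leg21 (i : Idx r) (a : Idx n) (j : Idx r) (b : Idx n) :
    scalarMul (Smat r) (superMul (LinearMap.mul Kq E) (leg2 (Idx r) X) (leg1 (Idx n) X)) i a j b =
      relL (fun i a j b => (-1 : Kq) ^ ((par i + par a) * (par j + par b)) • (X j b * X i a))
        i a j b := by
  have h : ∀ i a j b, superMul (LinearMap.mul Kq E) (leg2 (Idx r) X) (leg1 (Idx n) X) i a j b =
      X j b * X i a := by
    intro i a j b
    rw [superMul_leg21, sign_congr_zmod (b := 0), pow_zero, one_smul]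
    push_cast
    generalize (par i : ZMod 2) = x
    generalize (par j : ZMod 2) = y
    generalize (par a : ZMod 2) = z
    generalize (par b : ZMod 2) = w
    decide +revert
  simp only [scalarMul_Smat, h, relL, smul_smul, ite_mul, zero_mul]
  congr 1
  · congr 1
    · congr 1
      rw [mul_right_comm, ← pow_add, sign_congr_zmod (b := 0), pow_zero, one_mul]
      push_cast
      rw [CharTwo.add_self_eq_zero]
    · split_ifs
      · rw [mul_assoc, ← pow_add]
        congr 2
        apply sign_congr_zmod
        push_cast
        generalize (par i : ZMod 2) = x
        generalize (par j : ZMod 2) = y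
        generalize (par a : ZMod 2) = z
        generalize (par b : ZMod 2) = w
        decide +revert
      · rfl
  · split_ifs
    · rw [mul_assoc, ← pow_add]
      congr 2
      apply sign_congr_zmod
      push_cast [par_neg_zmod]
      generalize (par i : ZMod 2) = x
      generalize (par j : ZMod 2) = y
      generalize (par a : ZMod 2) = z
      generalize (par b : ZMod 2) = w
      decide +revert
    · rfl

theorem mulScalar_leg12 (i : Idx r) (a : Idx n) (j : Idx r) (b : Idx n) :
    mulScalar (superMul (LinearMap.mul Kq E) (leg1 (Idx r) X) (leg2 (Idx n) X)) (Smat n) i a j b =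
      relR (fun i a j b => (-1 : Kq) ^ ((par i + par a) * (par j + par b)) • (X j b * X i a))
        i a j b := by
  have h : ∀ i a j b, superMul (LinearMap.mul Kq E) (leg1 (Idx r) X) (leg2 (Idx n) X) i a j b =
      (-1 : Kq) ^ ((par j + par b) * (par i + par a)) • (X i a * X j b) := by
    intro i a j b
    rw [superMul_leg12]
    congr 1
    apply sign_congr_zmod
    push_cast
    generalize (par i : ZMod 2) = x
    generalize (par j : ZMod 2) = y
    generalize (par a : ZMod 2) = z
    generalize (par b : ZMod 2) = w
    decide +revert
  simp only [mulScalar_Smat, h, relR]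

theorem map_superMul_leg12 {ι κ : Type} [Fintype ι] [Fintype κ] [DecidableEq ι] [DecidableEq κ]
    [SuperIndex ι] [SuperIndex κ] {B C : Type} [Ring B] [Algebra Kq B] [Ring C] [Algebra Kq C]
    (F : B →ₐ[Kq] C) (X : ι → κ → B) (i : ι) (a : κ) (j : ι) (b : κ) :
    F.toLinearMap (superMul (LinearMap.mul Kq B) (leg1 ι X) (leg2 κ X) i a j b) =
      superMul (LinearMap.mul Kq C) (leg1 ι fun i a => F (X i a)) (leg2 κ fun i a => F (X i a))
        i a j b := by
  simp [superMul_leg12]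

theorem map_superMul_leg21 {ι κ : Type} [Fintype ι] [Fintype κ] [DecidableEq ι] [DecidableEq κ]
    [SuperIndex ι] [SuperIndex κ] {B C : Type} [Ring B] [Algebra Kq B] [Ring C] [Algebra Kq C]
    (F : B →ₐ[Kq] C) (X : ι → κ → B) (i : ι) (a : κ) (j : ι) (b : κ) :
    F.toLinearMap (superMul (LinearMap.mul Kq B) (leg2 ι X) (leg1 κ X) i a j b) =
      superMul (LinearMap.mul Kq C) (leg2 ι fun i a => F (X i a)) (leg1 κ fun i a => F (X i a))
        i a j b := by
  simp [superMul_leg21]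

end link

/-- The diagonal coefficients of the relations of `A_{r,n}` for positive rows. -/
def cA {r : ℕ} (i j : IdxPos r) : Kq := if i = j then qv else 1

/-- The off-diagonal coefficients of the relations of `A_{r,n}` for positive rows. -/
def eA {r : ℕ} (i j : IdxPos r) : Kq := if j.1 < i.1 then xi else 0

/-- The diagonal coefficients of the relations of `Ā_{s,n}` for negative rows. -/
def cB {r : ℕ} (i j : IdxPos r) : Kq := if i = j then qv⁻¹ else 1

/-- The off-diagonal coefficients of the relations of `Ā_{s,n}` for negative rows. -/
def eB {r : ℕ} (i j : IdxPos r) : Kq := if j.1 < i.1 then -xi else 0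

/-- The braid matrix of the relations of `Ā_{s,n}` for negative rows. -/
def Hbar (n : ℕ) : Matrix (Idx n × Idx n) (Idx n × Idx n) Kq := fun x y =>
  -((-1) ^ (par y.1 + par x.1) * Hm n (y.2, y.1) (x.2, x.1))

theorem phi_pos {r : ℕ} (i j : IdxPos r) : phi i.1 j.1 = if i = j then 1 else 0 := by
  have h : i.1 ≠ -j.1 := by
    intro h
    have h1 := congrArg (fun x : Idx r => (x : ℤ)) h
    have h2 := i.2
    have h3 := j.2
    simp only [coe_neg] at h1
    omega
  by_cases e : i = j
  · subst e
    rw [phi_self, if_pos rfl, par_of_pos i.2, pow_zero]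
  · rw [if_neg e, phi_of_ne (fun h => e (Subtype.ext h)) h]

theorem not_lt_neg_pos {r : ℕ} (i j : IdxPos r) : ¬ j.1 < -i.1 := by
  have h2 := i.2
  have h3 := j.2
  change ¬ (j.1 : ℤ) < -i.1
  omega

/-- For positive rows j < -i is impossible, so only two terms survive. The common sign (-1)^{|a||b|}
appears in `relR_pos` as well and cancels. -/
theorem relL_pos {r n : ℕ} {E : Type} [AddCommGroup E] [Module Kq E]
    (B : Idx r → Idx n → Idx r → Idx n → E) (i j : IdxPos r) (a b : Idx n) :
    relL B i a j b =
      (-1 : Kq) ^ (par a * par b) • (cA i j • B i a j b + eA i j • B j a i b) := by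
  simp only [relL, par_of_pos i.2, par_of_pos j.2, phi_pos, not_lt_neg_pos, if_false, zero_smul,
    zero_add, add_zero, smul_add, smul_smul, cA, eA, mul_ite, mul_zero]
  congr 2
  · split_ifs <;> simp
  · split_ifs <;> ring

theorem relR_pos {r n : ℕ} {E : Type} [AddCommGroup E] [Module Kq E]
    (B : Idx r → Idx n → Idx r → Idx n → E) (i j : IdxPos r) (a b : Idx n) :
    relR B i a j b =
      (-1 : Kq) ^ (par a * par b) • act (fun x => B j x.1 i x.2) (Hm n) (a, b) := by
  simp only [relR, par_of_pos j.2, act_Hm, smul_add, smul_smul, zero_add, mul_ite, mul_zero,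
    ← mul_assoc, ← pow_add]
  congr 1
  · congr 1
    · congr 1
      rw [sign_congr_zmod (b := 0), pow_zero, one_mul]
      push_cast
      rw [CharTwo.add_self_eq_zero]
    · congr 1
      split_ifs
      · rw [mul_comm]
        congr 1
        apply sign_congr_zmod
        push_cast
        generalize (par a : ZMod 2) = z
        generalize (par b : ZMod 2) = w
        decide +revert
      · rfl
  · congr 1
    split_ifs
    · rw [mul_comm _ xi, mul_assoc, ← pow_add]
      congr 1
      apply sign_congr_zmod
      push_cast
      generalize (par a : ZMod 2) = z
      generalize (par b : ZMod 2) = w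
      decide +revert
    · rfl

theorem act_Hbar {n : ℕ} {E : Type} [AddCommGroup E] [Module Kq E] (X : Idx n × Idx n → E)
    (a b : Idx n) : act X (Hbar n) (a, b) =
      ((-1 : Kq) ^ ((par a + 1) * (par b + 1)) * qv ^ phi a b) • X (b, a)
      + (if b < a then -xi else 0) • X (a, b)
      + (if b < -a then -(xi * (-1) ^ par a) else 0) • X (-a, -b) := by
  have key : ∀ x : Idx n × Idx n, Hbar n x (a, b) =
      (if x = (b, a) then ((-1 : Kq) ^ ((par a + 1) * (par b + 1)) * qv ^ phi a b) else 0)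
      + (if x = (a, b) then (if b < a then -xi else 0) else 0)
      + (if x = (-a, -b) then (if b < -a then -(xi * (-1) ^ par a) else 0) else 0) := by
    rintro ⟨u, p⟩
    have e1 : ((b, a) : Idx n × Idx n) = (u, p) ↔ (u, p) = (b, a) := eq_comm
    have e2 : ((b, a) : Idx n × Idx n) = (p, u) ↔ (u, p) = (a, b) := by
      simp only [Prod.mk.injEq]
      tauto
    have e3 : ((b, a) : Idx n × Idx n) = (-p, -u) ↔ (u, p) = (-a, -b) := by
      simp only [Prod.mk.injEq, eq_comm (a := b), eq_comm (a := a), neg_eq_iff_idx]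
      tauto
    simp only [Hbar, Hm_apply, e1, e2, e3, mul_add, neg_add]
    congr 1
    · congr 1
      · by_cases h : (u, p) = (b, a)
        · obtain ⟨rfl, rfl⟩ := Prod.mk.inj h
          simp only [if_true]
          rw [← mul_assoc, ← pow_add, ← neg_mul, ← neg_one_mul ((-1 : Kq) ^ _), ← pow_succ']
          congr 1
          apply sign_congr_zmod
          push_cast
          generalize (par p : ZMod 2) = z
          generalize (par u : ZMod 2) = w
          decide +revert
        · simp [h]
      · by_cases h : (u, p) = (a, b)
        · obtain ⟨rfl, rfl⟩ := Prod.mk.inj h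
          simp only [if_true]
          rw [sign_congr_zmod (b := 0), pow_zero, one_mul]
          · split_ifs <;> simp
          · push_cast
            rw [CharTwo.add_self_eq_zero]
        · simp [h]
    · by_cases h : (u, p) = (-a, -b)
      · obtain ⟨rfl, rfl⟩ := Prod.mk.inj h
        simp only [if_true, neg_neg_idx]
        split_ifs
        · rw [mul_left_comm, ← pow_add]
          congr 2
          apply sign_congr_zmod
          push_cast [par_neg_zmod]
          generalize (par a : ZMod 2) = z
          decide +revert
        · simp
      · simp [h]
  simp only [act, key, add_smul, Finset.sum_add_distrib, ite_smul, zero_smul,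
    Finset.sum_ite_eq', Finset.mem_univ, if_true]

theorem phi_neg_pos {r : ℕ} (i j : IdxPos r) : phi (-i.1) (-j.1) = if i = j then -1 else 0 := by
  rw [phi_neg_left, phi_neg_right, phi_pos]
  split_ifs <;> simp

/-- Compared with A_{r,n} the two sides exchange their roles: for negative columns it is `relR` that
keeps two terms, while `relL` becomes the action of a braid matrix (`relL_neg`). -/
theorem relR_neg {r n : ℕ} {E : Type} [Ring E] [Algebra Kq E]
    (X : Idx r → Idx n → E) (i j : Idx r) (a b : IdxPos n) :
    relR (fun i a j b => (-1 : Kq) ^ ((par i + par a) * (par j + par b)) • (X j b * X i a))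
        i (-a.1) j (-b.1) =
      (-1 : Kq) ^ ((par i + 1) * (par j + 1)) •
        (cB a b • (X i (-a.1) * X j (-b.1)) + eB a b • (X i (-b.1) * X j (-a.1))) := by
  have h1 : ¬ a.1 < -b.1 := not_lt_neg_pos b a
  simp only [relR, par_neg, par_of_pos a.2, par_of_pos b.2, phi_neg_pos, neg_neg_idx, h1, if_false,
    zero_smul, add_zero, smul_add, smul_smul, cB, eB, neg_lt_neg_idx, mul_ite, mul_zero, Nat.sub_zero,
    ite_mul, zero_mul]
  congr 1
  · congr 1
    rw [mul_comm (par i + 1)]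
    split_ifs <;> simp [mul_comm]
  · congr 1
    split_ifs
    · rw [mul_assoc, ← pow_add, mul_neg, mul_comm _ xi, ← mul_neg,
        ← neg_one_mul ((-1 : Kq) ^ _), ← pow_succ']
      congr 1
      apply sign_congr_zmod
      push_cast
      generalize (par i : ZMod 2) = z
      generalize (par j : ZMod 2) = w
      decide +revert
    · simp

theorem relL_neg {r n : ℕ} {E : Type} [Ring E] [Algebra Kq E]
    (X : Idx r → Idx n → E) (h : ∀ i a, X (-i) (-a) = X i a) (i j : Idx r) (a b : IdxPos n) :
    relL (fun i a j b => (-1 : Kq) ^ ((par i + par a) * (par j + par b)) • (X j b * X i a))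
        i (-a.1) j (-b.1) =
      (-1 : Kq) ^ ((par i + 1) * (par j + 1)) •
        act (fun x => X x.1 (-b.1) * X x.2 (-a.1)) (Hbar r) (i, j) := by
  simp only [relL, par_neg a.1, par_neg b.1, par_of_pos a.2, par_of_pos b.2, act_Hbar, smul_add, smul_smul,
    Nat.sub_zero, mul_ite, mul_zero, ite_mul, zero_mul]
  congr 1
  · congr 1
    · congr 1
      ring
    · congr 1
      split_ifs
      · rw [mul_assoc, ← pow_add, mul_neg, mul_comm _ xi, ← mul_neg,
          ← neg_one_mul ((-1 : Kq) ^ _), ← pow_succ']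
        congr 1
        apply sign_congr_zmod
        push_cast
        generalize (par i : ZMod 2) = z
        generalize (par j : ZMod 2) = w
        decide +revert
      · rfl
  · congr 1
    split_ifs
    · rw [mul_assoc, ← pow_add, ← mul_neg, mul_left_comm]
      congr 1
      rw [← neg_one_mul ((-1 : Kq) ^ par i), ← pow_succ', ← pow_add]
      apply sign_congr_zmod
      push_cast [par_neg_zmod]
      generalize (par i : ZMod 2) = z
      generalize (par j : ZMod 2) = w
      clear h
      decide +revert
    · rfl

/-! ### Universal properties and generators -/

theorem t_neg {r n : ℕ} (i : Idx r) (a : Idx n) : t r n (-i) (-a) = t r n i a :=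
  (mkA_rel (ARel.neg i a)).symm

theorem rel_t {r n : ℕ} (i : Idx r) (a : Idx n) (j : Idx r) (b : Idx n) :
    relL (fun i a j b => t r n i a * t r n j b) i a j b =
      relR (fun i a j b => t r n i a * t r n j b) i a j b := by
  have h := mkA_rel (ARel.stt i a j b)
  have e1 := map_scalarMul (mkA r n).toLinearMap
    (superMul (LinearMap.mul Kq _) (leg1 (Idx r) (Tfree r n)) (leg2 (Idx n) (Tfree r n))) i a j b
  have e2 := map_mulScalar (mkA r n).toLinearMap
    (superMul (LinearMap.mul Kq _) (leg2 (Idx r) (Tfree r n)) (leg1 (Idx n) (Tfree r n))) i a j b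
  simp only [map_superMul_leg12, map_superMul_leg21] at e1 e2
  exact (scalarMul_leg12 (t r n) i a j b).symm.trans (e1.symm.trans (h.trans
    (e2.trans (mulScalar_leg21 (t r n) i a j b))))

theorem neg_one_pow_ne_zero (m : ℕ) : (-1 : Kq) ^ m ≠ 0 := pow_ne_zero _ (by norm_num)

theorem rtt_Tplus (r n : ℕ) : RTT cA eA (Hm n) (Tplus r n) := by
  intro i j a b
  have h := rel_t i.1 a j.1 b
  rw [relL_pos, relR_pos] at h
  exact smul_right_injective _ (neg_one_pow_ne_zero _) h

/-- A family on the positive rows that satisfies the relations extends to `A_{r,n}`. -/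
theorem exists_hom_A {r n : ℕ} {E : Type} [Ring E] [Algebra Kq E] (T : IdxPos r → Idx n → E)
    (hT : RTT cA eA (Hm n) T) : ∃ F : A r n →ₐ[Kq] E, ∀ i a, F (Tplus r n i a) = T i a := by
  -- The values on negative rows are forced by t_{ia} = t_{-i,-a}.
  let X : Idx r → Idx n → E := fun i a =>
    if h : par i = 0 then T ⟨i, pos_of_par h⟩ a
    else T ⟨-i, pos_of_par (by rw [par_neg]; have := par_eq i; omega)⟩ (-a)
  have hX : ∀ (i : IdxPos r) a, X i.1 a = T i a := fun i a => dif_pos (par_of_pos i.2)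
  have hX' : ∀ i a, X (-i) (-a) = X i a := by
    intro i a
    rcases par_eq i with h | h
    · have h' : ¬ par (-i) = 0 := by rw [par_neg, h]; omega
      simp only [X, h, h', dif_pos, dif_neg, not_false_iff, neg_neg_idx]
    · have h' : par (-i) = 0 := by rw [par_neg, h]
      have h'' : ¬ par i = 0 := by omega
      simp only [X, h', h'', dif_pos, dif_neg, not_false_iff]
  have hrel := rel_of_rows (B := fun i a j b => X i a * X j b) (fun i a j b => by rw [hX'])
    (fun i a j b => by rw [hX']) (fun i a j b => by
      rw [relL_pos, relR_pos]
      simp only [hX]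
      rw [hT i j a b])
  let F : FreeAlgebra Kq (Idx r × Idx n) →ₐ[Kq] E := FreeAlgebra.lift Kq fun x => X x.1 x.2
  have hF : ∀ i a, F (Tfree r n i a) = X i a := fun i a => by simp [F, Tfree]
  refine ⟨liftA F ?_, fun i a => ?_⟩
  · intro x y h
    cases h with
    | neg i a => rw [hF, hF, hX']
    | stt i a j b =>
      have e1 := map_scalarMul F.toLinearMap
        (superMul (LinearMap.mul Kq _) (leg1 (Idx r) (Tfree r n)) (leg2 (Idx n) (Tfree r n)))
          i a j b
      have e2 := map_mulScalar F.toLinearMap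
        (superMul (LinearMap.mul Kq _) (leg2 (Idx r) (Tfree r n)) (leg1 (Idx n) (Tfree r n)))
          i a j b
      simp only [map_superMul_leg12, map_superMul_leg21, hF] at e1 e2
      exact e1.trans ((scalarMul_leg12 X i a j b).trans ((hrel i a j b).trans
        ((mulScalar_leg21 X i a j b).symm.trans e2.symm)))
  · rw [← hX]
    exact (RingQuot.liftAlgHom_mkAlgHom_apply _ _ _ _).trans (hF _ _)

theorem adjoin_Tplus (r n : ℕ) :
    Algebra.adjoin Kq (Set.range fun x : IdxPos r × Idx n => Tplus r n x.1 x.2) = ⊤ := by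
  rw [eq_top_iff]
  intro f _
  obtain ⟨x, rfl⟩ : ∃ x, mkA r n x = f := RingQuot.mkAlgHom_surjective Kq (ARel r n) f
  induction x using FreeAlgebra.induction with
  | grade0 c =>
    rw [AlgHom.commutes]
    exact Subalgebra.algebraMap_mem _ _
  | grade1 x =>
    obtain ⟨i, a⟩ := x
    rcases par_eq i with h | h
    · exact Algebra.subset_adjoin ⟨(⟨i, pos_of_par h⟩, a), rfl⟩
    · exact Algebra.subset_adjoin ⟨(⟨-i, pos_of_par (by rw [par_neg, h])⟩, -a), t_neg i a⟩
  | mul x y hx hy =>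
    rw [map_mul]
    exact Subalgebra.mul_mem _ (hx trivial) (hy trivial)
  | add x y hx hy =>
    rw [map_add]
    exact Subalgebra.add_mem _ (hx trivial) (hy trivial)

theorem Tbar_eq {s n : ℕ} (b : Idx n) (α : Idx s) :
    Tbar s n b α = mkAbar s n (TbarFree s n b α) := by
  rw [TbarFree, map_smul]
  rfl

theorem tbar_neg {s n : ℕ} (α : Idx s) (b : Idx n) :
    tbar s n α b = (-1 : Kq) ^ (par α + par b) • tbar s n (-α) (-b) := by
  have h := mkAbar_rel (AbarRel.neg α b)
  rwa [map_smul] at h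

theorem Tbar_neg {s n : ℕ} (b : Idx n) (α : Idx s) : Tbar s n (-b) (-α) = Tbar s n b α := by
  rw [Tbar, Tbar, tbar_neg α b, smul_smul, ← pow_add]
  congr 1
  apply sign_congr_zmod
  push_cast [par_neg_zmod]
  generalize (par α : ZMod 2) = z
  generalize (par b : ZMod 2) = w
  decide +revert

theorem rel_Tbar {s n : ℕ} (a : Idx n) (α : Idx s) (b : Idx n) (β : Idx s) :
    relL (fun i a j b => (-1 : Kq) ^ ((par i + par a) * (par j + par b)) •
      (Tbar s n j b * Tbar s n i a)) a α b β =
    relR (fun i a j b => (-1 : Kq) ^ ((par i + par a) * (par j + par b)) •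
      (Tbar s n j b * Tbar s n i a)) a α b β := by
  have h := mkAbar_rel (AbarRel.tts a α b β)
  have e1 := map_mulScalar (mkAbar s n).toLinearMap
    (superMul (LinearMap.mul Kq _) (leg1 (Idx n) (TbarFree s n)) (leg2 (Idx s) (TbarFree s n)))
      a α b β
  have e2 := map_scalarMul (mkAbar s n).toLinearMap
    (superMul (LinearMap.mul Kq _) (leg2 (Idx n) (TbarFree s n)) (leg1 (Idx s) (TbarFree s n)))
      a α b β
  simp only [map_superMul_leg12, map_superMul_leg21, ← Tbar_eq] at e1 e2
  exact (scalarMul_leg21 (Tbar s n) a α b β).symm.trans (e2.symm.trans (h.symm.trans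
    (e1.trans (mulScalar_leg12 (Tbar s n) a α b β))))

/-- The generators of `Ā_{s,n}` in the negative rows. -/
def Tminus (s n : ℕ) (α : IdxPos s) (b : Idx n) : Abar s n := tbar s n (-α.1) b

/-- For odd α the exponent |b|(|α| + |b|) is even, so T̄ has no sign in the negative rows. This is
the reason for presenting Ā_{s,n} by them. -/
theorem Tminus_eq_Tbar {s n : ℕ} (α : IdxPos s) (b : Idx n) :
    Tminus s n α b = Tbar s n b (-α.1) := by
  rw [Tbar, sign_congr_zmod (b := 0), pow_zero, one_smul, Tminus]
  push_cast [par_neg_zmod, par_of_pos α.2]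
  generalize (par b : ZMod 2) = w
  decide +revert

theorem rtt_Tminus (s n : ℕ) : RTT cB eB (Hbar n) (Tminus s n) := by
  intro α β a b
  have h := rel_Tbar a (-α.1) b (-β.1)
  rw [relL_neg _ Tbar_neg, relR_neg] at h
  simp only [Tminus_eq_Tbar]
  exact (smul_right_injective _ (neg_one_pow_ne_zero _) h).symm

/-- A family on the negative rows that satisfies the relations extends to `Ā_{s,n}`. -/
theorem exists_hom_Abar {s n : ℕ} {E : Type} [Ring E] [Algebra Kq E] (T : IdxPos s → Idx n → E)
    (hT : RTT cB eB (Hbar n) T) :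
    ∃ F : Abar s n →ₐ[Kq] E, ∀ α b, F (Tminus s n α b) = T α b := by
  let X : Idx n → Idx s → E := fun b α =>
    if h : par α = 0 then T ⟨α, pos_of_par h⟩ (-b)
    else T ⟨-α, pos_of_par (by rw [par_neg]; have := par_eq α; omega)⟩ b
  have hX : ∀ (α : IdxPos s) b, X b (-α.1) = T α b := fun α b => by
    have h : ¬ par (-α.1) = 0 := by rw [par_neg, par_of_pos α.2]; omega
    simp only [X, h, dif_neg, not_false_iff, neg_neg_idx]
  have hX' : ∀ b α, X (-b) (-α) = X b α := by
    intro b α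
    rcases par_eq α with h | h
    · have h' : ¬ par (-α) = 0 := by rw [par_neg, h]; omega
      simp only [X, h, h', dif_pos, dif_neg, not_false_iff, neg_neg_idx]
    · have h' : par (-α) = 0 := by rw [par_neg, h]
      have h'' : ¬ par α = 0 := by omega
      simp only [X, h', h'', dif_pos, dif_neg, not_false_iff, neg_neg_idx]
  have hrel := rel_of_cols (B := fun i a j b => (-1 : Kq) ^ ((par i + par a) * (par j + par b)) •
      (X j b * X i a)) (fun i a j b => by
        rw [hX']
        congr 1
        apply sign_congr_zmod
        push_cast [par_neg_zmod]
        generalize (par i : ZMod 2) = x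
        generalize (par j : ZMod 2) = y
        generalize (par a : ZMod 2) = z
        generalize (par b : ZMod 2) = w
        decide +revert)
    (fun i a j b => by
        rw [hX']
        congr 1
        apply sign_congr_zmod
        push_cast [par_neg_zmod]
        generalize (par i : ZMod 2) = x
        generalize (par j : ZMod 2) = y
        generalize (par a : ZMod 2) = z
        generalize (par b : ZMod 2) = w
        decide +revert) (fun i a j b => by
      rw [relL_neg _ hX', relR_neg]
      simp only [hX]
      rw [hT a b i j])
  -- The sign is its own inverse and cancels the one in `TbarFree`, so that `F` sends the matrix T̄
  -- to `X`.
  let F : FreeAlgebra Kq (Idx s × Idx n) →ₐ[Kq] E :=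
    FreeAlgebra.lift Kq fun x => (-1 : Kq) ^ (par x.2 * (par x.1 + par x.2)) • X x.2 x.1
  have hι : ∀ α b, F (FreeAlgebra.ι Kq (α, b)) =
      (-1 : Kq) ^ (par b * (par α + par b)) • X b α := fun α b => by simp [F]
  have hF : ∀ b α, F (TbarFree s n b α) = X b α := fun b α => by
    rw [TbarFree, map_smul, hι, smul_smul, ← pow_add, sign_congr_zmod (b := 0), pow_zero, one_smul]
    push_cast
    rw [CharTwo.add_self_eq_zero]
  refine ⟨liftAbar F ?_, fun α b => ?_⟩
  · intro x y h
    cases h with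
    | neg α b =>
      rw [map_smul, hι, hι, hX', smul_smul, ← pow_add]
      congr 1
      apply sign_congr_zmod
      push_cast [par_neg_zmod]
      generalize (par α : ZMod 2) = z
      generalize (par b : ZMod 2) = w
      decide +revert
    | tts a α b β =>
      have e1 := map_mulScalar F.toLinearMap
        (superMul (LinearMap.mul Kq _) (leg1 (Idx n) (TbarFree s n)) (leg2 (Idx s) (TbarFree s n)))
          a α b β
      have e2 := map_scalarMul F.toLinearMap
        (superMul (LinearMap.mul Kq _) (leg2 (Idx n) (TbarFree s n)) (leg1 (Idx s) (TbarFree s n)))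
          a α b β
      simp only [map_superMul_leg12, map_superMul_leg21, hF] at e1 e2
      exact e1.trans ((mulScalar_leg12 X a α b β).trans ((hrel a α b β).symm.trans
        ((scalarMul_leg21 X a α b β).symm.trans e2.symm)))
  · rw [Tminus_eq_Tbar, Tbar_eq, ← hX]
    exact (RingQuot.liftAlgHom_mkAlgHom_apply _ _ _ _).trans (hF _ _)

theorem adjoin_Tminus (s n : ℕ) :
    Algebra.adjoin Kq (Set.range fun x : IdxPos s × Idx n => Tminus s n x.1 x.2) = ⊤ := by
  rw [eq_top_iff]
  intro f _
  obtain ⟨x, rfl⟩ : ∃ x, mkAbar s n x = f := RingQuot.mkAlgHom_surjective Kq (AbarRel s n) f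
  induction x using FreeAlgebra.induction with
  | grade0 c =>
    rw [AlgHom.commutes]
    exact Subalgebra.algebraMap_mem _ _
  | grade1 x =>
    obtain ⟨α, b⟩ := x
    change tbar s n α b ∈ _
    rcases par_eq α with h | h
    · rw [tbar_neg]
      exact Subalgebra.smul_mem _ (Algebra.subset_adjoin
        (Set.mem_range_self ((⟨α, pos_of_par h⟩, -b) : IdxPos s × Idx n))) _
    · refine Algebra.subset_adjoin ⟨(⟨-α, pos_of_par (by rw [par_neg, h])⟩, b), ?_⟩
      simp only [Tminus, neg_neg_idx]
  | mul x y hx hy =>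
    rw [map_mul]
    exact Subalgebra.mul_mem _ (hx trivial) (hy trivial)
  | add x y hx hy =>
    rw [map_add]
    exact Subalgebra.add_mem _ (hx trivial) (hy trivial)

/-! ### Twisted tensor products of algebras -/

section twist

variable {B C : Type} [Ring B] [Algebra Kq B] [Ring C] [Algebra Kq C]

/-- Left multiplication by `x ⊗ 1` on `B ⊗ C`. -/
def lmul (x : B) : B ⊗[Kq] C →ₗ[Kq] B ⊗[Kq] C := LinearMap.rTensor C (LinearMap.mulLeft Kq x)

/-- Right multiplication by `1 ⊗ y` on `B ⊗ C`. -/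
def rmul (y : C) : B ⊗[Kq] C →ₗ[Kq] B ⊗[Kq] C := LinearMap.lTensor B (LinearMap.mulRight Kq y)

@[simp]
theorem lmul_tmul (x x' : B) (y : C) : lmul x (x' ⊗ₜ[Kq] y) = (x * x') ⊗ₜ y := rfl

@[simp]
theorem rmul_tmul (y y' : C) (x : B) : rmul y (x ⊗ₜ[Kq] y') = x ⊗ₜ (y' * y) := rfl

theorem rmul_lmul (x : B) (y : C) (z : B ⊗[Kq] C) : rmul y (lmul x z) = lmul x (rmul y z) := by
  induction z with
  | zero => simp
  | tmul a b => simp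
  | add a b ha hb => simp only [map_add, ha, hb]

theorem lmul_lmul (x x' : B) (z : B ⊗[Kq] C) : lmul x (lmul x' z) = lmul (x * x') z := by
  induction z with
  | zero => simp
  | tmul a b => simp [mul_assoc]
  | add a b ha hb => simp only [map_add, ha, hb]

theorem rmul_rmul (y y' : C) (z : B ⊗[Kq] C) : rmul y (rmul y' z) = rmul (y' * y) z := by
  induction z with
  | zero => simp
  | tmul a b => simp [mul_assoc]
  | add a b ha hb => simp only [map_add, ha, hb]

/-- Left multiplication by `1 ⊗ c` on `B ⊗ C`, with respect to `Y`. -/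
def lAct (Y : C ⊗[Kq] B →ₗ[Kq] B ⊗[Kq] C) (c : C) : B ⊗[Kq] C →ₗ[Kq] B ⊗[Kq] C :=
  mulRight B C ∘ₗ LinearMap.rTensor C (Y ∘ₗ TensorProduct.mk Kq C B c)

/-- Right multiplication by `b ⊗ 1` on `B ⊗ C`, with respect to `Y`. -/
def rAct (Y : C ⊗[Kq] B →ₗ[Kq] B ⊗[Kq] C) (b : B) : B ⊗[Kq] C →ₗ[Kq] B ⊗[Kq] C :=
  mulLeft C B ∘ₗ (TensorProduct.assoc Kq B B C).symm.toLinearMap ∘ₗ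
    LinearMap.lTensor B (Y ∘ₗ (TensorProduct.mk Kq C B).flip b)

theorem mulRight_tmul (z : B ⊗[Kq] C) (y : C) : mulRight B C (z ⊗ₜ y) = rmul y z := by
  induction z with
  | zero => simp
  | tmul a b => rfl
  | add a b ha hb => simp only [map_add, TensorProduct.add_tmul, ha, hb]

theorem mulLeft_assoc_symm (x : B) (z : B ⊗[Kq] C) :
    mulLeft C B ((TensorProduct.assoc Kq B B C).symm (x ⊗ₜ z)) = lmul x z := by
  induction z with
  | zero => simp
  | tmul a b => rfl
  | add a b ha hb => simp only [map_add, TensorProduct.tmul_add, ha, hb]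

@[simp]
theorem lAct_tmul (Y : C ⊗[Kq] B →ₗ[Kq] B ⊗[Kq] C) (c : C) (x : B) (y : C) :
    lAct Y c (x ⊗ₜ y) = rmul y (Y (c ⊗ₜ x)) :=
  mulRight_tmul _ _

@[simp]
theorem rAct_tmul (Y : C ⊗[Kq] B →ₗ[Kq] B ⊗[Kq] C) (b : B) (x : B) (y : C) :
    rAct Y b (x ⊗ₜ y) = lmul x (Y (y ⊗ₜ b)) :=
  mulLeft_assoc_symm _ _

theorem mulRight_onLeft_onRight (Y : C ⊗[Kq] B →ₗ[Kq] B ⊗[Kq] C) (c c' : C) (b : B) :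
    mulRight B C (onLeft Y (onRight Y ((c ⊗ₜ c') ⊗ₜ b))) = lAct Y c (Y (c' ⊗ₜ b)) := by
  change mulRight B C (onLeft Y ((TensorProduct.assoc Kq C B C).symm (c ⊗ₜ Y (c' ⊗ₜ b)))) = _
  induction Y (c' ⊗ₜ b) with
  | zero => simp
  | tmul a d => rfl
  | add a d ha hd => simp only [map_add, TensorProduct.tmul_add, ha, hd]

theorem mulLeft_onRight_onLeft (Y : C ⊗[Kq] B →ₗ[Kq] B ⊗[Kq] C) (c : C) (b b' : B) :
    mulLeft C B (onRight Y (onLeft Y ((c ⊗ₜ b) ⊗ₜ b'))) = rAct Y b' (Y (c ⊗ₜ b)) := by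
  change mulLeft C B (onRight Y (Y (c ⊗ₜ b) ⊗ₜ b')) = _
  induction Y (c ⊗ₜ b) with
  | zero => simp
  | tmul a d => rfl
  | add a d ha hd => simp only [map_add, TensorProduct.add_tmul, ha, hd]

/-- `Y` exchanges the factors `C` and `B` compatibly with the units and the multiplications. -/
structure IsTwist (Y : C ⊗[Kq] B →ₗ[Kq] B ⊗[Kq] C) : Prop where
  one_tmul : ∀ b, Y (1 ⊗ₜ b) = b ⊗ₜ 1
  tmul_one : ∀ c, Y (c ⊗ₜ 1) = 1 ⊗ₜ c
  tmul_mul : ∀ c b b', Y (c ⊗ₜ (b * b')) = rAct Y b' (Y (c ⊗ₜ b))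
  mul_tmul : ∀ c c' b, Y ((c * c') ⊗ₜ b) = lAct Y c (Y (c' ⊗ₜ b))

theorem IsTwist.mul_right {Y : C ⊗[Kq] B →ₗ[Kq] B ⊗[Kq] C} (hY : IsTwist Y) :
    Y ∘ₗ mulRight C B = mulLeft C B ∘ₗ onRight Y ∘ₗ onLeft Y := by
  apply TensorProduct.ext_threefold
  intro c b b'
  exact (hY.tmul_mul c b b').trans (mulLeft_onRight_onLeft Y c b b').symm

theorem IsTwist.mul_left {Y : C ⊗[Kq] B →ₗ[Kq] B ⊗[Kq] C} (hY : IsTwist Y) :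
    Y ∘ₗ mulLeft B C = mulRight B C ∘ₗ onLeft Y ∘ₗ onRight Y := by
  apply TensorProduct.ext_threefold
  intro c c' b
  exact (hY.mul_tmul c c' b).trans (mulRight_onLeft_onRight Y c c' b).symm

theorem tmul_mul_of_mul_right {Y : C ⊗[Kq] B →ₗ[Kq] B ⊗[Kq] C}
    (h : Y ∘ₗ mulRight C B = mulLeft C B ∘ₗ onRight Y ∘ₗ onLeft Y) (c : C) (b b' : B) :
    Y (c ⊗ₜ (b * b')) = rAct Y b' (Y (c ⊗ₜ b)) :=
  (LinearMap.congr_fun h ((c ⊗ₜ b) ⊗ₜ b')).trans (mulLeft_onRight_onLeft Y c b b')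

theorem mul_tmul_of_mul_left {Y : C ⊗[Kq] B →ₗ[Kq] B ⊗[Kq] C}
    (h : Y ∘ₗ mulLeft B C = mulRight B C ∘ₗ onLeft Y ∘ₗ onRight Y) (c c' : C) (b : B) :
    Y ((c * c') ⊗ₜ b) = lAct Y c (Y (c' ⊗ₜ b)) :=
  (LinearMap.congr_fun h ((c ⊗ₜ c') ⊗ₜ b)).trans (mulRight_onLeft_onRight Y c c' b)

theorem twistedMul_tmul (Y : C ⊗[Kq] B →ₗ[Kq] B ⊗[Kq] C) (x : B) (y : C) (z : B ⊗[Kq] C) :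
    twistedMul Y ((x ⊗ₜ y) ⊗ₜ z) = lmul x (lAct Y y z) := by
  induction z with
  | zero => simp
  | tmul a d =>
    rw [lAct_tmul]
    change TensorProduct.map (LinearMap.mul' Kq B) (LinearMap.mul' Kq C)
      ((TensorProduct.assoc Kq B B (C ⊗[Kq] C)).symm
        (x ⊗ₜ (TensorProduct.assoc Kq B C C (Y (y ⊗ₜ a) ⊗ₜ d)))) = _
    induction Y (y ⊗ₜ a) with
    | zero => simp
    | tmul a d => rfl
    | add a d ha hd => simp only [map_add, TensorProduct.tmul_add, TensorProduct.add_tmul, ha, hd]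
  | add a d ha hd => simp only [map_add, TensorProduct.tmul_add, ha, hd]

variable {Y : C ⊗[Kq] B →ₗ[Kq] B ⊗[Kq] C}

theorem lAct_rmul (y y' : C) (z : B ⊗[Kq] C) : lAct Y y (rmul y' z) = rmul y' (lAct Y y z) := by
  induction z with
  | zero => simp
  | tmul a d => simp only [lAct_tmul, rmul_tmul, rmul_rmul]
  | add a d ha hd => simp only [map_add, ha, hd]

theorem IsTwist.lAct_lAct (hY : IsTwist Y) (y y' : C) (z : B ⊗[Kq] C) :
    lAct Y y (lAct Y y' z) = lAct Y (y * y') z := by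
  induction z with
  | zero => simp
  | tmul a d => rw [lAct_tmul, lAct_tmul, lAct_rmul, hY.mul_tmul]
  | add a d ha hd => simp only [map_add, ha, hd]

/-- The product of `B ⊗ C` determined by `Y`. -/
def tmulY (Y : C ⊗[Kq] B →ₗ[Kq] B ⊗[Kq] C) (o o' : B ⊗[Kq] C) : B ⊗[Kq] C :=
  twistedMul Y (o ⊗ₜ o')

theorem tmulY_tmul (x : B) (y : C) (z : B ⊗[Kq] C) :
    tmulY Y (x ⊗ₜ y) z = lmul x (lAct Y y z) := twistedMul_tmul Y x y z

theorem tmulY_add_left (o o' z : B ⊗[Kq] C) : tmulY Y (o + o') z = tmulY Y o z + tmulY Y o' z := by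
  simp only [tmulY, TensorProduct.add_tmul, map_add]

theorem tmulY_add_right (z o o' : B ⊗[Kq] C) : tmulY Y z (o + o') = tmulY Y z o + tmulY Y z o' := by
  simp only [tmulY, TensorProduct.tmul_add, map_add]

theorem tmulY_zero_left (z : B ⊗[Kq] C) : tmulY Y 0 z = 0 := by
  simp only [tmulY, TensorProduct.zero_tmul, map_zero]

theorem tmulY_zero_right (z : B ⊗[Kq] C) : tmulY Y z 0 = 0 := by
  simp only [tmulY, TensorProduct.tmul_zero, map_zero]

theorem tmulY_smul_left (k : Kq) (o z : B ⊗[Kq] C) : tmulY Y (k • o) z = k • tmulY Y o z := by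
  rw [tmulY, ← TensorProduct.smul_tmul', map_smul, tmulY]

theorem tmulY_smul_right (k : Kq) (o z : B ⊗[Kq] C) : tmulY Y o (k • z) = k • tmulY Y o z := by
  simp only [tmulY, TensorProduct.tmul_smul, map_smul]

theorem tmulY_sum_left {ι : Type} (s : Finset ι) (f : ι → B ⊗[Kq] C) (z : B ⊗[Kq] C) :
    tmulY Y (∑ i ∈ s, f i) z = ∑ i ∈ s, tmulY Y (f i) z := by
  simp only [tmulY, TensorProduct.sum_tmul, map_sum]

theorem tmulY_sum_right {ι : Type} (s : Finset ι) (f : ι → B ⊗[Kq] C) (z : B ⊗[Kq] C) :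
    tmulY Y z (∑ i ∈ s, f i) = ∑ i ∈ s, tmulY Y z (f i) := by
  simp only [tmulY, TensorProduct.tmul_sum, map_sum]

theorem lmul_tmulY (x : B) (o o' : B ⊗[Kq] C) : tmulY Y (lmul x o) o' = lmul x (tmulY Y o o') := by
  induction o with
  | zero => simp [tmulY_zero_left]
  | tmul a d => rw [lmul_tmul, tmulY_tmul, tmulY_tmul, lmul_lmul]
  | add a d ha hd => simp only [map_add, tmulY_add_left, ha, hd]

theorem rmul_tmulY (y : C) (o o' : B ⊗[Kq] C) (hY : IsTwist Y) :
    tmulY Y (rmul y o) o' = tmulY Y o (lAct Y y o') := by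
  induction o with
  | zero => simp [tmulY_zero_left]
  | tmul a d => rw [rmul_tmul, tmulY_tmul, tmulY_tmul, hY.lAct_lAct]
  | add a d ha hd => simp only [map_add, tmulY_add_left, ha, hd]

theorem tmulY_rmul (y : C) (o o' : B ⊗[Kq] C) : tmulY Y o (rmul y o') = rmul y (tmulY Y o o') := by
  induction o with
  | zero => simp [tmulY_zero_left]
  | tmul a d => rw [tmulY_tmul, tmulY_tmul, lAct_rmul, rmul_lmul]
  | add a d ha hd => simp only [map_add, tmulY_add_left, ha, hd]

/-- This is the rule for a product in the second argument of `Y`, read as the associativity of (1 ⊗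
y)(x ⊗ 1)z. -/
theorem IsTwist.lAct_lmul (hY : IsTwist Y) (y : C) (x : B) (z : B ⊗[Kq] C) :
    lAct Y y (lmul x z) = tmulY Y (Y (y ⊗ₜ x)) z := by
  induction z with
  | zero => simp [tmulY_zero_right]
  | tmul a d =>
    rw [lmul_tmul, lAct_tmul, hY.tmul_mul]
    induction Y (y ⊗ₜ x) with
    | zero => simp [tmulY_zero_left]
    | tmul a' d' => rw [rAct_tmul, tmulY_tmul, lAct_tmul, rmul_lmul]
    | add a d ha hd => simp only [map_add, tmulY_add_left, ha, hd]
  | add a d ha hd => simp only [map_add, tmulY_add_right, ha, hd]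

/-- Factors from B on the far left pass through. The remaining associativity is split between the
two multiplication rules of a twist, in the forms `lAct_lAct` and `lAct_lmul`. -/
theorem IsTwist.tmulY_assoc (hY : IsTwist Y) (o o' o'' : B ⊗[Kq] C) :
    tmulY Y (tmulY Y o o') o'' = tmulY Y o (tmulY Y o' o'') := by
  induction o with
  | zero => simp [tmulY_zero_left]
  | tmul x y =>
    rw [tmulY_tmul, tmulY_tmul, lmul_tmulY]
    congr 1
    induction o' with
    | zero => simp [tmulY_zero_left]
    | tmul a d => rw [lAct_tmul, tmulY_tmul, rmul_tmulY _ _ _ hY, hY.lAct_lmul]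
    | add a d ha hd => simp only [map_add, tmulY_add_left, ha, hd]
  | add a d ha hd => simp only [tmulY_add_left, ha, hd]

theorem IsTwist.one_tmulY (hY : IsTwist Y) (o : B ⊗[Kq] C) : tmulY Y (1 ⊗ₜ 1) o = o := by
  rw [tmulY_tmul]
  induction o with
  | zero => simp
  | tmul a d => simp [hY.one_tmul]
  | add a d ha hd => simp only [map_add, ha, hd]

theorem IsTwist.tmulY_one (hY : IsTwist Y) (o : B ⊗[Kq] C) : tmulY Y o (1 ⊗ₜ 1) = o := by
  induction o with
  | zero => simp [tmulY_zero_left]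
  | tmul a d => simp [tmulY_tmul, hY.tmul_one]
  | add a d ha hd => simp only [tmulY_add_left, ha, hd]

/-- The space `B ⊗ C` with the product determined by `Y`. -/
def TwistAlg {Y : C ⊗[Kq] B →ₗ[Kq] B ⊗[Kq] C} (_ : IsTwist Y) : Type := B ⊗[Kq] C

instance (hY : IsTwist Y) : AddCommGroup (TwistAlg hY) :=
  inferInstanceAs (AddCommGroup (B ⊗[Kq] C))

instance (hY : IsTwist Y) : Module Kq (TwistAlg hY) :=
  inferInstanceAs (Module Kq (B ⊗[Kq] C))

instance (hY : IsTwist Y) : Ring (TwistAlg hY) where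
  __ := (inferInstance : AddCommGroup (TwistAlg hY))
  mul := tmulY Y
  one := 1 ⊗ₜ 1
  left_distrib := tmulY_add_right
  right_distrib := tmulY_add_left
  zero_mul := tmulY_zero_left
  mul_zero := tmulY_zero_right
  mul_assoc := hY.tmulY_assoc
  one_mul := hY.one_tmulY
  mul_one := hY.tmulY_one

instance (hY : IsTwist Y) : Algebra Kq (TwistAlg hY) :=
  Algebra.ofModule tmulY_smul_left tmulY_smul_right

end twist

/-! ### Twists determined by matrix representations -/

section matrices

variable {B C : Type} [Ring B] [Algebra Kq B] [Ring C] [Algebra Kq C]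
  {K X L Z : Type} [Fintype X] [DecidableEq X] [Fintype Z] [DecidableEq Z]

/-- The operator `b ⊗ c ↦ ∑ M(b)_{x x'} ⊗ w_{x'} c`. -/
def rowOp (M : B →ₐ[Kq] Matrix X X B) (w : X → C) (x : X) :
    B ⊗[Kq] C →ₗ[Kq] B ⊗[Kq] C :=
  ∑ x', TensorProduct.map ((Matrix.entryLinearMap Kq B x x') ∘ₗ M.toLinearMap)
    (LinearMap.mulLeft Kq (w x'))

/-- The operator `b ⊗ c ↦ ∑ b z_{y'} ⊗ M'(c)_{y' y}`. -/
def colOp (M' : C →ₐ[Kq] Matrix Z Z C) (z : Z → B) (y : Z) :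
    B ⊗[Kq] C →ₗ[Kq] B ⊗[Kq] C :=
  ∑ y', TensorProduct.map (LinearMap.mulRight Kq (z y'))
    ((Matrix.entryLinearMap Kq C y' y) ∘ₗ M'.toLinearMap)

theorem rowOp_tmul (M : B →ₐ[Kq] Matrix X X B) (w : X → C) (x : X) (b : B) (c : C) :
    rowOp M w x (b ⊗ₜ c) = ∑ x', M b x x' ⊗ₜ (w x' * c) := by
  simp [rowOp, LinearMap.sum_apply]

theorem colOp_tmul (M' : C →ₐ[Kq] Matrix Z Z C) (z : Z → B) (y : Z) (b : B) (c : C) :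
    colOp M' z y (b ⊗ₜ c) = ∑ y', (b * z y') ⊗ₜ M' c y' y := by
  simp [colOp, LinearMap.sum_apply]

theorem rowOp_rmul (M : B →ₐ[Kq] Matrix X X B) (w : X → C) (x : X) (d : C) (o : B ⊗[Kq] C) :
    rowOp M w x (rmul d o) = rmul d (rowOp M w x o) := by
  induction o with
  | zero => simp
  | tmul b c => simp only [rmul_tmul, rowOp_tmul, map_sum, mul_assoc]
  | add a b ha hb => simp only [map_add, ha, hb]

theorem colOp_lmul (M' : C →ₐ[Kq] Matrix Z Z C) (z : Z → B) (y : Z) (d : B) (o : B ⊗[Kq] C) :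
    colOp M' z y (lmul d o) = lmul d (colOp M' z y o) := by
  induction o with
  | zero => simp
  | tmul b c => simp only [lmul_tmul, colOp_tmul, map_sum, mul_assoc]
  | add a b ha hb => simp only [map_add, ha, hb]

/-- The two operators are the future left multiplication by w_x and right multiplication by z_y.
Since `M` and `M'` are multiplicative, the hypothesis on pairs of generators already makes them
commute everywhere. -/
theorem rowOp_colOp (M : B →ₐ[Kq] Matrix X X B) (w : X → C) (M' : C →ₐ[Kq] Matrix Z Z C) (z : Z → B)
    (h : ∀ x y, ∑ x', M (z y) x x' ⊗ₜ[Kq] w x' = ∑ y', z y' ⊗ₜ[Kq] M' (w x) y' y)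
    (x : X) (y : Z) (o : B ⊗[Kq] C) :
    rowOp M w x (colOp M' z y o) = colOp M' z y (rowOp M w x o) := by
  induction o with
  | zero => simp
  | tmul b c =>
    have h1 : ∀ y', rowOp M w x ((b * z y') ⊗ₜ[Kq] M' c y' y) =
        ∑ x'', lmul (M b x x'') (rmul (M' c y' y) (∑ x', M (z y') x'' x' ⊗ₜ[Kq] w x')) := by
      intro y'
      rw [rowOp_tmul, map_mul]
      simp only [Matrix.mul_apply, TensorProduct.sum_tmul, map_sum, rmul_tmul, lmul_tmul]
      exact Finset.sum_comm
    have h2 : ∀ x', colOp M' z y (M b x x' ⊗ₜ[Kq] (w x' * c)) =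
        ∑ y', lmul (M b x x') (rmul (M' c y' y) (∑ y'', z y'' ⊗ₜ[Kq] M' (w x') y'' y')) := by
      intro x'
      rw [colOp_tmul, map_mul]
      simp only [Matrix.mul_apply, TensorProduct.tmul_sum, map_sum, rmul_tmul, lmul_tmul]
      exact Finset.sum_comm
    rw [colOp_tmul, rowOp_tmul, map_sum, map_sum]
    simp only [h1, h2, h]
    exact Finset.sum_comm
  | add a b ha hb => simp only [map_add, ha, hb]

/-- The operators `rowOp` prescribe left multiplication by the generators of C on B ⊗ C. No relation
of C has to be verified for them: they commute with the right multiplications, and the latter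
produce all of B ⊗ C from 1 ⊗ 1, where a word in the generators acts through its value in C. The
representations of B and C enter only through the commutation of rows and columns. -/
theorem exists_isTwist (w : K → X → C) (z : L → Z → B) (M : K → B →ₐ[Kq] Matrix X X B)
    (M' : L → C →ₐ[Kq] Matrix Z Z C)
    (hw : Algebra.adjoin Kq (Set.range fun p : K × X => w p.1 p.2) = ⊤)
    (hz : Algebra.adjoin Kq (Set.range fun p : L × Z => z p.1 p.2) = ⊤)
    (h : ∀ k x l y, ∑ x', M k (z l y) x x' ⊗ₜ[Kq] w k x' =
      ∑ y', z l y' ⊗ₜ[Kq] M' l (w k x) y' y) :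
    ∃ Y : C ⊗[Kq] B →ₗ[Kq] B ⊗[Kq] C, IsTwist Y ∧
      (∀ k x b, Y (w k x ⊗ₜ b) = ∑ x', M k b x x' ⊗ₜ w k x') ∧
      (∀ c l y, Y (c ⊗ₜ z l y) = ∑ y', z l y' ⊗ₜ M' l c y' y) := by
  let π : FreeAlgebra Kq (K × X) →ₐ[Kq] C := FreeAlgebra.lift Kq fun p => w p.1 p.2
  -- The action starts from the free algebra, since C is known only by its generators; `hker` shows
  -- that it descends to C.
  let N : FreeAlgebra Kq (K × X) →ₐ[Kq] Module.End Kq (B ⊗[Kq] C) :=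
    FreeAlgebra.lift Kq fun p => rowOp (M p.1) (w p.1) p.2
  have hπι : ∀ p, π (FreeAlgebra.ι Kq p) = w p.1 p.2 := fun p => by simp [π]
  have hNι : ∀ p, N (FreeAlgebra.ι Kq p) = rowOp (M p.1) (w p.1) p.2 := fun p => by simp [N]
  have hπ : Function.Surjective π := by
    rw [← AlgHom.range_eq_top, eq_top_iff, ← hw]
    apply Algebra.adjoin_le
    rintro _ ⟨p, rfl⟩
    exact ⟨FreeAlgebra.ι Kq p, hπι p⟩
  have hcomm : ∀ R : Module.End Kq (B ⊗[Kq] C),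
      (∀ k x o, rowOp (M k) (w k) x (R o) = R (rowOp (M k) (w k) x o)) →
      ∀ P o, N P (R o) = R (N P o) := by
    intro R hR P
    induction P using FreeAlgebra.induction with
    | grade0 c => intro o; simp [Module.algebraMap_end_apply]
    | grade1 p => intro o; rw [hNι]; exact hR _ _ _
    | mul P Q hP hQ => intro o; rw [map_mul, Module.End.mul_apply, Module.End.mul_apply, hQ, hP]
    | add P Q hP hQ =>
      intro o
      rw [map_add, LinearMap.add_apply, LinearMap.add_apply, hQ, hP, map_add]
  have hNr : ∀ P d o, N P (rmul d o) = rmul d (N P o) :=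
    fun P d => hcomm (rmul d) (fun k x o => rowOp_rmul _ _ _ _ _) P
  have hN1 : ∀ P c, N P (1 ⊗ₜ c) = 1 ⊗ₜ (π P * c) := by
    intro P
    induction P using FreeAlgebra.induction with
    | grade0 k =>
      intro c
      simp [Module.algebraMap_end_apply, Algebra.algebraMap_eq_smul_one]
    | grade1 p =>
      intro c
      rw [hNι, hπι, rowOp_tmul, map_one, Finset.sum_eq_single p.2]
      · simp
      · intro x _ hx
        simp [Matrix.one_apply_ne (Ne.symm hx)]
      · simp
    | mul P Q hP hQ => intro c; rw [map_mul, map_mul, Module.End.mul_apply, hQ, hP, mul_assoc]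
    | add P Q hP hQ =>
      intro c
      rw [map_add, map_add, LinearMap.add_apply, hQ, hP, add_mul, TensorProduct.tmul_add]
  -- Right multiplication by b ⊗ 1, assembled from the operators `colOp` along an expression of b in
  -- generators.
  have hR : ∀ b : B, ∃ R : Module.End Kq (B ⊗[Kq] C),
      (∀ P o, N P (R o) = R (N P o)) ∧ (∀ x o, R (lmul x o) = lmul x (R o)) ∧
      ∀ b', R (b' ⊗ₜ 1) = (b' * b) ⊗ₜ 1 := by
    intro b
    have hb : b ∈ Algebra.adjoin Kq (Set.range fun p : L × Z => z p.1 p.2) := by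
      rw [hz]
      trivial
    induction hb using Algebra.adjoin_induction with
    | mem b hb =>
      obtain ⟨⟨l, y⟩, rfl⟩ := hb
      refine ⟨colOp (M' l) (z l) y, hcomm _ fun k x o => rowOp_colOp _ _ _ _ (h k · l ·) x y o,
        fun x o => colOp_lmul _ _ _ _ _, fun b' => ?_⟩
      rw [colOp_tmul, map_one, Finset.sum_eq_single y]
      · simp
      · intro x _ hx
        simp [Matrix.one_apply_ne hx]
      · simp
    | algebraMap k =>
      refine ⟨k • LinearMap.id, fun P o => by simp, fun x o => by simp, fun b' => ?_⟩
      rw [Algebra.algebraMap_eq_smul_one, mul_smul_comm, mul_one]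
      rfl
    | add b b' _ _ ih ih' =>
      obtain ⟨R, h1, h2, h3⟩ := ih
      obtain ⟨R', h1', h2', h3'⟩ := ih'
      refine ⟨R + R', fun P o => ?_, fun x o => ?_, fun b'' => ?_⟩
      · simp only [LinearMap.add_apply, map_add, h1, h1']
      · simp only [LinearMap.add_apply, map_add, h2, h2']
      · simp only [LinearMap.add_apply, h3, h3', mul_add, TensorProduct.add_tmul]
    | mul b b' _ _ ih ih' =>
      obtain ⟨R, h1, h2, h3⟩ := ih
      obtain ⟨R', h1', h2', h3'⟩ := ih'
      refine ⟨R' * R, fun P o => ?_, fun x o => ?_, fun b'' => ?_⟩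
      · simp only [Module.End.mul_apply, h1, h1']
      · simp only [Module.End.mul_apply, h2, h2']
      · simp only [Module.End.mul_apply, h3, h3', mul_assoc]
  -- A vector b ⊗ c is the image of 1 ⊗ 1 under operators that commute with `N P`, and `N P` sends 1
  -- ⊗ 1 to 1 ⊗ π P = 0.
  have hker : ∀ P, π P = 0 → N P = 0 := by
    intro P hP
    ext b c
    obtain ⟨R, h1, h2, h3⟩ := hR b
    have e : b ⊗ₜ[Kq] c = rmul c (R (1 ⊗ₜ 1)) := by
      rw [h3, one_mul, rmul_tmul, one_mul]
    change N P (b ⊗ₜ[Kq] c) = 0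
    rw [e, hNr, h1, hN1, hP]
    simp
  have hker' : ∀ P Q, π P = π Q → N P = N Q := fun P Q e => by
    rw [← sub_eq_zero, ← map_sub]
    exact hker _ (by rw [map_sub, e, sub_self])
  -- A linear section of `π` is enough to define `Y`; by `hker` its choice is immaterial.
  obtain ⟨σ, hσ⟩ := LinearMap.exists_rightInverse_of_surjective π.toLinearMap
    (LinearMap.range_eq_top.2 hπ)
  have hσ' : ∀ c, π (σ c) = c := fun c => LinearMap.congr_fun hσ c
  let Y : C ⊗[Kq] B →ₗ[Kq] B ⊗[Kq] C := TensorProduct.lift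
    ((LinearMap.lcomp Kq _ ((TensorProduct.mk Kq B C).flip 1)) ∘ₗ N.toLinearMap ∘ₗ σ)
  have hY : ∀ c b, Y (c ⊗ₜ b) = N (σ c) (b ⊗ₜ 1) := fun c b => rfl
  have hYP : ∀ P b, Y (π P ⊗ₜ b) = N P (b ⊗ₜ 1) := fun P b => by
    rw [hY, hker' (σ (π P)) P (hσ' _)]
  have hNl : ∀ P o, N P o = lAct Y (π P) o := by
    intro P o
    induction o with
    | zero => simp
    | tmul b c => rw [lAct_tmul, hYP, ← hNr, rmul_tmul, one_mul]
    | add a b ha hb => simp only [map_add, ha, hb]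
  refine ⟨Y, ⟨fun b => ?_, fun c => ?_, fun c b b' => ?_, fun c c' b => ?_⟩, fun k x b => ?_,
    fun c l y => ?_⟩
  · have e := hYP 1 b
    rwa [map_one, map_one] at e
  · rw [hY, hN1, hσ', mul_one]
  · obtain ⟨R, h1, h2, h3⟩ := hR b'
    have hRr : ∀ o, R o = rAct Y b' o := by
      intro o
      induction o with
      | zero => simp
      | tmul x y =>
        have e : x ⊗ₜ[Kq] y = lmul x (N (σ y) (1 ⊗ₜ 1)) := by
          rw [hN1, hσ', lmul_tmul, mul_one, mul_one]
        rw [rAct_tmul, hY, e, h2, ← h1, h3, one_mul]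
      | add a b ha hb => simp only [map_add, ha, hb]
    rw [hY, hY, ← h3, h1, hRr]
  · obtain ⟨P, rfl⟩ := hπ c
    obtain ⟨Q, rfl⟩ := hπ c'
    rw [← map_mul, hYP, hYP, map_mul, Module.End.mul_apply, hNl]
  · rw [← hπι (k, x), hYP, hNι, rowOp_tmul]
    simp
  · have e : z l y ⊗ₜ[Kq] (1 : C) = colOp (M' l) (z l) y (1 ⊗ₜ 1) := by
      rw [colOp_tmul, map_one, Finset.sum_eq_single y]
      · simp
      · intro x _ hx
        simp [Matrix.one_apply_ne hx]
      · simp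
    rw [hY, e, hcomm _ fun k x o => rowOp_colOp _ _ _ _ (h k · l ·) x y o, hN1, hσ', colOp_tmul]
    simp

/-- Only the unit and the product rule in the first argument are assumed. This matters for the
uniqueness of Ω, where the rule in the second argument is not available in this form at the outset.
-/
theorem tmul_gen_of_mul_tmul {Y : C ⊗[Kq] B →ₗ[Kq] B ⊗[Kq] C} (h1 : ∀ b, Y (1 ⊗ₜ b) = b ⊗ₜ 1)
    (hm : ∀ c c' b, Y ((c * c') ⊗ₜ b) = lAct Y c (Y (c' ⊗ₜ b)))
    (w : K → C) (z : Z → B) (M' : C →ₐ[Kq] Matrix Z Z C)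
    (hw : Algebra.adjoin Kq (Set.range w) = ⊤)
    (h : ∀ k y, Y (w k ⊗ₜ z y) = ∑ y', z y' ⊗ₜ[Kq] M' (w k) y' y) (c : C) (y : Z) :
    Y (c ⊗ₜ z y) = ∑ y', z y' ⊗ₜ[Kq] M' c y' y := by
  have hc : c ∈ Algebra.adjoin Kq (Set.range w) := by
    rw [hw]
    trivial
  induction hc using Algebra.adjoin_induction generalizing y with
  | mem c hc =>
    obtain ⟨k, rfl⟩ := hc
    exact h k y
  | algebraMap k =>
    simp only [Algebra.algebraMap_eq_smul_one, ← TensorProduct.smul_tmul', map_smul, h1,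
      Matrix.smul_apply, TensorProduct.tmul_smul, map_one, ← Finset.smul_sum]
    rw [Finset.sum_eq_single y]
    · simp
    · intro x _ hx
      simp [Matrix.one_apply_ne hx]
    · simp
  | add c c' _ _ ih ih' =>
    simp only [TensorProduct.add_tmul, map_add, ih, ih', Matrix.add_apply, TensorProduct.tmul_add,
      Finset.sum_add_distrib]
  | mul c c' _ _ ih ih' =>
    rw [hm, ih']
    simp only [map_sum, lAct_tmul, ih, map_mul, Matrix.mul_apply, TensorProduct.tmul_sum, rmul_tmul]
    exact Finset.sum_comm

/-- A twist is determined by its values on pairs of generators. -/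
theorem eq_of_twist_gen {Y Y' : C ⊗[Kq] B →ₗ[Kq] B ⊗[Kq] C} (hY : IsTwist Y) (hY' : IsTwist Y')
    (w : K → C) (z : L → Z → B) (M' : L → C →ₐ[Kq] Matrix Z Z C)
    (hw : Algebra.adjoin Kq (Set.range w) = ⊤)
    (hz : Algebra.adjoin Kq (Set.range fun p : L × Z => z p.1 p.2) = ⊤)
    (h : ∀ k l y, Y (w k ⊗ₜ z l y) = ∑ y', z l y' ⊗ₜ[Kq] M' l (w k) y' y)
    (h' : ∀ k l y, Y' (w k ⊗ₜ z l y) = ∑ y', z l y' ⊗ₜ[Kq] M' l (w k) y' y) : Y = Y' := by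
  ext c b
  change Y (c ⊗ₜ b) = Y' (c ⊗ₜ b)
  have hb : b ∈ Algebra.adjoin Kq (Set.range fun p : L × Z => z p.1 p.2) := by
    rw [hz]
    trivial
  induction hb using Algebra.adjoin_induction generalizing c with
  | mem b hb =>
    obtain ⟨⟨l, y⟩, rfl⟩ := hb
    rw [tmul_gen_of_mul_tmul hY.one_tmul hY.mul_tmul w (z l) (M' l) hw (fun k y => h k l y),
      tmul_gen_of_mul_tmul hY'.one_tmul hY'.mul_tmul w (z l) (M' l) hw (fun k y => h' k l y)]
  | algebraMap k =>
    simp only [Algebra.algebraMap_eq_smul_one, TensorProduct.tmul_smul, map_smul, hY.tmul_one,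
      hY'.tmul_one]
  | add b b' _ _ ih ih' => simp only [TensorProduct.tmul_add, map_add, ih, ih']
  | mul b b' _ _ ih ih' =>
    rw [hY.tmul_mul, hY'.tmul_mul, ih]
    induction Y' (c ⊗ₜ b) with
    | zero => simp
    | tmul x y => rw [rAct_tmul, rAct_tmul, ih']
    | add o o' ho ho' => simp only [map_add, ho, ho']

end matrices

/-! ### The sign-twisted flip -/

section sgnSwap

variable {B C : Type} [Ring B] [Algebra Kq B] [Ring C] [Algebra Kq C]

/-- The flip `c ⊗ b ↦ (-1)^{|b||c|} b ⊗ c`, where the parities are given by the involutions `σB` and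
`σC`. -/
def sgnSwap (σB : B →ₐ[Kq] B) (σC : C →ₐ[Kq] C) : C ⊗[Kq] B →ₗ[Kq] B ⊗[Kq] C :=
  (TensorProduct.comm Kq C B).toLinearMap ∘ₗ
    (TensorProduct.map LinearMap.id ((2 : Kq)⁻¹ • (LinearMap.id + σB.toLinearMap)) +
      TensorProduct.map σC.toLinearMap ((2 : Kq)⁻¹ • (LinearMap.id - σB.toLinearMap)))

theorem half_smul_add_self {E : Type} [AddCommGroup E] [Module Kq E] (x : E) :
    (2 : Kq)⁻¹ • (x + x) = x := by
  rw [← two_smul Kq x, smul_smul, inv_mul_cancel₀ two_ne_zero, one_smul]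

theorem half_smul_add_half {E : Type} [AddCommGroup E] [Module Kq E] (x : E) :
    (2 : Kq)⁻¹ • x + (2 : Kq)⁻¹ • x = x := by
  rw [← smul_add, half_smul_add_self]

theorem sgnSwap_even {σB : B →ₐ[Kq] B} (σC : C →ₐ[Kq] C) {b : B} (hb : σB b = b) (c : C) :
    sgnSwap σB σC (c ⊗ₜ b) = b ⊗ₜ c := by
  simp [sgnSwap, hb, half_smul_add_half]

theorem sgnSwap_odd {σB : B →ₐ[Kq] B} (σC : C →ₐ[Kq] C) {b : B} (hb : σB b = -b) (c : C) :
    sgnSwap σB σC (c ⊗ₜ b) = b ⊗ₜ σC c := by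
  simp [sgnSwap, hb, half_smul_add_half]

theorem sgnSwap_homog {σB : B →ₐ[Kq] B} {σC : C →ₐ[Kq] C} {b : B} {c : C} {k m : ℕ}
    (hb : σB b = (-1 : Kq) ^ k • b) (hc : σC c = (-1 : Kq) ^ m • c) :
    sgnSwap σB σC (c ⊗ₜ b) = (-1 : Kq) ^ (k * m) • b ⊗ₜ c := by
  rcases Nat.even_or_odd k with hk | hk
  · rw [hk.neg_one_pow, one_smul] at hb
    rw [sgnSwap_even σC hb, (hk.mul_right m).neg_one_pow, one_smul]
  · rw [hk.neg_one_pow, neg_one_smul] at hb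
    rw [sgnSwap_odd σC hb, hc, TensorProduct.tmul_smul, pow_mul, hk.neg_one_pow]

theorem exists_even_add_odd {σ : B →ₐ[Kq] B} (hσ : ∀ b, σ (σ b) = b) (b : B) :
    ∃ b₀ b₁, σ b₀ = b₀ ∧ σ b₁ = -b₁ ∧ b = b₀ + b₁ := by
  refine ⟨(2 : Kq)⁻¹ • (b + σ b), (2 : Kq)⁻¹ • (b - σ b), ?_, ?_, ?_⟩
  · rw [map_smul, map_add, hσ, add_comm]
  · rw [map_smul, map_sub, hσ, ← smul_neg, neg_sub]
  · rw [← smul_add, add_add_sub_cancel, half_smul_add_self]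

theorem isTwist_sgnSwap {σB : B →ₐ[Kq] B} {σC : C →ₐ[Kq] C} (hB : ∀ b, σB (σB b) = b)
    (hC : ∀ c, σC (σC c) = c) : IsTwist (sgnSwap σB σC) where
  one_tmul b := by
    obtain ⟨b₀, b₁, h0, h1, rfl⟩ := exists_even_add_odd hB b
    rw [TensorProduct.tmul_add, map_add, sgnSwap_even σC h0, sgnSwap_odd σC h1, map_one,
      TensorProduct.add_tmul]
  tmul_one c := sgnSwap_even σC (map_one _) c
  tmul_mul c b b' := by
    obtain ⟨b₀, b₁, h0, h1, rfl⟩ := exists_even_add_odd hB b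
    obtain ⟨b₀', b₁', h0', h1', rfl⟩ := exists_even_add_odd hB b'
    have e1 : σB (b₀ * b₀') = b₀ * b₀' := by rw [map_mul, h0, h0']
    have e2 : σB (b₀ * b₁') = -(b₀ * b₁') := by rw [map_mul, h0, h1', mul_neg]
    have e3 : σB (b₁ * b₀') = -(b₁ * b₀') := by rw [map_mul, h1, h0', neg_mul]
    have e4 : σB (b₁ * b₁') = b₁ * b₁' := by rw [map_mul, h1, h1', neg_mul_neg]
    simp only [add_mul, mul_add, TensorProduct.tmul_add, map_add, sgnSwap_even σC e1,
      sgnSwap_odd σC e2, sgnSwap_odd σC e3, sgnSwap_even σC e4, sgnSwap_even σC h0,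
      sgnSwap_odd σC h1, rAct_tmul, sgnSwap_even σC h0', sgnSwap_odd σC h1', lmul_tmul, hC]
    abel
  mul_tmul c c' b := by
    obtain ⟨b₀, b₁, h0, h1, rfl⟩ := exists_even_add_odd hB b
    simp only [TensorProduct.tmul_add, map_add, sgnSwap_even σC h0, sgnSwap_odd σC h1, map_mul,
      lAct_tmul, rmul_tmul]

end sgnSwap

/-! ### Parities -/

theorem A_hom_ext {r n : ℕ} {E : Type} [Ring E] [Algebra Kq E] {F G : A r n →ₐ[Kq] E}
    (h : ∀ i a, F (Tplus r n i a) = G (Tplus r n i a)) : F = G := by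
  apply AlgHom.ext_of_adjoin_eq_top (adjoin_Tplus r n)
  rintro _ ⟨⟨i, a⟩, rfl⟩
  exact h i a

theorem Abar_hom_ext {r n : ℕ} {E : Type} [Ring E] [Algebra Kq E] {F G : Abar r n →ₐ[Kq] E}
    (h : ∀ i a, F (Tminus r n i a) = G (Tminus r n i a)) : F = G := by
  apply AlgHom.ext_of_adjoin_eq_top (adjoin_Tminus r n)
  rintro _ ⟨⟨i, a⟩, rfl⟩
  exact h i a

theorem parityA_t {r n : ℕ} (i : Idx r) (a : Idx n) :
    parityA r n (t r n i a) = (-1 : Kq) ^ (par i + par a) • t r n i a := by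
  have h : parityA r n (t r n i a) = parityFreeA r n (Tfree r n i a) :=
    RingQuot.liftAlgHom_mkAlgHom_apply _ _ _ _
  rw [h, parityFreeA]
  simp [Tfree, t]

theorem parityA_Tplus {r n : ℕ} (i : IdxPos r) (a : Idx n) :
    parityA r n (Tplus r n i a) = (-1 : Kq) ^ par a • Tplus r n i a := by
  rw [Tplus, parityA_t, par_of_pos i.2, zero_add]

theorem parityA_parityA {r n : ℕ} (f : A r n) : parityA r n (parityA r n f) = f := by
  have h : (parityA r n).comp (parityA r n) = AlgHom.id Kq _ := A_hom_ext fun i a => by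
    rw [AlgHom.comp_apply, parityA_Tplus, map_smul, parityA_Tplus, smul_smul, ← pow_add,
      ← two_mul, pow_mul]
    simp
  exact DFunLike.congr_fun h f

/-- It is enough to decompose one argument into even and odd parts, because the parity automorphism
of the other argument supplies the sign. This two-term form is the one used for all computations. -/
theorem superSwap_eq (r n : ℕ) : superSwap r n = sgnSwap (parityA r n) (parityA r n) := by
  ext f g
  obtain ⟨g₀, g₁, h0, h1, rfl⟩ := exists_even_add_odd parityA_parityA g
  obtain ⟨f₀, f₁, h0', h1', rfl⟩ := exists_even_add_odd parityA_parityA f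
  have e1 : ∀ f, parityA r n f = f →
      ((2 : Kq)⁻¹ • (LinearMap.id + (parityA r n).toLinearMap) : A r n →ₗ[Kq] A r n) f = f ∧
      ((2 : Kq)⁻¹ • (LinearMap.id - (parityA r n).toLinearMap) : A r n →ₗ[Kq] A r n) f = 0 := fun f h => by
    simp [h, half_smul_add_half]
  have e2 : ∀ f, parityA r n f = -f →
      ((2 : Kq)⁻¹ • (LinearMap.id + (parityA r n).toLinearMap) : A r n →ₗ[Kq] A r n) f = 0 ∧
      ((2 : Kq)⁻¹ • (LinearMap.id - (parityA r n).toLinearMap) : A r n →ₗ[Kq] A r n) f = f := fun f h => by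
    simp [h, half_smul_add_half]
  simp only [superSwap, TensorProduct.AlgebraTensorModule.curry_apply, LinearMap.restrictScalars_self,
    TensorProduct.curry_apply, LinearMap.comp_apply, LinearMap.add_apply, LinearMap.sub_apply,
    TensorProduct.map_tmul, TensorProduct.tmul_add, TensorProduct.add_tmul, map_add, sgnSwap_even _ h0,
    sgnSwap_odd _ h1, (e1 _ h0').1, (e1 _ h0').2, (e1 _ h0).1, (e1 _ h0).2, (e2 _ h1').1,
    (e2 _ h1').2, (e2 _ h1).1, (e2 _ h1).2, h0', h1', TensorProduct.zero_tmul,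
    TensorProduct.tmul_zero, TensorProduct.tmul_neg]
  simp

theorem isTwist_superSwap (r n : ℕ) : IsTwist (superSwap r n) := by
  rw [superSwap_eq]
  exact isTwist_sgnSwap parityA_parityA parityA_parityA

/-- A diagonal rescaling multiplies both sides by the same factor if it is constant along the
nonzero entries of `H`. With signs of parities it yields the parity automorphism of Ā_{s,n}, and the
sign that is needed in the representation behind Υ. -/
theorem RTT.rescale {I V E : Type} [Fintype V] [Ring E] [Algebra Kq E] {c e : I → I → Kq}
    {H : Matrix (V × V) (V × V) Kq} {T : I → V → E} (hT : RTT c e H T) (ε : V → Kq)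
    (hε : ∀ x y, H x y ≠ 0 → ε x.1 * ε x.2 = ε y.1 * ε y.2) : RTT c e H fun i a => ε a • T i a := by
  intro i j a b
  have h1 : act (fun x : V × V => ε x.1 • T j x.1 * ε x.2 • T i x.2) H (a, b) =
      (ε a * ε b) • act (fun x : V × V => T j x.1 * T i x.2) H (a, b) := by
    simp only [act, Finset.smul_sum, smul_mul_smul_comm, smul_smul]
    refine Finset.sum_congr rfl fun x _ => ?_
    by_cases h : H x (a, b) = 0
    · simp [h]
    · rw [hε _ _ h, mul_comm]
  rw [h1, ← hT i j a b]
  simp only [smul_mul_smul_comm, smul_add, smul_smul, mul_comm]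

theorem par_add_par_of_Hm {n : ℕ} {x y : Idx n × Idx n} (h : Hm n x y ≠ 0) :
    ((par x.1 + par x.2 : ℕ) : ZMod 2) = ((par y.1 + par y.2 : ℕ) : ZMod 2) := by
  obtain ⟨u, p⟩ := x
  obtain ⟨a, b⟩ := y
  by_contra hne
  apply h
  have h1 : ¬ (u, p) = (b, a) := by
    intro e
    obtain ⟨rfl, rfl⟩ := Prod.mk.inj e
    exact hne (by push_cast; rw [add_comm])
  have h2 : ¬ (u, p) = (a, b) := by
    intro e
    obtain ⟨rfl, rfl⟩ := Prod.mk.inj e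
    exact hne rfl
  have h3 : ¬ (u, p) = (-a, -b) := by
    intro e
    obtain ⟨rfl, rfl⟩ := Prod.mk.inj e
    refine hne ?_
    push_cast [par_neg_zmod]
    generalize (par a : ZMod 2) = z
    generalize (par b : ZMod 2) = w
    clear hne
    decide +revert
  simp [Hm_apply, h1, h2, h3]

theorem par_add_par_of_Hinv {n : ℕ} {x y : Idx n × Idx n} (h : Hinv n x y ≠ 0) :
    ((par x.1 + par x.2 : ℕ) : ZMod 2) = ((par y.1 + par y.2 : ℕ) : ZMod 2) := by
  by_cases h' : Hm n x y = 0
  · by_cases e : x = y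
    · rw [e]
    · simp [Hinv_eq, h', Matrix.one_apply_ne e] at h
  · exact par_add_par_of_Hm h'

theorem par_add_par_of_Hbar {n : ℕ} {x y : Idx n × Idx n} (h : Hbar n x y ≠ 0) :
    ((par x.1 + par x.2 : ℕ) : ZMod 2) = ((par y.1 + par y.2 : ℕ) : ZMod 2) := by
  have h' : Hm n (y.2, y.1) (x.2, x.1) ≠ 0 := by
    intro e
    simp [Hbar, e] at h
  have := par_add_par_of_Hm h'
  simp only at this
  rw [add_comm (par x.1), add_comm (par y.1), this]

/-- The rows used here are negative, hence the summand 1 in the parity of the generators.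
Compatibility with the relations holds because `Hbar` preserves the total parity. -/
theorem exists_parityAbar (s n : ℕ) : ∃ F : Abar s n →ₐ[Kq] Abar s n,
    ∀ α b, F (Tminus s n α b) = (-1 : Kq) ^ (1 + par b) • Tminus s n α b :=
  exists_hom_Abar _ ((rtt_Tminus s n).rescale (fun b => (-1 : Kq) ^ (1 + par b)) fun x y h => by
    have h' := par_add_par_of_Hbar h
    simp only [← pow_add]
    apply sign_congr_zmod
    push_cast at h' ⊢
    rw [add_add_add_comm, h', add_add_add_comm])

/-- The parity automorphism of `Ā_{s,n}`. -/
def parityAbar (s n : ℕ) : Abar s n →ₐ[Kq] Abar s n := (exists_parityAbar s n).choose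

theorem parityAbar_Tminus {s n : ℕ} (α : IdxPos s) (b : Idx n) :
    parityAbar s n (Tminus s n α b) = (-1 : Kq) ^ (1 + par b) • Tminus s n α b :=
  (exists_parityAbar s n).choose_spec α b

theorem tbar_eq_Tminus {s n : ℕ} (α : Idx s) (b : Idx n) :
    ∃ (β : IdxPos s) (c : Idx n) (k : ℕ), tbar s n α b = (-1 : Kq) ^ k • Tminus s n β c ∧
      ((1 + par c : ℕ) : ZMod 2) = ((par α + par b : ℕ) : ZMod 2) := by
  rcases par_eq α with h | h
  · refine ⟨⟨α, pos_of_par h⟩, -b, par α + par b, tbar_neg α b, ?_⟩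
    rw [h]
    push_cast [par_neg_zmod]
    generalize (par b : ZMod 2) = w
    decide +revert
  · refine ⟨⟨-α, pos_of_par (by rw [par_neg, h])⟩, b, 0, ?_, by rw [h]⟩
    simp only [Tminus, neg_neg_idx, pow_zero, one_smul]

theorem parityAbar_tbar {s n : ℕ} (α : Idx s) (b : Idx n) :
    parityAbar s n (tbar s n α b) = (-1 : Kq) ^ (par α + par b) • tbar s n α b := by
  obtain ⟨β, c, k, h, h'⟩ := tbar_eq_Tminus α b
  rw [h, map_smul, parityAbar_Tminus, sign_congr_zmod h', smul_comm]

theorem parityAbar_parityAbar {s n : ℕ} (f : Abar s n) :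
    parityAbar s n (parityAbar s n f) = f := by
  have h : (parityAbar s n).comp (parityAbar s n) = AlgHom.id Kq _ := Abar_hom_ext fun i a => by
    rw [AlgHom.comp_apply, parityAbar_Tminus, map_smul, parityAbar_Tminus, smul_smul, ← pow_add,
      ← two_mul, pow_mul]
    simp
  exact DFunLike.congr_fun h f

/-! ### Parity preservation of twists -/

section evenness

variable {B C : Type} [Ring B] [Algebra Kq B] [Ring C] [Algebra Kq C]

theorem mulLeft_onRight_tmul (Y : C ⊗[Kq] B →ₗ[Kq] B ⊗[Kq] C) (z : B ⊗[Kq] C) (b : B) :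
    mulLeft C B (onRight Y (z ⊗ₜ b)) = rAct Y b z := by
  induction z with
  | zero => simp
  | tmul a d => rfl
  | add a d ha hd => simp only [map_add, TensorProduct.add_tmul, ha, hd]

theorem map_lmul (σB : B →ₐ[Kq] B) (σC : C →ₐ[Kq] C) (x : B) (z : B ⊗[Kq] C) :
    TensorProduct.map σB.toLinearMap σC.toLinearMap (lmul x z) =
      lmul (σB x) (TensorProduct.map σB.toLinearMap σC.toLinearMap z) := by
  induction z with
  | zero => simp
  | tmul a d => simp
  | add a d ha hd => simp only [map_add, ha, hd]

theorem map_rmul (σB : B →ₐ[Kq] B) (σC : C →ₐ[Kq] C) (y : C) (z : B ⊗[Kq] C) :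
    TensorProduct.map σB.toLinearMap σC.toLinearMap (rmul y z) =
      rmul (σC y) (TensorProduct.map σB.toLinearMap σC.toLinearMap z) := by
  induction z with
  | zero => simp
  | tmul a d => simp
  | add a d ha hd => simp only [map_add, ha, hd]

/-- Since twists are determined by their values at generators, a twist commutes with the parity
automorphisms as soon as it does so there: compare it with its conjugate. -/
theorem IsTwist.conj {Y : C ⊗[Kq] B →ₗ[Kq] B ⊗[Kq] C} (hY : IsTwist Y) {σB : B →ₐ[Kq] B}
    {σC : C →ₐ[Kq] C} (hB : ∀ b, σB (σB b) = b) (hC : ∀ c, σC (σC c) = c) :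
    IsTwist (TensorProduct.map σB.toLinearMap σC.toLinearMap ∘ₗ Y ∘ₗ
      TensorProduct.map σC.toLinearMap σB.toLinearMap) where
  one_tmul b := by simp [hY.one_tmul, hB]
  tmul_one c := by simp [hY.tmul_one, hC]
  tmul_mul c b b' := by
    simp only [LinearMap.comp_apply, TensorProduct.map_tmul, AlgHom.toLinearMap_apply, map_mul,
      hY.tmul_mul]
    induction Y (σC c ⊗ₜ[Kq] σB b) with
    | zero => simp
    | tmul x y =>
      rw [rAct_tmul, map_lmul, TensorProduct.map_tmul, rAct_tmul]
      simp [hC]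
    | add x y hx hy => simp only [map_add, hx, hy]
  mul_tmul c c' b := by
    simp only [LinearMap.comp_apply, TensorProduct.map_tmul, AlgHom.toLinearMap_apply, map_mul,
      hY.mul_tmul]
    induction Y (σC c' ⊗ₜ[Kq] σB b) with
    | zero => simp
    | tmul x y =>
      rw [lAct_tmul, map_rmul, TensorProduct.map_tmul, lAct_tmul]
      simp [hB]
    | add x y hx hy => simp only [map_add, hx, hy]

theorem sgnSwap_even_left {σB : B →ₐ[Kq] B} (hB : ∀ b, σB (σB b) = b) {σC : C →ₐ[Kq] C} {c : C}
    (hc : σC c = c) (b : B) : sgnSwap σB σC (c ⊗ₜ b) = b ⊗ₜ c := by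
  obtain ⟨b₀, b₁, h0, h1, rfl⟩ := exists_even_add_odd hB b
  rw [TensorProduct.tmul_add, map_add, sgnSwap_even σC h0, sgnSwap_odd σC h1, hc,
    TensorProduct.add_tmul]

theorem sgnSwap_odd_left {σB : B →ₐ[Kq] B} (hB : ∀ b, σB (σB b) = b) {σC : C →ₐ[Kq] C} {c : C}
    (hc : σC c = -c) (b : B) : sgnSwap σB σC (c ⊗ₜ b) = σB b ⊗ₜ c := by
  obtain ⟨b₀, b₁, h0, h1, rfl⟩ := exists_even_add_odd hB b
  rw [TensorProduct.tmul_add, map_add, sgnSwap_even σC h0, sgnSwap_odd σC h1, hc, map_add, h0, h1,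
    TensorProduct.add_tmul, TensorProduct.tmul_neg, TensorProduct.neg_tmul]

theorem sgnSwap_sgnSwap {σB : B →ₐ[Kq] B} (hB : ∀ b, σB (σB b) = b) {σC : C →ₐ[Kq] C}
    (hC : ∀ c, σC (σC c) = c) (z : C ⊗[Kq] B) : sgnSwap σC σB (sgnSwap σB σC z) = z := by
  induction z with
  | zero => simp
  | tmul c b =>
    obtain ⟨b₀, b₁, h0, h1, rfl⟩ := exists_even_add_odd hB b
    rw [TensorProduct.tmul_add, map_add, sgnSwap_even σC h0, sgnSwap_odd σC h1, map_add,
      sgnSwap_even_left hC h0, sgnSwap_odd_left hC h1, hC]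
  | add a d ha hd => simp only [map_add, ha, hd]

end evenness

theorem superMul_leg12_bilin {ι κ ι' κ' M N P : Type} [Fintype ι'] [Fintype κ] [DecidableEq ι']
    [DecidableEq κ] [SuperIndex ι] [SuperIndex κ] [SuperIndex ι'] [SuperIndex κ']
    [AddCommMonoid M] [Module Kq M] [AddCommMonoid N] [Module Kq N]
    [AddCommMonoid P] [Module Kq P]
    (m : M →ₗ[Kq] N →ₗ[Kq] P) (X : ι → κ → M) (Z : ι' → κ' → N) (i : ι) (a : κ) (j : ι') (b : κ') :
    superMul m (leg1 ι' X) (leg2 κ Z) i a j b =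
      (-1 : Kq) ^ ((par i + par a) * (par j + par b)) • m (X i a) (Z j b) := by
  rw [superMul, Finset.sum_eq_single a, Finset.sum_eq_single j]
  · simp only [leg1, leg2, if_true]
    congr 1
    apply sign_congr_zmod
    push_cast
    generalize ((par i : ℕ) : ZMod 2) = x
    generalize ((par j : ℕ) : ZMod 2) = y
    generalize ((par a : ℕ) : ZMod 2) = z
    generalize ((par b : ℕ) : ZMod 2) = w
    decide +revert
  · intro u _ hu
    simp [leg1, Ne.symm hu]
  · simp
  · intro p _ hp
    simp [leg2, hp]
  · simp

theorem mulScalar_Smat_of_par_eq_zero {n : ℕ} {ι ι' M : Type} [SuperIndex ι] [SuperIndex ι']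
    [AddCommGroup M] [Module Kq M] (Y : SuperMat ι (Idx n) ι' (Idx n) M) (i : ι) (a : Idx n) (j : ι')
    (b : Idx n) (hj : par j = 0) : mulScalar Y (Smat n) i a j b =
      (-1 : Kq) ^ (par a * par b) • act (fun x => Y i x.2 j x.1) (Hm n) (a, b) := by
  simp only [mulScalar_Smat, hj, act_Hm, smul_add, smul_smul, zero_add, mul_ite, mul_zero,
    ← mul_assoc, ← pow_add]
  congr 1
  · congr 1
    · congr 1
      rw [sign_congr_zmod (b := 0), pow_zero, one_mul]
      push_cast
      rw [CharTwo.add_self_eq_zero]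
    · congr 1
      split_ifs
      · rw [mul_comm]
        congr 1
        apply sign_congr_zmod
        push_cast
        generalize (par a : ZMod 2) = z
        generalize (par b : ZMod 2) = w
        decide +revert
      · rfl
  · congr 1
    split_ifs
    · rw [mul_comm _ xi, mul_assoc, ← pow_add]
      congr 1
      apply sign_congr_zmod
      push_cast
      generalize (par a : ZMod 2) = z
      generalize (par b : ZMod 2) = w
      decide +revert
    · rfl

/-! ### The operator `Ω` -/

section omega

variable {r s : ℕ}

theorem act_tmul_eq_sum_left {ι V E F : Type} [Fintype V] [AddCommGroup E] [Module Kq E]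
    [AddCommGroup F] [Module Kq F] (H : Matrix (V × V) ι Kq) (T : V → E) (T' : V → F) (y : ι) :
    act (fun x : V × V => T x.1 ⊗ₜ[Kq] T' x.2) H y = ∑ u, T u ⊗ₜ ∑ p, H (u, p) y • T' p := by
  simp only [act, Fintype.sum_prod_type, TensorProduct.tmul_sum, TensorProduct.tmul_smul]

theorem act_tmul_eq_sum_right {ι V E F : Type} [Fintype V] [AddCommGroup E] [Module Kq E]
    [AddCommGroup F] [Module Kq F] (H : Matrix (V × V) ι Kq) (T : V → E) (T' : V → F) (y : ι) :
    act (fun x : V × V => T x.1 ⊗ₜ[Kq] T' x.2) H y = ∑ p, (∑ u, H (u, p) y • T u) ⊗ₜ T' p := by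
  simp only [act, Fintype.sum_prod_type, TensorProduct.sum_tmul, TensorProduct.smul_tmul']
  exact Finset.sum_comm

theorem exists_hom_matL (r s : ℕ) : ∃ F : A r s →ₐ[Kq] Matrix (Idx s) (Idx s) (A r s),
    ∀ i a, F (Tplus r s i a) = matL (Hm s) (Tplus r s) i a :=
  exists_hom_A _ ((rtt_Tplus r s).matL (by rw [braid_Hm, ← mul_assoc, ← braid_Hm]))

theorem exists_hom_matR (r s : ℕ) : ∃ F : A r s →ₐ[Kq] Matrix (Idx s) (Idx s) (A r s),
    ∀ i a, F (Tplus r s i a) = matR (Hm s) (Tplus r s) i a :=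
  exists_hom_A _ ((rtt_Tplus r s).matR (by rw [← braid_Hm, ← mul_assoc, braid_Hm]))

/-- The twist `Ψ` of `A_{r,s}` with itself: the operator `Ω` followed by the super permutation. -/
theorem exists_braidA (r s : ℕ) : ∃ Y : A r s ⊗[Kq] A r s →ₗ[Kq] A r s ⊗[Kq] A r s,
    IsTwist Y ∧ ∃ M M' : A r s →ₐ[Kq] Matrix (Idx s) (Idx s) (A r s),
      (∀ i a, M (Tplus r s i a) = matR (Hm s) (Tplus r s) i a) ∧
      (∀ i a, M' (Tplus r s i a) = matL (Hm s) (Tplus r s) i a) ∧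
      (∀ i a b, Y (Tplus r s i a ⊗ₜ b) = ∑ a', M b a a' ⊗ₜ Tplus r s i a') ∧
      (∀ c j b, Y (c ⊗ₜ Tplus r s j b) = ∑ b', Tplus r s j b' ⊗ₜ M' c b' b) := by
  obtain ⟨M, hM⟩ := exists_hom_matR r s
  obtain ⟨M', hM'⟩ := exists_hom_matL r s
  obtain ⟨Y, hY, h1, h2⟩ := exists_isTwist (Tplus r s) (Tplus r s) (fun _ => M) (fun _ => M')
    (adjoin_Tplus r s) (adjoin_Tplus r s) (fun i a j b => by
      simp only [hM, hM', matR, matL]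
      -- Both sides are the row vector T_j ⊗ T_i times `Hm`, grouped by one or by the other tensor
      -- factor.
      rw [← act_tmul_eq_sum_left, ← act_tmul_eq_sum_right])
  exact ⟨Y, hY, M, M', hM, hM', h1, h2⟩

/-- The twist `Ψ` of `A_{r,s}` with itself. -/
def braidA (r s : ℕ) : A r s ⊗[Kq] A r s →ₗ[Kq] A r s ⊗[Kq] A r s := (exists_braidA r s).choose

theorem isTwist_braidA (r s : ℕ) : IsTwist (braidA r s) := (exists_braidA r s).choose_spec.1

/-- The coefficients of `Ψ` at the generators on the left. -/
def coefR (r s : ℕ) : A r s →ₐ[Kq] Matrix (Idx s) (Idx s) (A r s) :=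
  (exists_braidA r s).choose_spec.2.choose

/-- The coefficients of `Ψ` at the generators on the right. -/
def coefL (r s : ℕ) : A r s →ₐ[Kq] Matrix (Idx s) (Idx s) (A r s) :=
  (exists_braidA r s).choose_spec.2.choose_spec.choose

theorem coefR_Tplus (i : IdxPos r) (a : Idx s) :
    coefR r s (Tplus r s i a) = matR (Hm s) (Tplus r s) i a :=
  (exists_braidA r s).choose_spec.2.choose_spec.choose_spec.1 i a

theorem coefL_Tplus (i : IdxPos r) (a : Idx s) :
    coefL r s (Tplus r s i a) = matL (Hm s) (Tplus r s) i a :=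
  (exists_braidA r s).choose_spec.2.choose_spec.choose_spec.2.1 i a

theorem braidA_Tplus_tmul (i : IdxPos r) (a : Idx s) (b : A r s) :
    braidA r s (Tplus r s i a ⊗ₜ b) = ∑ a', coefR r s b a a' ⊗ₜ Tplus r s i a' :=
  (exists_braidA r s).choose_spec.2.choose_spec.choose_spec.2.2.1 i a b

theorem braidA_tmul_Tplus (c : A r s) (j : IdxPos r) (b : Idx s) :
    braidA r s (c ⊗ₜ Tplus r s j b) = ∑ b', Tplus r s j b' ⊗ₜ coefL r s c b' b :=
  (exists_braidA r s).choose_spec.2.choose_spec.choose_spec.2.2.2 c j b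

theorem braidA_Tplus_Tplus (i j : IdxPos r) (a b : Idx s) :
    braidA r s (Tplus r s i a ⊗ₜ Tplus r s j b) =
      act (fun x => Tplus r s j x.1 ⊗ₜ Tplus r s i x.2) (Hm s) (a, b) := by
  rw [braidA_tmul_Tplus, coefL_Tplus, act_tmul_eq_sum_left]
  rfl

/-- `Ψ` preserves parities. -/
theorem braidA_parity (z : A r s ⊗[Kq] A r s) :
    braidA r s (TensorProduct.map (parityA r s).toLinearMap (parityA r s).toLinearMap z) =
      TensorProduct.map (parityA r s).toLinearMap (parityA r s).toLinearMap (braidA r s z) := by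
  -- The conjugate of Ψ by the parities has the same values at generators, because nonzero entries
  -- of `Hm` preserve the total parity.
  have h : TensorProduct.map (parityA r s).toLinearMap (parityA r s).toLinearMap ∘ₗ braidA r s ∘ₗ
      TensorProduct.map (parityA r s).toLinearMap (parityA r s).toLinearMap = braidA r s := by
    refine eq_of_twist_gen ((isTwist_braidA r s).conj parityA_parityA parityA_parityA)
      (isTwist_braidA r s) (fun x : IdxPos r × Idx s => Tplus r s x.1 x.2) (Tplus r s)
      (fun _ => coefL r s) (adjoin_Tplus r s) (adjoin_Tplus r s) (fun x j b => ?_)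
      (fun x j b => braidA_tmul_Tplus _ j b)
    rw [← braidA_tmul_Tplus, braidA_Tplus_Tplus]
    simp only [LinearMap.comp_apply, TensorProduct.map_tmul, AlgHom.toLinearMap_apply, parityA_Tplus,
      TensorProduct.smul_tmul_smul, map_smul, braidA_Tplus_Tplus, map_act]
    simp only [act, Finset.smul_sum, smul_smul]
    refine Finset.sum_congr rfl fun y _ => ?_
    by_cases h : Hm s y (x.2, b) = 0
    · simp [h]
    · congr 1
      have e : (-1 : Kq) ^ par y.1 * (-1) ^ par y.2 = (-1) ^ par x.2 * (-1) ^ par b := by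
        rw [← pow_add, ← pow_add]
        exact sign_congr_zmod (par_add_par_of_Hm h)
      have e2 : ((-1 : Kq) ^ par x.2 * (-1) ^ par b) * ((-1 : Kq) ^ par x.2 * (-1) ^ par b) = 1 := by
        rw [← pow_add, ← pow_add, ← two_mul, pow_mul]
        simp
      rw [e]
      linear_combination Hm s y (x.2, b) * e2
  have h2 := LinearMap.congr_fun h
    (TensorProduct.map (parityA r s).toLinearMap (parityA r s).toLinearMap z)
  have h3 : ∀ z, TensorProduct.map (parityA r s).toLinearMap (parityA r s).toLinearMap
      (TensorProduct.map (parityA r s).toLinearMap (parityA r s).toLinearMap z) = z := by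
    intro z
    induction z with
    | zero => simp
    | tmul a d => simp [parityA_parityA]
    | add a d ha hd => simp only [map_add, ha, hd]
  rw [← h2]
  simp only [LinearMap.comp_apply, h3]

theorem superSwap_superSwap (z : A r s ⊗[Kq] A r s) :
    superSwap r s (superSwap r s z) = z := by
  rw [superSwap_eq]
  exact sgnSwap_sgnSwap parityA_parityA parityA_parityA z

theorem superSwap_Tplus (i j : IdxPos r) (a b : Idx s) :
    superSwap r s (Tplus r s i a ⊗ₜ Tplus r s j b) =
      (-1 : Kq) ^ (par a * par b) • Tplus r s j b ⊗ₜ Tplus r s i a := by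
  rw [superSwap_eq, sgnSwap_homog (parityA_Tplus j b) (parityA_Tplus i a), mul_comm]

theorem superSwap_rmul (y : A r s) (z : A r s ⊗[Kq] A r s) :
    superSwap r s (rmul y z) = rAct (superSwap r s) y (superSwap r s z) := by
  induction z with
  | zero => simp
  | tmul a b => exact (isTwist_superSwap r s).tmul_mul a b y
  | add a b ha hb => simp only [map_add, ha, hb]

theorem superSwap_lmul (x : A r s) (z : A r s ⊗[Kq] A r s) :
    superSwap r s (lmul x z) = lAct (superSwap r s) x (superSwap r s z) := by
  induction z with
  | zero => simp
  | tmul a b => exact (isTwist_superSwap r s).mul_tmul x a b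
  | add a b ha hb => simp only [map_add, ha, hb]

theorem superSwap_parity (z : A r s ⊗[Kq] A r s) :
    superSwap r s (TensorProduct.map (parityA r s).toLinearMap (parityA r s).toLinearMap z) =
      TensorProduct.map (parityA r s).toLinearMap (parityA r s).toLinearMap (superSwap r s z) := by
  induction z with
  | zero => simp
  | tmul a b =>
    obtain ⟨a₀, a₁, h0, h1, rfl⟩ := exists_even_add_odd parityA_parityA a
    have e : parityA r s (-a₁) = - -a₁ := by rw [map_neg, h1]
    simp only [superSwap_eq, TensorProduct.add_tmul, map_add, TensorProduct.map_tmul,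
      AlgHom.toLinearMap_apply, h0, h1, sgnSwap_even_left parityA_parityA h0,
      sgnSwap_odd_left parityA_parityA h1, sgnSwap_odd_left parityA_parityA e]
  | add a b ha hb => simp only [map_add, ha, hb]

/-- It translates the first multiplication axiom of Ω into the product rule of a twist for the
composite of Ω with the super permutation. The two permutations of the middle factor cancel whether
or not Ω preserves parity. -/
theorem onOuter_mul_left (Ω : A r s ⊗[Kq] A r s →ₗ[Kq] A r s ⊗[Kq] A r s) (f : A r s)
    (z : A r s ⊗[Kq] A r s) :
    mulLeft (A r s) (A r s) (onOuter Ω ((TensorProduct.assoc Kq _ _ _).symm (f ⊗ₜ superSwap r s z))) =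
      superSwap r s (lAct (superSwap r s ∘ₗ Ω) f z) := by
  have h : onRight (superSwap r s) ((TensorProduct.assoc Kq _ _ _).symm (f ⊗ₜ superSwap r s z)) =
      (TensorProduct.assoc Kq _ _ _).symm (f ⊗ₜ z) := by
    simp [onRight, superSwap_superSwap]
  rw [onOuter, LinearMap.comp_apply, LinearMap.comp_apply, h]
  clear h
  induction z with
  | zero => simp
  | tmul x y =>
    rw [lAct_tmul, TensorProduct.assoc_symm_tmul]
    change mulLeft _ _ (onRight (superSwap r s) (Ω (f ⊗ₜ x) ⊗ₜ y)) = _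
    rw [mulLeft_onRight_tmul, LinearMap.comp_apply, superSwap_rmul, superSwap_superSwap]
  | add a b ha hb => simp only [map_add, TensorProduct.tmul_add, ha, hb]

/-- `Ω^{[1][3]}` at an element with homogeneous middle factor. -/
theorem onOuter_tmul_even (Ω : A r s ⊗[Kq] A r s →ₗ[Kq] A r s ⊗[Kq] A r s) {x : A r s}
    (hx : parityA r s x = x) (y g : A r s) :
    mulRight _ _ (onOuter Ω ((y ⊗ₜ x) ⊗ₜ g)) = lAct (superSwap r s) x (Ω (y ⊗ₜ g)) := by
  have h : onRight (superSwap r s) ((y ⊗ₜ x) ⊗ₜ g) = (y ⊗ₜ g) ⊗ₜ[Kq] x := by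
    simp [onRight, superSwap_eq, sgnSwap_even_left parityA_parityA hx]
  rw [onOuter, LinearMap.comp_apply, LinearMap.comp_apply, h]
  change mulRight _ _ (onRight (superSwap r s) (Ω (y ⊗ₜ g) ⊗ₜ x)) = _
  induction Ω (y ⊗ₜ g) with
  | zero => simp
  | tmul b a =>
    simp [onRight, superSwap_eq, sgnSwap_even _ hx, sgnSwap_even_left parityA_parityA hx, mulRight]
  | add a b ha hb => simp only [map_add, TensorProduct.add_tmul, ha, hb]

/-- An odd middle factor is moved past `g` before Ω is applied and past one output afterwards. Each
move leaves a parity automorphism behind, and the super permutation inside `lAct` contributes a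
further one. -/
theorem onOuter_tmul_odd (Ω : A r s ⊗[Kq] A r s →ₗ[Kq] A r s ⊗[Kq] A r s) {x : A r s}
    (hx : parityA r s x = -x) (y g : A r s) :
    mulRight _ _ (onOuter Ω ((y ⊗ₜ x) ⊗ₜ g)) =
      lAct (superSwap r s) x (TensorProduct.map (parityA r s).toLinearMap (parityA r s).toLinearMap
        (Ω (y ⊗ₜ parityA r s g))) := by
  have h : onRight (superSwap r s) ((y ⊗ₜ x) ⊗ₜ g) = (y ⊗ₜ parityA r s g) ⊗ₜ[Kq] x := by
    simp [onRight, superSwap_eq, sgnSwap_odd_left parityA_parityA hx]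
  rw [onOuter, LinearMap.comp_apply, LinearMap.comp_apply, h]
  change mulRight _ _ (onRight (superSwap r s) (Ω (y ⊗ₜ parityA r s g) ⊗ₜ x)) = _
  induction Ω (y ⊗ₜ parityA r s g) with
  | zero => simp
  | tmul b a =>
    simp [onRight, superSwap_eq, sgnSwap_odd _ hx, sgnSwap_odd_left parityA_parityA hx, mulRight,
      parityA_parityA]
  | add a b ha hb => simp only [map_add, TensorProduct.add_tmul, ha, hb]

/-- The counterpart of `onOuter_mul_left` for the second axiom. Here the parity automorphisms from
before and after Ω cancel only because Ω commutes with them. -/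
theorem onOuter_mul_right {Ω : A r s ⊗[Kq] A r s →ₗ[Kq] A r s ⊗[Kq] A r s}
    (hΩ : ∀ z, Ω (TensorProduct.map (parityA r s).toLinearMap (parityA r s).toLinearMap z) =
      TensorProduct.map (parityA r s).toLinearMap (parityA r s).toLinearMap (Ω z))
    (g : A r s) (z : A r s ⊗[Kq] A r s) :
    mulRight _ _ (onOuter Ω (superSwap r s z ⊗ₜ g)) =
      superSwap r s (rAct (superSwap r s ∘ₗ Ω) g z) := by
  induction z with
  | zero => simp
  | tmul x y =>
    obtain ⟨x₀, x₁, h0, h1, rfl⟩ := exists_even_add_odd parityA_parityA x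
    have e0 : superSwap r s (x₀ ⊗ₜ y) = y ⊗ₜ x₀ := by
      rw [superSwap_eq, sgnSwap_even_left parityA_parityA h0]
    have e1 : superSwap r s (x₁ ⊗ₜ y) = parityA r s y ⊗ₜ x₁ := by
      rw [superSwap_eq, sgnSwap_odd_left parityA_parityA h1]
    have e2 := hΩ (parityA r s y ⊗ₜ parityA r s g)
    simp only [TensorProduct.map_tmul, AlgHom.toLinearMap_apply, parityA_parityA] at e2
    simp only [TensorProduct.add_tmul, map_add, e0, e1, onOuter_tmul_even Ω h0,
      onOuter_tmul_odd Ω h1, rAct_tmul, superSwap_lmul, LinearMap.comp_apply, superSwap_superSwap,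
      ← e2]
  | add a b ha hb => simp only [map_add, TensorProduct.add_tmul, ha, hb]

/-- In positive rows all remaining signs are (-1)^{|a||b|}, and the super permutation absorbs them.
The condition thus says that Ω followed by the permutation acts on generators by `Hm`, as Ψ does. -/
theorem isOmega_gen_iff (Ω : A r s ⊗[Kq] A r s →ₗ[Kq] A r s ⊗[Kq] A r s) (i j : IdxPos r)
    (a b : Idx s) :
    Ω (superMul (TensorProduct.mk Kq (A r s) (A r s))
        (leg1 (IdxPos r) (Tplus r s)) (leg2 (Idx s) (Tplus r s)) i a j b)
      = mulScalar (superMul (TensorProduct.mk Kq (A r s) (A r s))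
        (leg1 (IdxPos r) (Tplus r s)) (leg2 (Idx s) (Tplus r s))) (Smat s) i a j b ↔
    superSwap r s (Ω (Tplus r s i a ⊗ₜ Tplus r s j b)) =
      braidA r s (Tplus r s i a ⊗ₜ Tplus r s j b) := by
  rw [mulScalar_Smat_of_par_eq_zero _ _ _ _ _ (par_idxPos j)]
  simp only [superMul_leg12_bilin, par_idxPos, zero_add, map_smul]
  rw [(smul_right_injective _ (neg_one_pow_ne_zero (par a * par b))).eq_iff,
    braidA_Tplus_Tplus]
  have h : act (fun x => (-1 : Kq) ^ (par x.2 * par x.1) •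
      TensorProduct.mk Kq (A r s) (A r s) (Tplus r s i x.2) (Tplus r s j x.1)) (Hm s) (a, b) =
      superSwap r s (act (fun x => Tplus r s j x.1 ⊗ₜ Tplus r s i x.2) (Hm s) (a, b)) := by
    rw [map_act]
    congr 1
    funext x
    rw [superSwap_Tplus, mul_comm]
    rfl
  rw [h]
  constructor
  · intro e
    exact (congrArg _ e).trans (superSwap_superSwap _)
  · intro e
    rw [← e, superSwap_superSwap]
    rfl

theorem isOmega_superSwap_braidA (r s : ℕ) : IsOmega r s (superSwap r s ∘ₗ braidA r s) := by
  have hc : superSwap r s ∘ₗ superSwap r s ∘ₗ braidA r s = braidA r s := by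
    ext1
    ext
    simp [superSwap_superSwap]
  refine ⟨fun f => ?_, fun f => ?_, fun i α j β => ?_, ?_, ?_⟩
  · rw [LinearMap.comp_apply, (isTwist_braidA r s).tmul_one, (isTwist_superSwap r s).one_tmul]
  · rw [LinearMap.comp_apply, (isTwist_braidA r s).one_tmul, (isTwist_superSwap r s).tmul_one]
  · rw [isOmega_gen_iff, LinearMap.comp_apply, superSwap_superSwap]
  · apply TensorProduct.ext_threefold
    intro f f' g
    have e := onOuter_mul_left (superSwap r s ∘ₗ braidA r s) f (braidA r s (f' ⊗ₜ g))
    rw [hc] at e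
    refine Eq.trans ?_ e.symm
    change superSwap r s (braidA r s ((f * f') ⊗ₜ g)) = _
    rw [(isTwist_braidA r s).mul_tmul]
  · apply TensorProduct.ext_threefold
    intro f g g'
    have e := onOuter_mul_right (Ω := superSwap r s ∘ₗ braidA r s) (fun z => ?_) g'
      (braidA r s (f ⊗ₜ g))
    · rw [hc] at e
      refine Eq.trans ?_ e.symm
      change superSwap r s (braidA r s (f ⊗ₜ (g * g'))) = _
      rw [(isTwist_braidA r s).tmul_mul]
    · rw [LinearMap.comp_apply, LinearMap.comp_apply, braidA_parity, superSwap_parity]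

/-- Ω is not assumed to preserve parity, so `onOuter_mul_right` cannot be applied to it. The first
axiom, free of such an assumption, fixes Ω on c ⊗ T_{jb}; the second one then extends this to all
second arguments. -/
theorem IsOmega.eq_superSwap_braidA {Ω : A r s ⊗[Kq] A r s →ₗ[Kq] A r s ⊗[Kq] A r s}
    (hΩ : IsOmega r s Ω) : Ω = superSwap r s ∘ₗ braidA r s := by
  have h1 : ∀ c j b, superSwap r s (Ω (c ⊗ₜ Tplus r s j b)) = braidA r s (c ⊗ₜ Tplus r s j b) := by
    intro c j b
    rw [braidA_tmul_Tplus]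
    refine tmul_gen_of_mul_tmul (Y := superSwap r s ∘ₗ Ω) (fun b => ?_) (fun c c' b => ?_)
      (fun x : IdxPos r × Idx s => Tplus r s x.1 x.2) (Tplus r s j)
      (coefL r s) (adjoin_Tplus r s) (fun x b => ?_) c b
    · rw [LinearMap.comp_apply, hΩ.one_tmul, (isTwist_superSwap r s).one_tmul]
    · have e := onOuter_mul_left Ω c (superSwap r s (Ω (c' ⊗ₜ b)))
      rw [superSwap_superSwap] at e
      have e2 := LinearMap.congr_fun hΩ.mul_left ((c ⊗ₜ c') ⊗ₜ b)
      change Ω ((c * c') ⊗ₜ b) = _ at e2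
      rw [LinearMap.comp_apply, e2, LinearMap.comp_apply, ← superSwap_superSwap (lAct _ _ _)]
      exact congrArg _ e
    · rw [LinearMap.comp_apply, ← braidA_tmul_Tplus]
      exact (isOmega_gen_iff Ω x.1 j x.2 b).1 (hΩ.gen _ _ _ _)
  have h0 := isOmega_superSwap_braidA r s
  set Ω₀ := superSwap r s ∘ₗ braidA r s with hdef
  have h2 : ∀ c j b, Ω (c ⊗ₜ Tplus r s j b) = Ω₀ (c ⊗ₜ Tplus r s j b) := fun c j b => by
    rw [hdef, LinearMap.comp_apply, ← h1, superSwap_superSwap]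
  -- An odd middle factor replaces `g` by its image under the parity automorphism, so the induction
  -- has to carry both elements.
  have key : ∀ g ∈ Algebra.adjoin Kq (Set.range fun x : IdxPos r × Idx s => Tplus r s x.1 x.2),
      ∀ c, Ω (c ⊗ₜ g) = Ω₀ (c ⊗ₜ g) ∧ Ω (c ⊗ₜ parityA r s g) = Ω₀ (c ⊗ₜ parityA r s g) := by
    have hmul : ∀ g g', (∀ c, Ω (c ⊗ₜ g) = Ω₀ (c ⊗ₜ g)) →
        (∀ c, Ω (c ⊗ₜ g') = Ω₀ (c ⊗ₜ g') ∧ Ω (c ⊗ₜ parityA r s g') = Ω₀ (c ⊗ₜ parityA r s g')) →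
        ∀ c, Ω (c ⊗ₜ (g * g')) = Ω₀ (c ⊗ₜ (g * g')) := by
      intro g g' h h' c
      have e := LinearMap.congr_fun hΩ.mul_right ((c ⊗ₜ g) ⊗ₜ g')
      have e0 := LinearMap.congr_fun h0.mul_right ((c ⊗ₜ g) ⊗ₜ g')
      refine e.trans (Eq.trans ?_ e0.symm)
      change mulRight _ _ (onOuter Ω (Ω (c ⊗ₜ g) ⊗ₜ g')) =
        mulRight _ _ (onOuter Ω₀ (Ω₀ (c ⊗ₜ g) ⊗ₜ g'))
      rw [h]
      induction Ω₀ (c ⊗ₜ g) with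
      | zero => simp
      | tmul y x =>
        obtain ⟨x₀, x₁, hx0, hx1, rfl⟩ := exists_even_add_odd parityA_parityA x
        simp only [TensorProduct.tmul_add, TensorProduct.add_tmul, map_add,
          onOuter_tmul_even _ hx0, onOuter_tmul_odd _ hx1, (h' _).1, (h' _).2]
      | add a b ha hb => simp only [map_add, TensorProduct.add_tmul, ha, hb]
    intro g hg
    induction hg using Algebra.adjoin_induction with
    | mem g hg =>
      obtain ⟨⟨j, b⟩, rfl⟩ := hg
      intro c
      simp only [parityA_Tplus, TensorProduct.tmul_smul, map_smul, h2, true_and]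
    | algebraMap k =>
      intro c
      simp only [Algebra.algebraMap_eq_smul_one, map_smul, map_one, TensorProduct.tmul_smul,
        hΩ.tmul_one, h0.tmul_one, true_and]
    | add g g' _ _ ih ih' =>
      intro c
      simp only [map_add, TensorProduct.tmul_add, (ih c).1, (ih c).2, (ih' c).1, (ih' c).2, true_and]
    | mul g g' _ _ ih ih' =>
      intro c
      refine ⟨hmul g g' (fun c => (ih c).1) ih' c, ?_⟩
      rw [map_mul]
      exact hmul _ _ (fun c => (ih c).2) (fun c => by
        rw [parityA_parityA]
        exact (ih' c).symm) c
  ext f g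
  exact (key g (by rw [adjoin_Tplus]; trivial) f).1

end omega

/-! ### The braiding `Υ` -/

theorem Hinv_sign {n : ℕ} (a b c d : Idx n) :
    (-1 : Kq) ^ (par c + par d) * Hinv n (a, b) (c, d) =
      (-1) ^ (par a + par b) * Hinv n (a, b) (c, d) := by
  by_cases h : Hinv n (a, b) (c, d) = 0
  · simp [h]
  · rw [sign_congr_zmod (par_add_par_of_Hinv h)]

theorem Hinv_sign' {n : ℕ} (a b c d : Idx n) :
    (-1 : Kq) ^ (par a + par c) * Hinv n (a, b) (c, d) =
      (-1) ^ (par b + par d) * Hinv n (a, b) (c, d) := by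
  by_cases h : Hinv n (a, b) (c, d) = 0
  · simp [h]
  · rw [sign_congr_zmod]
    have h' := par_add_par_of_Hinv h
    clear h
    push_cast at h' ⊢
    generalize (par a : ZMod 2) = x at *
    generalize (par b : ZMod 2) = y at *
    generalize (par c : ZMod 2) = z at *
    generalize (par d : ZMod 2) = w at *
    decide +revert

/-- The inverse braid matrix with its first and last arguments exchanged. -/
def Hdual (n : ℕ) : Matrix (Idx n × Idx n) (Idx n × Idx n) Kq := fun x y =>
  Hinv n (y.1, x.1) (y.2, x.2)

/-- The braid matrix between the generators of `Ā_{s,n}` in the negative rows and those of `A_{r,n}`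
in the positive rows. -/
def Hmix (n : ℕ) : Matrix (Idx n × Idx n) (Idx n × Idx n) Kq := fun x y =>
  (-1) ^ par y.2 * Hdual n x y

/-! ### Products of matrices on three tensor factors, entry by entry -/

theorem tri12_mul_tri23_apply {V : Type} [Fintype V] [DecidableEq V]
    (H K : Matrix (V × V) (V × V) Kq) (a b c d e f : V) :
    (tri12 H * tri23 K) (a, b, c) (d, e, f) = ∑ m, H (a, b) (d, m) * K (m, c) (e, f) := by
  simp only [Matrix.mul_apply, Fintype.sum_prod_type, tri12, tri23]
  rw [Finset.sum_eq_single d]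
  · refine Finset.sum_congr rfl fun m _ => ?_
    rw [Finset.sum_eq_single c]
    · simp
    · intro x _ hx
      simp [Ne.symm hx]
    · simp
  · intro x _ hx
    simp [hx]
  · simp

theorem tri23_mul_tri12_apply {V : Type} [Fintype V] [DecidableEq V]
    (H K : Matrix (V × V) (V × V) Kq) (a b c d e f : V) :
    (tri23 H * tri12 K) (a, b, c) (d, e, f) = ∑ m, H (b, c) (m, f) * K (a, m) (d, e) := by
  simp only [Matrix.mul_apply, Fintype.sum_prod_type, tri12, tri23]
  rw [Finset.sum_eq_single a]
  · refine Finset.sum_congr rfl fun m _ => ?_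
    rw [Finset.sum_eq_single f]
    · simp
    · intro x _ hx
      simp [hx]
    · simp
  · intro x _ hx
    simp [Ne.symm hx]
  · simp

theorem tri23_mul_apply {V : Type} [Fintype V] [DecidableEq V] (H : Matrix (V × V) (V × V) Kq)
    (L : Matrix (V × V × V) (V × V × V) Kq) (a b c : V) (y : V × V × V) :
    (tri23 H * L) (a, b, c) y = ∑ u, ∑ v, H (b, c) (u, v) * L (a, u, v) y := by
  simp only [Matrix.mul_apply, Fintype.sum_prod_type, tri23]
  rw [Finset.sum_eq_single a]
  · simp
  · intro x _ hx
    simp [Ne.symm hx]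
  · simp

theorem tri12_mul_apply {V : Type} [Fintype V] [DecidableEq V] (H : Matrix (V × V) (V × V) Kq)
    (L : Matrix (V × V × V) (V × V × V) Kq) (a b c : V) (y : V × V × V) :
    (tri12 H * L) (a, b, c) y = ∑ u, ∑ v, H (a, b) (u, v) * L (u, v, c) y := by
  simp only [Matrix.mul_apply, Fintype.sum_prod_type, tri12]
  refine Finset.sum_congr rfl fun u _ => Finset.sum_congr rfl fun v _ => ?_
  rw [Finset.sum_eq_single c]
  · simp
  · intro x _ hx
    simp [Ne.symm hx]
  · simp

theorem mul_tri12_apply {V : Type} [Fintype V] [DecidableEq V] (H : Matrix (V × V) (V × V) Kq)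
    (L : Matrix (V × V × V) (V × V × V) Kq) (a b c : V) (y : V × V × V) :
    (L * tri12 H) y (a, b, c) = ∑ u, ∑ v, L y (u, v, c) * H (u, v) (a, b) := by
  simp only [Matrix.mul_apply, Fintype.sum_prod_type, tri12]
  refine Finset.sum_congr rfl fun u _ => Finset.sum_congr rfl fun v _ => ?_
  rw [Finset.sum_eq_single c]
  · simp
  · intro x _ hx
    simp [hx]
  · simp

theorem mul_tri23_apply {V : Type} [Fintype V] [DecidableEq V] (H : Matrix (V × V) (V × V) Kq)
    (L : Matrix (V × V × V) (V × V × V) Kq) (a b c : V) (y : V × V × V) :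
    (L * tri23 H) y (a, b, c) = ∑ u, ∑ v, L y (a, u, v) * H (u, v) (b, c) := by
  simp only [Matrix.mul_apply, Fintype.sum_prod_type, tri23]
  rw [Finset.sum_eq_single a]
  · simp
  · intro x _ hx
    simp [hx]
  · simp

theorem tri12_inv (n : ℕ) : tri12 (Hm n) * tri12 (Hinv n) = 1 := by
  rw [← tri12_mul, Hm_mul_Hinv, tri12_one]

theorem tri23_inv (n : ℕ) : tri23 (Hm n) * tri23 (Hinv n) = 1 := by
  rw [← tri23_mul, Hm_mul_Hinv, tri23_one]

theorem tri12_inv' (n : ℕ) : tri12 (Hinv n) * tri12 (Hm n) = 1 := by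
  rw [← tri12_mul, Hinv_mul_Hm, tri12_one]

theorem tri23_inv' (n : ℕ) : tri23 (Hinv n) * tri23 (Hm n) = 1 := by
  rw [← tri23_mul, Hinv_mul_Hm, tri23_one]

/-- By the braid relation ba conjugates b into a, and a'b' is the inverse of ba. -/
theorem braid_inverse {R : Type} [Ring R] {a b a' b' : R} (h : a * b * a = b * a * b) (ha : a * a' = 1)
    (ha' : a' * a = 1) (hb : b * b' = 1) (hb' : b' * b = 1) : b * (a' * b') = a' * b' * a := by
  calc b * (a' * b') = a' * (b' * b) * (a * b * (a' * b')) := by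
        rw [hb', mul_one, mul_assoc a b, ← mul_assoc a' a, ha', one_mul]
    _ = a' * b' * (b * a * b) * (a' * b') := by simp only [mul_assoc]
    _ = a' * b' * a * (b * (a * a') * b') := by rw [← h]; simp only [mul_assoc]
    _ = a' * b' * a := by rw [ha, mul_one, hb, mul_one]

theorem braid_Hm_Hinv (n : ℕ) : tri23 (Hm n) * (tri12 (Hinv n) * tri23 (Hinv n)) =
    tri12 (Hinv n) * tri23 (Hinv n) * tri12 (Hm n) :=
  braid_inverse (braid_Hm n) (tri12_inv n) (tri12_inv' n) (tri23_inv n) (tri23_inv' n)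

theorem braid_Hm_Hinv' (n : ℕ) : tri12 (Hm n) * (tri23 (Hinv n) * tri12 (Hinv n)) =
    tri23 (Hinv n) * tri12 (Hinv n) * tri23 (Hm n) :=
  braid_inverse (braid_Hm n).symm (tri23_inv n) (tri23_inv' n) (tri12_inv n) (tri12_inv' n)

/-- This is `braid_Hm_Hinv'` after a partial transposition: `Hbar` is `Hm` transposed and flipped,
`Hmix` is `Hinv` with two arguments exchanged, both up to signs. It lets Ā_{s,n} act by matrices
built from `Hmix`. -/
theorem braid_Hbar_Hmix (n : ℕ) : tri23 (Hbar n) * (tri12 (Hmix n) * tri23 (Hmix n)) =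
    tri12 (Hmix n) * tri23 (Hmix n) * tri12 (Hbar n) := by
  ext ⟨x₁, x₂, x₃⟩ ⟨y₁, y₂, y₃⟩
  -- These arguments are read off from the transpositions in `Hbar` and `Hdual`. In `h1` and `h2`
  -- parity preservation collects all signs into one factor that does not depend on the summation
  -- indices.
  have h := congrFun (congrFun (braid_Hm_Hinv' n) (y₂, y₁, x₁)) (y₃, x₃, x₂)
  rw [tri12_mul_apply, mul_tri23_apply] at h
  rw [tri23_mul_apply, mul_tri12_apply]
  simp only [tri12_mul_tri23_apply, tri23_mul_tri12_apply] at h ⊢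
  have h1 : ∀ m v₂ v₃, Hbar n (x₂, x₃) (v₂, v₃) *
      (Hmix n (x₁, v₂) (y₁, m) * Hmix n (m, v₃) (y₂, y₃)) =
      -(-1) ^ (par x₂ + par y₃ + par y₁ + par x₁) *
        (Hinv n (y₁, x₁) (m, v₂) * Hinv n (y₂, m) (y₃, v₃) * Hm n (v₃, v₂) (x₃, x₂)) := by
    intro m v₂ v₃
    have e := Hinv_sign y₁ x₁ m v₂
    simp only [Hbar, Hmix, Hdual]
    simp only [pow_add] at e ⊢
    linear_combination (-(-1) ^ par x₂ * (-1) ^ par y₃ * Hinv n (y₂, m) (y₃, v₃) *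
      Hm n (v₃, v₂) (x₃, x₂)) * e
  have h2 : ∀ m v₁ v₂, (Hmix n (x₁, x₂) (v₁, m) * Hmix n (m, x₃) (v₂, y₃)) *
      Hbar n (v₁, v₂) (y₁, y₂) =
      -(-1) ^ (par x₂ + par y₃ + par y₁ + par x₁) *
        (Hm n (y₂, y₁) (v₂, v₁) * (Hinv n (v₁, x₁) (m, x₂) * Hinv n (v₂, m) (y₃, x₃))) := by
    intro m v₁ v₂
    have e := Hinv_sign' v₁ x₁ m x₂
    simp only [Hbar, Hmix, Hdual]
    simp only [pow_add] at e ⊢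
    linear_combination (-(-1) ^ par y₁ * (-1) ^ par y₃ *
      Hm n (y₂, y₁) (v₂, v₁) * Hinv n (v₂, m) (y₃, x₃)) * e
  simp only [Finset.mul_sum, Finset.sum_mul] at h ⊢
  simp only [h1, h2]
  simp only [← Finset.mul_sum]
  refine congrArg _ (Finset.sum_comm.trans (Eq.trans ?_ Finset.sum_comm))
  simp only [← Finset.mul_sum, ← Finset.sum_mul] at h ⊢
  exact h.symm

/-- The queer symmetry of S⁻¹ with one index negated on each side. It makes the formula for Υ
compatible with the symmetry of the generators t̄. -/
theorem Hinv_neg_left {n : ℕ} (a b c u : Idx n) : Hinv n (-b, u) (a, c) =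
    (-1) ^ (par a + par b + par c + 1) * Hinv n (b, u) (a, -c) := by
  have e1 : (-b, u) = (c, a) ↔ (b, u) = (-c, a) := by simp only [Prod.mk.injEq, neg_eq_iff_idx]
  have e2 : (-b, u) = (a, c) ↔ (b, u) = (-a, - -c) := by
    simp only [Prod.mk.injEq, neg_eq_iff_idx, neg_neg_idx]
  have e3 : (-b, u) = (-a, -c) ↔ (b, u) = (a, -c) := by
    simp only [Prod.mk.injEq, neg_inj_idx]
  simp only [SmatInv_swap, e1, e2, e3, mul_add, mul_sub, phi_neg_left, neg_neg_idx]
  have t1 : (if (b, u) = (-c, a) then (-1 : Kq) ^ (par a * par c) * qv ^ (-phi c a) else 0) =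
      (-1) ^ (par a + par b + par c + 1) *
        (if (b, u) = (-c, a) then (-1) ^ (par a * par (-c)) * qv ^ (-phi c a) else 0) := by
    split_ifs with h
    · obtain ⟨rfl, rfl⟩ := Prod.mk.inj h
      rw [← mul_assoc, ← pow_add]
      congr 1
      apply sign_congr_zmod
      push_cast [par_neg_zmod]
      generalize (par u : ZMod 2) = z
      generalize (par c : ZMod 2) = w
      clear h e1 e2 e3
      decide +revert
    · simp
  have t2 : (if (b, u) = (-a, c) then if c < a then xi else 0 else 0) =
      -((-1) ^ (par a + par b + par c + 1) *
        (if (b, u) = (-a, c) then if c < a then xi * (-1) ^ par (-c) else 0 else 0)) := by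
    split_ifs with h
    · obtain ⟨rfl, rfl⟩ := Prod.mk.inj h
      rw [mul_left_comm, ← pow_add, ← mul_neg, ← neg_one_mul ((-1 : Kq) ^ _), ← pow_succ',
        sign_congr_zmod (b := 0), pow_zero, mul_one]
      push_cast [par_neg_zmod]
      generalize (par a : ZMod 2) = z
      generalize (par u : ZMod 2) = w
      clear h e1 e2 e3
      decide +revert
    all_goals simp
  have t3 : (if (b, u) = (a, -c) then if -c < a then xi * (-1) ^ par c else 0 else 0) =
      -((-1) ^ (par a + par b + par c + 1) *
        (if (b, u) = (a, -c) then if -c < a then xi else 0 else 0)) := by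
    split_ifs with h
    · obtain ⟨rfl, rfl⟩ := Prod.mk.inj h
      rw [mul_comm _ xi, ← mul_neg, ← neg_one_mul ((-1 : Kq) ^ _), ← pow_succ']
      congr 1
      apply sign_congr_zmod
      push_cast
      generalize (par b : ZMod 2) = z
      generalize (par c : ZMod 2) = w
      clear h e1 e2 e3
      decide +revert
    all_goals simp
  rw [t1, t2, t3]
  ring

/-- The sign (-1)^{|a|} is that of exchanging T_{ia} with the odd row index of a generator `Tminus`;
it matches the sign in `Hmix`. -/
theorem rtt_matL_Tplus (r n : ℕ) :
    RTT cA eA (Hm n) fun i a => (-1 : Kq) ^ par a • matL (Hinv n) (Tplus r n) i a :=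
  ((rtt_Tplus r n).matL (braid_Hm_Hinv n)).rescale _ fun x y h => by
    rw [← pow_add, ← pow_add]
    exact sign_congr_zmod (par_add_par_of_Hm h)

/-- The value of `Υ` at the generators. -/
def braidGen (r s n : ℕ) (α : Idx s) (b : Idx n) (i : IdxPos r) (a : Idx n) :
    A r n ⊗[Kq] Abar s n :=
  (-1 : Kq) ^ (par α * par a) •
    act (fun x => Tplus r n i x.1 ⊗ₜ tbar s n α x.2) (Hdual n) (b, a)

/-- The involution `c ↦ -c` of `I_{n|n}`. -/
def negIdx (n : ℕ) : Idx n ≃ Idx n := ⟨fun c => -c, fun c => -c, neg_neg_idx, neg_neg_idx⟩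

/-- Υ is constructed from the negative rows of Ā_{s,n}. This symmetry carries its values at
generators over to the positive rows. -/
theorem braidGen_neg {r s n : ℕ} (α : Idx s) (b : Idx n) (i : IdxPos r) (a : Idx n) :
    braidGen r s n α b i a = (-1 : Kq) ^ (par α + par b) • braidGen r s n (-α) (-b) i a := by
  simp only [braidGen, act, Fintype.sum_prod_type, Hdual, Hinv_neg_left, Finset.smul_sum, smul_smul]
  refine Finset.sum_congr rfl fun u _ => ?_
  refine Fintype.sum_equiv (negIdx n) _ _ fun c => ?_
  simp only [negIdx, Equiv.coe_fn_mk, neg_neg_idx]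
  rw [tbar_neg α c, TensorProduct.tmul_smul, smul_smul]
  congr 1
  rw [← mul_assoc, ← mul_assoc, mul_right_comm, ← pow_add, ← pow_add, ← pow_add]
  congr 1
  apply sign_congr_zmod
  push_cast [par_neg_zmod]
  generalize (par α : ZMod 2) = x
  generalize (par a : ZMod 2) = y
  generalize (par b : ZMod 2) = z
  generalize (par c : ZMod 2) = w
  decide +revert

/-- The identity legs collapse the matrix products to one sum over two indices. Both sides then
carry the same invertible sign, which is cancelled. -/
theorem isBraiding_gen_iff {r s n : ℕ} (Y : Abar s n ⊗[Kq] A r n →ₗ[Kq] A r n ⊗[Kq] Abar s n)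
    (b : Idx n) (α : Idx s) (i : IdxPos r) (a : Idx n) :
    Y (superMul (TensorProduct.mk Kq (Abar s n) (A r n))
        (leg1 (IdxPos r) (Tbar s n)) (leg2 (Idx s) (Tplus r n)) b α i a)
      = superMul (TensorProduct.mk Kq (A r n) (Abar s n))
        (mulScalar (leg2 (Idx n) (Tplus r n)) (SmatInv n)) (leg1 (Idx n) (Tbar s n)) b α i a ↔
    Y (tbar s n α b ⊗ₜ Tplus r n i a) = braidGen r s n α b i a := by
  have h : superMul (TensorProduct.mk Kq (A r n) (Abar s n))
        (mulScalar (leg2 (Idx n) (Tplus r n)) (SmatInv n)) (leg1 (Idx n) (Tbar s n)) b α i a =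
      (-1 : Kq) ^ ((par b + par α) * par a + par b * (par α + par b)) • braidGen r s n α b i a := by
    have h1 : ∀ c, mulScalar (leg2 (Idx n) (Tplus r n)) (SmatInv n) b c i a =
        ∑ u, ((-1 : Kq) ^ (par u * (par b + par c)) * SmatInv n b c u a) • Tplus r n i u := by
      intro c
      rw [mulScalar, superMul, Finset.sum_eq_single b]
      · refine Finset.sum_congr rfl fun u _ => ?_
        simp only [leg2, if_true, LinearMap.flip_apply, LinearMap.lsmul_apply, smul_smul]
        -- The two signs agree only where the total parity is preserved, and that is the case for
        -- every nonzero entry.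
        by_cases hS : Hinv n (b, u) (a, c) = 0
        · have hS' : SmatInv n b c u a = 0 := by
            rw [Hinv] at hS
            exact (mul_eq_zero.1 hS).resolve_left (neg_one_pow_ne_zero _)
          rw [hS', mul_zero, mul_zero]
        · congr 2
          have h' := par_add_par_of_Hinv hS
          clear hS
          apply sign_congr_zmod
          rw [par_idxPos]
          push_cast at h' ⊢
          generalize (par a : ZMod 2) = x at *
          generalize (par b : ZMod 2) = y at *
          generalize (par c : ZMod 2) = z at *
          generalize (par u : ZMod 2) = w at *
          decide +revert
      · intro p _ hp
        simp [leg2, Ne.symm hp]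
      · simp
    rw [superMul, Finset.sum_comm, Finset.sum_eq_single a]
    · simp only [leg1, braidGen, act, Fintype.sum_prod_type, Finset.smul_sum]
      rw [Finset.sum_comm (s := Finset.univ (α := Idx n))]
      refine Finset.sum_congr rfl fun c _ => ?_
      rw [h1 c]
      simp only [if_true, Tbar, map_sum, map_smul, LinearMap.sum_apply, LinearMap.smul_apply,
        Finset.smul_sum, smul_smul]
      refine Finset.sum_congr rfl fun u _ => ?_
      change _ • Tplus r n i u ⊗ₜ[Kq] tbar s n α c = _
      congr 1
      simp only [Hdual, Hinv, ← mul_assoc, ← pow_add]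
      by_cases hS : Hinv n (b, u) (a, c) = 0
      · have hS' : SmatInv n b c u a = 0 := by
          rw [Hinv] at hS
          exact (mul_eq_zero.1 hS).resolve_left (neg_one_pow_ne_zero _)
        rw [hS', mul_zero, mul_zero]
      · congr 1
        have h' := par_add_par_of_Hinv hS
        clear hS
        apply sign_congr_zmod
        rw [par_idxPos]
        push_cast at h' ⊢
        generalize (par a : ZMod 2) = x at *
        generalize (par b : ZMod 2) = y at *
        generalize (par c : ZMod 2) = z at *
        generalize (par u : ZMod 2) = w at *
        generalize (par α : ZMod 2) = v at *
        decide +revert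
    · intro x _ hx
      simp [leg1, hx]
    · simp
  rw [h, superMul_leg12_bilin, map_smul, Tbar, map_smul, LinearMap.smul_apply, map_smul, smul_smul,
    ← pow_add, par_idxPos, zero_add,
    (smul_right_injective _ (neg_one_pow_ne_zero _)).eq_iff]
  rfl

theorem exists_braidAbar (r s n : ℕ) : ∃ Y : Abar s n ⊗[Kq] A r n →ₗ[Kq] A r n ⊗[Kq] Abar s n,
    IsTwist Y ∧ ∃ M' : Abar s n →ₐ[Kq] Matrix (Idx n) (Idx n) (Abar s n),
      (∀ α b, M' (Tminus s n α b) = matL (Hmix n) (Tminus s n) α b) ∧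
      (∀ c j b, Y (c ⊗ₜ Tplus r n j b) = ∑ b', Tplus r n j b' ⊗ₜ M' c b' b) := by
  obtain ⟨M, hM⟩ := exists_hom_A _ (rtt_matL_Tplus r n)
  obtain ⟨M', hM'⟩ := exists_hom_Abar _ ((rtt_Tminus s n).matL (braid_Hbar_Hmix n))
  obtain ⟨Y, hY, h1, h2⟩ := exists_isTwist (Tminus s n) (Tplus r n) (fun _ => M) (fun _ => M')
    (adjoin_Tminus s n) (adjoin_Tplus r n) (fun α b i a => by
      rw [hM, hM']
      have e := act_tmul_eq_sum_right (Hmix n) (Tplus r n i) (Tminus s n α) (b, a)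
      rw [act_tmul_eq_sum_left] at e
      refine Eq.trans ?_ e.symm
      simp only [Matrix.smul_apply, matL, Finset.smul_sum, smul_smul]
      rfl)
  exact ⟨Y, hY, M', hM', h2⟩

/-- The braiding `Υ`. -/
def braidAbar (r s n : ℕ) : Abar s n ⊗[Kq] A r n →ₗ[Kq] A r n ⊗[Kq] Abar s n :=
  (exists_braidAbar r s n).choose

theorem isTwist_braidAbar (r s n : ℕ) : IsTwist (braidAbar r s n) :=
  (exists_braidAbar r s n).choose_spec.1

/-- The coefficients of `Υ` at the generators on the right. -/
def coefBar (r s n : ℕ) : Abar s n →ₐ[Kq] Matrix (Idx n) (Idx n) (Abar s n) :=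
  (exists_braidAbar r s n).choose_spec.2.choose

theorem coefBar_Tminus {r s n : ℕ} (α : IdxPos s) (b : Idx n) :
    coefBar r s n (Tminus s n α b) = matL (Hmix n) (Tminus s n) α b :=
  (exists_braidAbar r s n).choose_spec.2.choose_spec.1 α b

theorem braidAbar_tmul_Tplus {r s n : ℕ} (c : Abar s n) (j : IdxPos r) (b : Idx n) :
    braidAbar r s n (c ⊗ₜ Tplus r n j b) = ∑ b', Tplus r n j b' ⊗ₜ coefBar r s n c b' b :=
  (exists_braidAbar r s n).choose_spec.2.choose_spec.2 c j b

theorem braidGen_Tminus {r s n : ℕ} (α : IdxPos s) (b : Idx n) (i : IdxPos r) (a : Idx n) :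
    braidGen r s n (-α.1) b i a =
      ∑ u, Tplus r n i u ⊗ₜ coefBar r s n (Tminus s n α b) u a := by
  rw [coefBar_Tminus]
  have e := act_tmul_eq_sum_left (Hmix n) (Tplus r n i) (Tminus s n α) (b, a)
  refine Eq.trans ?_ e
  simp only [braidGen, act, Finset.smul_sum, smul_smul, Hmix]
  rw [par_neg, par_of_pos α.2]
  simp only [Nat.sub_zero, one_mul]
  rfl

theorem braidAbar_tbar_Tplus {r s n : ℕ} (α : Idx s) (b : Idx n) (i : IdxPos r) (a : Idx n) :
    braidAbar r s n (tbar s n α b ⊗ₜ Tplus r n i a) = braidGen r s n α b i a := by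
  have h : ∀ (α : IdxPos s) b, braidAbar r s n (tbar s n (-α.1) b ⊗ₜ Tplus r n i a) =
      braidGen r s n (-α.1) b i a := fun α b => by
    rw [braidGen_Tminus, ← braidAbar_tmul_Tplus]
    rfl
  rcases par_eq α with h' | h'
  · rw [tbar_neg, braidGen_neg, ← TensorProduct.smul_tmul', map_smul, h ⟨α, pos_of_par h'⟩]
  · have e := h ⟨-α, pos_of_par (by rw [par_neg, h'])⟩ b
    rwa [neg_neg_idx] at e

theorem isBraiding_braidAbar (r s n : ℕ) : IsBraiding r s n (braidAbar r s n) where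
  one_tmul := (isTwist_braidAbar r s n).one_tmul
  tmul_one := (isTwist_braidAbar r s n).tmul_one
  gen b α i a := (isBraiding_gen_iff _ _ _ _ _).2 (braidAbar_tbar_Tplus α b i a)
  mul_right := (isTwist_braidAbar r s n).mul_right
  mul_left := (isTwist_braidAbar r s n).mul_left

theorem IsBraiding.eq_braidAbar {r s n : ℕ} {Y : Abar s n ⊗[Kq] A r n →ₗ[Kq] A r n ⊗[Kq] Abar s n}
    (hY : IsBraiding r s n Y) : Y = braidAbar r s n :=
  eq_of_twist_gen ⟨hY.one_tmul, hY.tmul_one, tmul_mul_of_mul_right hY.mul_right,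
    mul_tmul_of_mul_left hY.mul_left⟩ (isTwist_braidAbar r s n)
    (fun x : IdxPos s × Idx n => Tminus s n x.1 x.2) (Tplus r n) (fun _ => coefBar r s n)
    (adjoin_Tminus s n) (adjoin_Tplus r n)
    (fun x i a => by
      rw [← braidGen_Tminus]
      exact (isBraiding_gen_iff Y x.2 (-x.1.1) i a).1 (hY.gen _ _ _ _))
    (fun x i a => braidAbar_tmul_Tplus _ _ _)

/-! ### The comultiplication -/

theorem Hm_sign {n : ℕ} {a b c d : Idx n} {k m : ℕ}
    (h : ((par a + par b : ℕ) : ZMod 2) = ((par c + par d : ℕ) : ZMod 2) →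
      (k : ZMod 2) = (m : ZMod 2)) :
    (-1 : Kq) ^ k * Hm n (a, b) (c, d) = (-1) ^ m * Hm n (a, b) (c, d) := by
  by_cases h0 : Hm n (a, b) (c, d) = 0
  · simp [h0]
  · rw [sign_congr_zmod (h (par_add_par_of_Hm h0))]

theorem Smat_eq_Hm {n : ℕ} (p b u c : Idx n) : Smat n p b u c =
    (-1) ^ (par b * par c + par u * (par p + par b)) * Hm n (u, p) (b, c) := by
  rw [Hm, ← mul_assoc, ← pow_add, ← two_mul, pow_mul]
  simp

theorem sign_gather (k l m o : ℕ) (x : Kq) : (-1 : Kq) ^ k * ((-1) ^ l * ((-1) ^ m * x * (-1) ^ o)) =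
    (-1) ^ (k + l + m + o) * x := by
  ring

theorem sum_comm_pairs {ι κ M : Type} [Fintype ι] [Fintype κ] [AddCommMonoid M]
    (f : ι → ι → κ → κ → M) :
    ∑ b, ∑ c, ∑ u, ∑ p, f b c u p = ∑ u, ∑ p, ∑ b, ∑ c, f b c u p := by
  simp only [← Fintype.sum_prod_type' (f := fun b c => ∑ u, ∑ p, f b c u p)]
  simp only [← Fintype.sum_prod_type' (f := fun u p => f _ _ u p)]
  rw [Finset.sum_comm]
  simp only [Fintype.sum_prod_type]

theorem scalarMul_apply {ι κ μ ι' κ' μ' M : Type} [Fintype μ] [Fintype μ']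
    [SuperIndex ι] [SuperIndex κ] [SuperIndex μ] [SuperIndex ι'] [SuperIndex κ'] [SuperIndex μ']
    [AddCommMonoid M] [Module Kq M]
    (D : SuperMat ι μ ι' μ' Kq) (X : SuperMat μ κ μ' κ' M) (i : ι) (k : κ) (j : ι') (l : κ') :
    scalarMul D X i k j l = ∑ p, ∑ u,
    ((-1 : Kq) ^ ((par i + par p + par j + par u) * (par p + par k + par u + par l)
      + (par j + par u) * (par p + par k))) • D i p j u • X p k u l := rfl

theorem mulScalar_apply {ι κ μ ι' κ' μ' M : Type} [Fintype μ] [Fintype μ']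
    [SuperIndex ι] [SuperIndex κ] [SuperIndex μ] [SuperIndex ι'] [SuperIndex κ'] [SuperIndex μ']
    [AddCommMonoid M] [Module Kq M]
    (X : SuperMat ι μ ι' μ' M) (D : SuperMat μ κ μ' κ' Kq) (i : ι) (k : κ) (j : ι') (l : κ') :
    mulScalar X D i k j l = ∑ p, ∑ u,
    ((-1 : Kq) ^ ((par i + par p + par j + par u) * (par p + par k + par u + par l)
      + (par j + par u) * (par p + par k))) • D p k u l • X i p j u := rfl

/-- The relations of `A_{n,s}` for all rows, in terms of the braid matrices. -/
theorem t_mul_t_Hm {n s : ℕ} (u p : Idx n) (α β : Idx s) :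
    ∑ b, ∑ c, ((-1 : Kq) ^ (par b * (par b + par α) + par c * (par c + par β) + (par b + par α) * par c)
        * Hm n (u, p) (b, c)) • (t n s b α * t n s c β) =
    ∑ γ, ∑ δ, ((-1 : Kq) ^ (par u * (par u + par γ) + par p * (par p + par δ) + (par u + par γ) * par p)
        * Hm s (γ, δ) (α, β)) • (t n s u γ * t n s p δ) := by
  have h := (scalarMul_leg12 (t n s) p α u β).trans
    ((rel_t p α u β).trans (mulScalar_leg21 (t n s) p α u β).symm)
  simp only [scalarMul_apply, mulScalar_apply, superMul_leg12, superMul_leg21, smul_smul] at h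
  have h' := congrArg (fun x => (-1 : Kq) ^ (par α * par p + par β * (par u + par p) + par β * par α +
    par u * par p + par u + par p) • x) h
  simp only [Finset.smul_sum, smul_smul] at h'
  refine Eq.trans ?_ (h'.trans ?_)
  · refine Finset.sum_congr rfl fun b _ => Finset.sum_congr rfl fun c _ => ?_
    congr 1
    rw [Smat_eq_Hm, sign_gather]
    apply Hm_sign
    intro h
    clear h'
    push_cast at h ⊢
    generalize (par α : ZMod 2) = x₁ at *
    generalize (par β : ZMod 2) = x₂ at *
    generalize (par u : ZMod 2) = x₃ at *
    generalize (par p : ZMod 2) = x₄ at *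
    generalize (par b : ZMod 2) = x₅ at *
    generalize (par c : ZMod 2) = x₆ at *
    revert h
    revert x₁ x₂ x₃ x₄ x₅ x₆
    decide
  · rw [Finset.sum_comm]
    refine Finset.sum_congr rfl fun γ _ => Finset.sum_congr rfl fun δ _ => ?_
    congr 1
    rw [Smat_eq_Hm, sign_gather]
    apply Hm_sign
    intro h
    clear h'
    push_cast at h ⊢
    generalize (par α : ZMod 2) = x₁ at *
    generalize (par β : ZMod 2) = x₂ at *
    generalize (par u : ZMod 2) = x₃ at *
    generalize (par p : ZMod 2) = x₄ at *
    generalize (par γ : ZMod 2) = x₅ at *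
    generalize (par δ : ZMod 2) = x₆ at *
    revert h
    revert x₁ x₂ x₃ x₄ x₅ x₆
    decide

/-- The relations are preserved by `t_{iα} ↦ ∑_b (-1)^{|b|(|b|+|α|)} t_{ib} ⊗ t_{bα}`. -/
theorem isTwist_sgnSwap_A (r n s : ℕ) : IsTwist (sgnSwap (parityA r n) (parityA n s)) :=
  isTwist_sgnSwap parityA_parityA parityA_parityA

/-- The image of a generator under the comultiplication. -/
def comulGen (r n s : ℕ) (i : Idx r) (α : Idx s) : A r n ⊗[Kq] A n s :=
  ∑ b, (-1 : Kq) ^ ((par i + par b) * (par b + par α)) • (t r n i b ⊗ₜ[Kq] t n s b α)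

theorem comulGen_neg {r n s : ℕ} (i : Idx r) (α : Idx s) :
    comulGen r n s (-i) (-α) = comulGen r n s i α := by
  refine Fintype.sum_equiv (negIdx n) _ _ fun b => ?_
  simp only [negIdx, Equiv.coe_fn_mk]
  rw [← t_neg i (-b), ← t_neg (-b) α, neg_neg_idx]
  congr 1
  apply sign_congr_zmod
  push_cast [par_neg_zmod]
  generalize (par α : ZMod 2) = x
  generalize (par i : ZMod 2) = y
  generalize (par b : ZMod 2) = z
  decide +revert

theorem tmulY_comulGen {r n s : ℕ} (i j : IdxPos r) (α β : Idx s) :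
    tmulY (sgnSwap (parityA r n) (parityA n s)) (comulGen r n s i.1 α) (comulGen r n s j.1 β) =
      ∑ b, ∑ c, (-1 : Kq) ^ (par b * (par b + par α) + par c * (par c + par β) +
        (par b + par α) * par c) • ((Tplus r n i b * Tplus r n j c) ⊗ₜ (t n s b α * t n s c β)) := by
  simp only [comulGen, tmulY_sum_left, tmulY_sum_right, tmulY_smul_left, tmulY_smul_right, Finset.smul_sum,
    smul_smul]
  rw [Finset.sum_comm]
  refine Finset.sum_congr rfl fun b _ => Finset.sum_congr rfl fun c _ => ?_
  rw [tmulY_tmul, lAct_tmul, sgnSwap_homog (parityA_t j.1 c) (parityA_t b α)]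
  simp only [map_smul, rmul_tmul, lmul_tmul, smul_smul, ← pow_add]
  congr 1
  apply sign_congr_zmod
  rw [par_of_pos i.2, par_of_pos j.2]
  push_cast
  generalize (par α : ZMod 2) = x
  generalize (par β : ZMod 2) = y
  generalize (par b : ZMod 2) = z
  generalize (par c : ZMod 2) = w
  decide +revert

/-- The relations of A_{r,n} produce `Hm n` on the two summed middle indices; the relations of
A_{n,s}, in the form `t_mul_t_Hm`, convert it into `Hm s` on the outer ones. -/
theorem rtt_comulGen (r n s : ℕ) : RTT (E := TwistAlg (isTwist_sgnSwap_A r n s)) cA eA (Hm s)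
    fun i α => comulGen r n s i.1 α := by
  intro i j α β
  change cA i j • tmulY (sgnSwap (parityA r n) (parityA n s)) (comulGen r n s i.1 α)
    (comulGen r n s j.1 β) + eA i j • tmulY (sgnSwap (parityA r n) (parityA n s))
    (comulGen r n s j.1 α) (comulGen r n s i.1 β) =
    act (fun x => tmulY (sgnSwap (parityA r n) (parityA n s)) (comulGen r n s j.1 x.1)
      (comulGen r n s i.1 x.2)) (Hm s) (α, β)
  simp only [tmulY_comulGen]
  simp only [Finset.smul_sum, ← Finset.sum_add_distrib]
  have h1 : ∀ b c, cA i j • (-1 : Kq) ^ (par b * (par b + par α) + par c * (par c + par β) +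
        (par b + par α) * par c) • ((Tplus r n i b * Tplus r n j c) ⊗ₜ[Kq] (t n s b α * t n s c β)) +
      eA i j • (-1 : Kq) ^ (par b * (par b + par α) + par c * (par c + par β) +
        (par b + par α) * par c) • ((Tplus r n j b * Tplus r n i c) ⊗ₜ[Kq] (t n s b α * t n s c β)) =
      ∑ u, ∑ p, (Tplus r n j u * Tplus r n i p) ⊗ₜ[Kq]
        (((-1 : Kq) ^ (par b * (par b + par α) + par c * (par c + par β) + (par b + par α) * par c)
        * Hm n (u, p) (b, c)) • (t n s b α * t n s c β)) := by
    intro b c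
    have h := rtt_Tplus r n i j b c
    rw [smul_comm (cA i j), smul_comm (eA i j), ← smul_add, TensorProduct.smul_tmul',
      TensorProduct.smul_tmul', ← TensorProduct.add_tmul, h]
    simp only [act, Fintype.sum_prod_type, TensorProduct.sum_tmul, Finset.smul_sum, ← TensorProduct.smul_tmul', smul_smul,
      TensorProduct.tmul_smul]
  simp only [h1]
  have h2 : ∀ u p, (∑ b, ∑ c, (Tplus r n j u * Tplus r n i p) ⊗ₜ[Kq]
        (((-1 : Kq) ^ (par b * (par b + par α) + par c * (par c + par β) + (par b + par α) * par c)
        * Hm n (u, p) (b, c)) • (t n s b α * t n s c β))) =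
      ∑ γ, ∑ δ, (Tplus r n j u * Tplus r n i p) ⊗ₜ[Kq]
        (((-1 : Kq) ^ (par u * (par u + par γ) + par p * (par p + par δ) + (par u + par γ) * par p)
        * Hm s (γ, δ) (α, β)) • (t n s u γ * t n s p δ)) := by
    intro u p
    simp only [← TensorProduct.tmul_sum]
    rw [t_mul_t_Hm]
  -- Summing over b and c first, with u and p fixed, exposes the left-hand side of the relations in
  -- the second tensor factor.
  rw [sum_comm_pairs]
  simp only [h2, act, Fintype.sum_prod_type, Finset.smul_sum, smul_smul]
  rw [sum_comm_pairs]
  refine Finset.sum_congr rfl fun γ _ => Finset.sum_congr rfl fun δ _ =>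
    Finset.sum_congr rfl fun u _ => Finset.sum_congr rfl fun p _ => ?_
  rw [TensorProduct.tmul_smul, mul_comm]

theorem exists_comul (r n s : ℕ) : ∃ F : A r s →ₐ[Kq] TwistAlg (isTwist_sgnSwap_A r n s),
    ∀ i α, F (Tplus r s i α) = comulGen r n s i.1 α :=
  exists_hom_A _ (rtt_comulGen r n s)

/-- The comultiplication `A_{r,s} → A_{r,n} ⊗ A_{n,s}`. -/
def comul (r n s : ℕ) : A r s →ₐ[Kq] TwistAlg (isTwist_sgnSwap_A r n s) := (exists_comul r n s).choose

theorem comul_Tplus {r n s : ℕ} (i : IdxPos r) (α : Idx s) :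
    comul r n s (Tplus r s i α) = comulGen r n s i.1 α := (exists_comul r n s).choose_spec i α

theorem comul_t {r n s : ℕ} (i : Idx r) (α : Idx s) :
    comul r n s (t r s i α) = comulGen r n s i α := by
  rcases par_eq i with h | h
  · exact comul_Tplus ⟨i, pos_of_par h⟩ α
  · rw [← t_neg, ← comulGen_neg]
    exact comul_Tplus ⟨-i, pos_of_par (by rw [par_neg, h])⟩ (-α)

theorem comul_mul {r n s : ℕ} (f g : A r s) : comul r n s (f * g) =
    tmulY (sgnSwap (parityA r n) (parityA n s)) (comul r n s f) (comul r n s g) :=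
  map_mul _ f g

theorem isComul_comul (n : ℕ) : IsComul n (comul n n n).toLinearMap where
  map_one := map_one (comul n n n)
  map_mul f g := by
    rw [superSwap_eq]
    exact comul_mul f g
  map_gen := comul_t

theorem IsComul.eq_comul {n : ℕ} {Δ : A n n →ₗ[Kq] A n n ⊗[Kq] A n n} (h : IsComul n Δ) :
    Δ = (comul n n n).toLinearMap := by
  let F : A n n →ₐ[Kq] TwistAlg (isTwist_sgnSwap_A n n n) :=
    AlgHom.ofLinearMap Δ h.map_one fun f g => (h.map_mul f g).trans (by
      rw [superSwap_eq]
      rfl)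
  have e : F = comul n n n := A_hom_ext fun i a => (h.map_gen _ _).trans (comul_Tplus i a).symm
  rw [← e]
  rfl

/-! ### The antipode -/

section superOpposite

variable {B : Type} [Ring B] [Algebra Kq B]

/-- The super-opposite product `x ∘ y = (-1)^{|x||y|} y x`. -/
def sopMul (σ : B →ₐ[Kq] B) : B →ₗ[Kq] B →ₗ[Kq] B :=
  TensorProduct.curry (LinearMap.mul' Kq B ∘ₗ sgnSwap σ σ)

theorem sopMul_even {σ : B →ₐ[Kq] B} {y : B} (hy : σ y = y) (x : B) : sopMul σ x y = y * x := by
  change LinearMap.mul' Kq B (sgnSwap σ σ (x ⊗ₜ y)) = _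
  rw [sgnSwap_even σ hy]
  rfl

theorem sopMul_odd {σ : B →ₐ[Kq] B} {y : B} (hy : σ y = -y) (x : B) : sopMul σ x y = y * σ x := by
  change LinearMap.mul' Kq B (sgnSwap σ σ (x ⊗ₜ y)) = _
  rw [sgnSwap_odd σ hy]
  rfl

theorem sopMul_homog {σ : B →ₐ[Kq] B} {x y : B} {k m : ℕ} (hy : σ y = (-1 : Kq) ^ k • y)
    (hx : σ x = (-1 : Kq) ^ m • x) : sopMul σ x y = (-1 : Kq) ^ (k * m) • (y * x) := by
  change LinearMap.mul' Kq B (sgnSwap σ σ (x ⊗ₜ y)) = _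
  rw [sgnSwap_homog hy hx, map_smul]
  rfl

theorem sopMul_assoc {σ : B →ₐ[Kq] B} (hσ : ∀ b, σ (σ b) = b) (x y z : B) :
    sopMul σ (sopMul σ x y) z = sopMul σ x (sopMul σ y z) := by
  obtain ⟨y₀, y₁, hy0, hy1, rfl⟩ := exists_even_add_odd hσ y
  obtain ⟨z₀, z₁, hz0, hz1, rfl⟩ := exists_even_add_odd hσ z
  have e1 : σ (z₀ * y₀) = z₀ * y₀ := by rw [map_mul, hz0, hy0]
  have e2 : σ (z₀ * y₁) = -(z₀ * y₁) := by rw [map_mul, hz0, hy1, mul_neg]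
  have e3 : σ (z₁ * y₀) = -(z₁ * y₀) := by rw [map_mul, hz1, hy0, neg_mul]
  have e4 : σ (z₁ * -y₁) = z₁ * -y₁ := by rw [map_mul, map_neg, hz1, hy1, neg_mul_neg]
  simp only [map_add, LinearMap.add_apply, sopMul_even hy0, sopMul_odd hy1, sopMul_even hz0,
    sopMul_odd hz1, map_mul, hy0, hy1, sopMul_even e1, sopMul_odd e2, sopMul_odd e3, sopMul_even e4, hσ, mul_assoc]

/-- The algebra `B` with the super-opposite product. -/
def SuperOp {σ : B →ₐ[Kq] B} (_ : ∀ b, σ (σ b) = b) : Type := B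

variable {σ : B →ₐ[Kq] B} (hσ : ∀ b, σ (σ b) = b)

instance : AddCommGroup (SuperOp hσ) := inferInstanceAs (AddCommGroup B)

instance : Module Kq (SuperOp hσ) := inferInstanceAs (Module Kq B)

instance : Ring (SuperOp hσ) where
  __ := (inferInstance : AddCommGroup (SuperOp hσ))
  mul := fun x y => sopMul σ x y
  one := (1 : B)
  left_distrib := fun x y z => (sopMul σ x).map_add y z
  right_distrib := fun x y z => LinearMap.map_add₂ (sopMul σ) x y z
  zero_mul := fun x => LinearMap.map_zero₂ (sopMul σ) x
  mul_zero := fun x => (sopMul σ x).map_zero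
  mul_assoc := fun x y z => sopMul_assoc (B := B) hσ x y z
  one_mul := fun x => by
    obtain ⟨y₀, y₁, hy0, hy1, h⟩ := exists_even_add_odd hσ x
    change sopMul σ 1 x = x
    rw [h, map_add, sopMul_even hy0, sopMul_odd hy1, map_one, mul_one, mul_one]
  mul_one := fun x => (sopMul_even (map_one σ) x).trans (one_mul (M := B) x)

instance : Algebra Kq (SuperOp hσ) :=
  Algebra.ofModule (fun k x y => LinearMap.map_smul₂ (sopMul σ) k x y)
    (fun k x y => (sopMul σ x).map_smul k y)

end superOpposite

/-- Written with the super-opposite product, the relations of T̄ are literally those of T, so the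
antipode is an ordinary homomorphism into `SuperOp`. -/
theorem rtt_antipode (n s : ℕ) :
    RTT (E := SuperOp (parityAbar_parityAbar (s := s) (n := n))) cA eA (Hm s)
      fun (i : IdxPos n) α => tbar s n α i.1 := by
  intro i j α β
  have h := rel_Tbar i.1 α j.1 β
  rw [relL_pos, relR_pos] at h
  have h' := smul_right_injective _ (neg_one_pow_ne_zero _) h
  have e : ∀ (i j : IdxPos n) (α β : Idx s), sopMul (parityAbar s n) (tbar s n α i.1) (tbar s n β j.1) =
      (-1 : Kq) ^ ((par i.1 + par α) * (par j.1 + par β)) •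
      (Tbar s n j.1 β * Tbar s n i.1 α) := by
    intro i j α β
    rw [sopMul_homog (parityAbar_tbar β j.1) (parityAbar_tbar α i.1), Tbar, Tbar, par_of_pos i.2,
      par_of_pos j.2]
    simp [mul_comm]
  simp only [← e] at h'
  exact h'

theorem exists_antipode (n s : ℕ) :
    ∃ F : A n s →ₐ[Kq] SuperOp (parityAbar_parityAbar (s := s) (n := n)),
      ∀ i α, F (Tplus n s i α) = tbar s n α i.1 :=
  exists_hom_A _ (rtt_antipode n s)

/-- The antipode `A_{n,s} → Ā_{s,n}`. -/
def antipode (n s : ℕ) : A n s →ₐ[Kq] SuperOp (parityAbar_parityAbar (s := s) (n := n)) :=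
  (exists_antipode n s).choose

/-- The antipode `A_{n,s} → Ā_{s,n}` as a linear map. -/
def antipodeL (n s : ℕ) : A n s →ₗ[Kq] Abar s n := (antipode n s).toLinearMap

theorem antipodeL_Tplus {n s : ℕ} (i : IdxPos n) (α : Idx s) :
    antipodeL n s (Tplus n s i α) = tbar s n α i.1 := (exists_antipode n s).choose_spec i α

theorem antipodeL_t {n s : ℕ} (i : Idx n) (α : Idx s) :
    antipodeL n s (t n s i α) = (-1 : Kq) ^ (par i * (par i + par α)) • tbar s n α i := by
  rcases par_eq i with h | h
  · rw [h, zero_mul, pow_zero, one_smul]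
    exact antipodeL_Tplus ⟨i, pos_of_par h⟩ α
  · rw [← t_neg, tbar_neg, smul_smul, ← pow_add, h, sign_congr_zmod (b := 0), pow_zero, one_smul]
    · exact antipodeL_Tplus ⟨-i, pos_of_par (by rw [par_neg, h])⟩ (-α)
    · push_cast
      generalize (par α : ZMod 2) = x
      decide +revert

theorem antipodeL_one (n s : ℕ) : antipodeL n s 1 = 1 := map_one (antipode n s)

theorem antipodeL_sopMul {n s : ℕ} (f g : A n s) :
    antipodeL n s (f * g) = sopMul (parityAbar s n) (antipodeL n s f) (antipodeL n s g) :=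
  map_mul (antipode n s) f g

/-- Induction along left multiplication by positive-row generators, the only operation for which Δ̃
has a simple recursion. -/
theorem A_induction {r n : ℕ} {P : A r n → Prop} (h1 : P 1) (hs : ∀ (k : Kq) f, P f → P (k • f))
    (ha : ∀ f g, P f → P g → P (f + g)) (hm : ∀ i a f, P f → P (Tplus r n i a * f)) (f : A r n) :
    P f := by
  have key : ∀ g ∈ Algebra.adjoin Kq (Set.range fun x : IdxPos r × Idx n => Tplus r n x.1 x.2),
      ∀ f, P f → P (g * f) := by
    intro g hg
    induction hg using Algebra.adjoin_induction with
    | mem g hg =>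
      obtain ⟨⟨i, a⟩, rfl⟩ := hg
      exact hm i a
    | algebraMap k =>
      intro f hf
      rw [← Algebra.smul_def]
      exact hs k f hf
    | add g g' _ _ ih ih' =>
      intro f hf
      rw [add_mul]
      exact ha _ _ (ih f hf) (ih' f hf)
    | mul g g' _ _ ih ih' =>
      intro f hf
      rw [mul_assoc]
      exact ih _ (ih' f hf)
  have e := key f (by rw [adjoin_Tplus]; trivial) 1 h1
  rwa [mul_one] at e

theorem parityAbar_sopMul {s n : ℕ} (x y : Abar s n) : parityAbar s n (sopMul (parityAbar s n) x y) =
    sopMul (parityAbar s n) (parityAbar s n x) (parityAbar s n y) := by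
  obtain ⟨y₀, y₁, hy0, hy1, rfl⟩ := exists_even_add_odd parityAbar_parityAbar y
  have e : parityAbar s n (-y₁) = - -y₁ := by rw [map_neg, hy1]
  simp only [map_add, sopMul_even hy0, sopMul_odd hy1, map_mul, hy0, hy1, sopMul_odd e]

theorem antipodeL_parity {n s : ℕ} (f : A n s) :
    antipodeL n s (parityA n s f) = parityAbar s n (antipodeL n s f) := by
  induction f using A_induction with
  | h1 => rw [map_one, antipodeL_one, map_one]
  | hs k f hf => simp only [map_smul, hf]
  | ha f g hf hg => simp only [map_add, hf, hg]
  | hm i a f hf =>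
    rw [map_mul, antipodeL_sopMul, hf, antipodeL_sopMul, parityAbar_sopMul, parityA_Tplus, map_smul,
      antipodeL_Tplus, parityAbar_tbar, par_of_pos i.2, add_zero]

theorem map_superSwap {n : ℕ} {Sa : A n n →ₗ[Kq] Abar n n}
    (h : ∀ f, Sa (parityA n n f) = parityAbar n n (Sa f)) (f g : A n n) :
    LinearMap.mul' Kq (Abar n n) (TensorProduct.map Sa Sa (superSwap n n (f ⊗ₜ g))) =
      sopMul (parityAbar n n) (Sa f) (Sa g) := by
  obtain ⟨g₀, g₁, h0, h1, rfl⟩ := exists_even_add_odd parityA_parityA g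
  have e0 : parityAbar n n (Sa g₀) = Sa g₀ := by rw [← h, h0]
  have e1 : parityAbar n n (Sa g₁) = -Sa g₁ := by rw [← h, h1, map_neg]
  simp only [superSwap_eq, TensorProduct.tmul_add, map_add, sgnSwap_even _ h0, sgnSwap_odd _ h1,
    TensorProduct.map_tmul, LinearMap.mul'_apply, h, sopMul_even e0, sopMul_odd e1]

theorem isAntipode_antipodeL (n : ℕ) : IsAntipode n (antipodeL n n) where
  map_one := antipodeL_one n n
  map_mul f g := by rw [map_superSwap antipodeL_parity, antipodeL_sopMul]
  map_gen := antipodeL_t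

/-- That `Sa` preserves parity is not part of the hypotheses. The induction therefore treats f and
its image under the parity automorphism together. -/
theorem IsAntipode.eq_antipodeL {n : ℕ} {Sa : A n n →ₗ[Kq] Abar n n} (h : IsAntipode n Sa) :
    Sa = antipodeL n n := by
  have hT : ∀ i a, Sa (Tplus n n i a) = antipodeL n n (Tplus n n i a) := fun i a =>
    (h.map_gen _ _).trans (antipodeL_t _ _).symm
  have key : ∀ f, Sa f = antipodeL n n f ∧ Sa (parityA n n f) = antipodeL n n (parityA n n f) := by
    intro f
    induction f using A_induction with
    | h1 => simp only [_root_.map_one, h.map_one, antipodeL_one, true_and]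
    | hs k f hf => simp only [map_smul, hf.1, hf.2, true_and]
    | ha f g hf hg => simp only [map_add, hf.1, hf.2, hg.1, hg.2, true_and]
    | hm i a f hf =>
      have hm : ∀ f, Sa f = antipodeL n n f → Sa (parityA n n f) = antipodeL n n (parityA n n f) →
          Sa (Tplus n n i a * f) = antipodeL n n (Tplus n n i a * f) := by
        intro f h1 h2
        rw [h.map_mul, (isAntipode_antipodeL n).map_mul]
        obtain ⟨f₀, f₁, e0, e1, rfl⟩ := exists_even_add_odd parityA_parityA f
        -- The even and the odd part are half the sum and half the difference of f and its image
        -- under the parity automorphism.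
        have h3 : Sa f₀ = antipodeL n n f₀ ∧ Sa f₁ = antipodeL n n f₁ := by
          simp only [map_add, e0, e1, map_neg] at h1 h2
          constructor
          · rw [← half_smul_add_self (Sa f₀), ← half_smul_add_self (antipodeL n n f₀)]
            congr 1
            calc Sa f₀ + Sa f₀ = (Sa f₀ + Sa f₁) + (Sa f₀ + -Sa f₁) := by abel
              _ = _ := by
                rw [h1, h2]
                abel
          · rw [← half_smul_add_self (Sa f₁), ← half_smul_add_self (antipodeL n n f₁)]
            congr 1
            calc Sa f₁ + Sa f₁ = (Sa f₀ + Sa f₁) - (Sa f₀ + -Sa f₁) := by abel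
              _ = _ := by
                rw [h1, h2]
                abel
        simp only [superSwap_eq, TensorProduct.tmul_add, map_add, sgnSwap_even _ e0,
          sgnSwap_odd _ e1, TensorProduct.map_tmul, h3.1, h3.2, hT, parityA_Tplus, map_smul]
      refine ⟨hm f hf.1 hf.2, ?_⟩
      rw [_root_.map_mul, parityA_Tplus, smul_mul_assoc, map_smul, map_smul,
        hm _ hf.2 (by rw [parityA_parityA]; exact hf.1)]
  exact LinearMap.ext fun f => (key f).1

/-! ### The restriction of `(1 ⊗ S°) ∘ Δ°` -/

theorem inclA_t {r r' n n' : ℕ} (hr : r ≤ r') (hn : n ≤ n') (i : Idx r) (a : Idx n) :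
    inclA hr hn (t r n i a) = t r' n' (emb hr i) (emb hn a) := by
  have h : inclA hr hn (t r n i a) = inclFreeA hr hn (Tfree r n i a) :=
    RingQuot.liftAlgHom_mkAlgHom_apply _ _ _ _
  rw [h]
  simp [inclFreeA, Tfree]

theorem inclAbar_tbar {s s' n n' : ℕ} (hs : s ≤ s') (hn : n ≤ n') (α : Idx s) (b : Idx n) :
    inclAbar hs hn (tbar s n α b) = tbar s' n' (emb hs α) (emb hn b) := by
  have h : inclAbar hs hn (tbar s n α b) = inclFreeAbar hs hn (FreeAlgebra.ι Kq (α, b)) :=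
    RingQuot.liftAlgHom_mkAlgHom_apply _ _ _ _
  rw [h]
  simp [inclFreeAbar]

theorem parityA_inclA {r r' n n' : ℕ} (hr : r ≤ r') (hn : n ≤ n') (f : A r n) :
    parityA r' n' (inclA hr hn f) = inclA hr hn (parityA r n f) := by
  have h : (parityA r' n').comp (inclA hr hn) = (inclA hr hn).comp (parityA r n) :=
    A_hom_ext fun i a => by
      rw [AlgHom.comp_apply, AlgHom.comp_apply, Tplus, inclA_t, parityA_t, parityA_t, map_smul, inclA_t,
        par_emb, par_emb]
  exact DFunLike.congr_fun h f

theorem parityAbar_inclAbar {s s' n n' : ℕ} (hs : s ≤ s') (hn : n ≤ n') (f : Abar s n) :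
    parityAbar s' n' (inclAbar hs hn f) = inclAbar hs hn (parityAbar s n f) := by
  have h : (parityAbar s' n').comp (inclAbar hs hn) = (inclAbar hs hn).comp (parityAbar s n) :=
    Abar_hom_ext fun i a => by
      rw [AlgHom.comp_apply, AlgHom.comp_apply, Tminus, inclAbar_tbar, parityAbar_tbar,
        parityAbar_tbar, map_smul, inclAbar_tbar, par_emb, par_emb]
  exact DFunLike.congr_fun h f

/-! ### Functoriality of twisted and super-opposite products -/

section functoriality

variable {B C B' C' : Type} [Ring B] [Algebra Kq B] [Ring C] [Algebra Kq C] [Ring B'] [Algebra Kq B']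
  [Ring C'] [Algebra Kq C']

theorem map_lmul_hom (F : B →ₐ[Kq] B') (G : C →ₐ[Kq] C') (x : B) (z : B ⊗[Kq] C) :
    TensorProduct.map F.toLinearMap G.toLinearMap (lmul x z) =
      lmul (F x) (TensorProduct.map F.toLinearMap G.toLinearMap z) := by
  induction z with
  | zero => simp
  | tmul a d => simp
  | add a d ha hd => simp only [map_add, ha, hd]

theorem map_rmul_hom (F : B →ₐ[Kq] B') (G : C →ₐ[Kq] C') (y : C) (z : B ⊗[Kq] C) :
    TensorProduct.map F.toLinearMap G.toLinearMap (rmul y z) =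
      rmul (G y) (TensorProduct.map F.toLinearMap G.toLinearMap z) := by
  induction z with
  | zero => simp
  | tmul a d => simp
  | add a d ha hd => simp only [map_add, ha, hd]

theorem map_tmulY {Y : C ⊗[Kq] B →ₗ[Kq] B ⊗[Kq] C} {Y' : C' ⊗[Kq] B' →ₗ[Kq] B' ⊗[Kq] C'}
    {F : B →ₐ[Kq] B'} {G : C →ₐ[Kq] C'}
    (h : ∀ c b, TensorProduct.map F.toLinearMap G.toLinearMap (Y (c ⊗ₜ b)) = Y' (G c ⊗ₜ F b))
    (o o' : B ⊗[Kq] C) : TensorProduct.map F.toLinearMap G.toLinearMap (tmulY Y o o') =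
      tmulY Y' (TensorProduct.map F.toLinearMap G.toLinearMap o)
        (TensorProduct.map F.toLinearMap G.toLinearMap o') := by
  induction o with
  | zero => simp [tmulY_zero_left]
  | tmul x y =>
    rw [tmulY_tmul, map_lmul_hom, TensorProduct.map_tmul, tmulY_tmul]
    congr 1
    induction o' with
    | zero => simp
    | tmul a d => rw [lAct_tmul, map_rmul_hom, h, TensorProduct.map_tmul, lAct_tmul]; rfl
    | add a d ha hd => simp only [map_add, ha, hd]
  | add a d ha hd => simp only [map_add, tmulY_add_left, ha, hd]

theorem map_sgnSwap {σB : B →ₐ[Kq] B} {σC : C →ₐ[Kq] C} {σB' : B' →ₐ[Kq] B'} {σC' : C' →ₐ[Kq] C'}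
    {F : B →ₐ[Kq] B'} {G : C →ₐ[Kq] C'} (hF : ∀ b, σB' (F b) = F (σB b))
    (hG : ∀ c, σC' (G c) = G (σC c)) (hB : ∀ b, σB (σB b) = b) (c : C) (b : B) :
    TensorProduct.map F.toLinearMap G.toLinearMap (sgnSwap σB σC (c ⊗ₜ b)) =
      sgnSwap σB' σC' (G c ⊗ₜ F b) := by
  obtain ⟨b₀, b₁, h0, h1, rfl⟩ := exists_even_add_odd hB b
  have e0 : σB' (F b₀) = F b₀ := by rw [hF, h0]
  have e1 : σB' (F b₁) = -F b₁ := by rw [hF, h1, map_neg]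
  simp only [TensorProduct.tmul_add, map_add, sgnSwap_even _ h0, sgnSwap_odd _ h1, sgnSwap_even _ e0,
    sgnSwap_odd _ e1, TensorProduct.map_tmul, AlgHom.toLinearMap_apply, hG]

theorem map_sopMul {σB : B →ₐ[Kq] B} {σB' : B' →ₐ[Kq] B'} {F : B →ₐ[Kq] B'}
    (hF : ∀ b, σB' (F b) = F (σB b)) (hB : ∀ b, σB (σB b) = b) (x y : B) :
    F (sopMul σB x y) = sopMul σB' (F x) (F y) := by
  obtain ⟨b₀, b₁, h0, h1, rfl⟩ := exists_even_add_odd hB y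
  have e0 : σB' (F b₀) = F b₀ := by rw [hF, h0]
  have e1 : σB' (F b₁) = -F b₁ := by rw [hF, h1, map_neg]
  simp only [map_add, sopMul_even h0, sopMul_odd h1, sopMul_even e0, sopMul_odd e1, map_mul, hF]

end functoriality

/-! ### The inclusions commute with the comultiplication and the antipode -/

theorem emb_refl {n : ℕ} (b : Idx n) : emb (le_refl n) b = b := rfl

/-- The comultiplication as a linear map. -/
def comulL (r n s : ℕ) : A r s →ₗ[Kq] A r n ⊗[Kq] A n s := (comul r n s).toLinearMap

theorem comulL_one (r n s : ℕ) : comulL r n s 1 = 1 ⊗ₜ 1 := map_one (comul r n s)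

theorem comulL_mul {r n s : ℕ} (f g : A r s) : comulL r n s (f * g) =
    tmulY (sgnSwap (parityA r n) (parityA n s)) (comulL r n s f) (comulL r n s g) :=
  comul_mul f g

theorem comulL_t {r n s : ℕ} (i : Idx r) (α : Idx s) :
    comulL r n s (t r s i α) = comulGen r n s i α := comul_t i α

theorem comulL_inclA {r s n : ℕ} (hr : r ≤ n) (hs : s ≤ n) (f : A r s) :
    TensorProduct.map (inclA hr (le_refl n)).toLinearMap (inclA (le_refl n) hs).toLinearMap
      (comulL r n s f) = comulL n n n (inclA hr hs f) := by
  induction f using A_induction with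
  | h1 => simp [comulL_one]
  | hs k f hf => simp only [map_smul, hf]
  | ha f g hf hg => simp only [map_add, hf, hg]
  | hm i a f hf =>
    rw [comulL_mul, map_mul, comulL_mul, map_tmulY (map_sgnSwap (parityA_inclA _ _) (parityA_inclA _ _)
      parityA_parityA), hf, Tplus, inclA_t, comulL_t, comulL_t]
    congr 1
    simp only [comulGen, map_sum, map_smul, TensorProduct.map_tmul, AlgHom.toLinearMap_apply, inclA_t,
      par_emb, emb_refl]

theorem antipodeL_inclA {s n : ℕ} (hs : s ≤ n) (f : A n s) :
    inclAbar hs (le_refl n) (antipodeL n s f) = antipodeL n n (inclA (le_refl n) hs f) := by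
  induction f using A_induction with
  | h1 => simp only [antipodeL_one, map_one]
  | hs k f hf => simp only [map_smul, hf]
  | ha f g hf hg => simp only [map_add, hf, hg]
  | hm i a f hf =>
    rw [antipodeL_sopMul, map_mul, antipodeL_sopMul, map_sopMul (parityAbar_inclAbar _ _)
      parityAbar_parityAbar, hf, antipodeL_Tplus, inclAbar_tbar, Tplus, inclA_t, antipodeL_t,
      par_emb, par_of_pos i.2, zero_mul, pow_zero, one_smul]

/-- The map `Δ̃_{r,s}`. -/
def Dmap (r s n : ℕ) : A r s →ₗ[Kq] A r n ⊗[Kq] Abar s n :=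
  LinearMap.lTensor (A r n) (antipodeL n s) ∘ₗ comulL r n s

theorem isRestriction_Dmap {r s n : ℕ} (hr : r ≤ n) (hs : s ≤ n) :
    IsRestriction hr hs (comulL n n n) (antipodeL n n) (Dmap r s n) := by
  intro f
  rw [← comulL_inclA]
  change TensorProduct.map _ _ (LinearMap.lTensor (A r n) (antipodeL n s) (comulL r n s f)) = _
  induction comulL r n s f with
  | zero => simp
  | tmul x y => simp [antipodeL_inclA]
  | add x y hx hy => simp only [map_add, hx, hy]

/-- Every relation between rows i and j involves these two rows in each of its monomials. Hence all
rows outside the smaller index set can be set to zero, and this gives retractions of the inclusions.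
-/
theorem rtt_restrict {n N : ℕ} {E : Type} [Ring E] [Algebra Kq E] {r : ℕ} (h : r ≤ n)
    {c e : IdxPos r → IdxPos r → Kq} {c' e' : IdxPos n → IdxPos n → Kq}
    {H : Matrix (Idx N × Idx N) (Idx N × Idx N) Kq} {T : IdxPos r → Idx N → E}
    (hT : RTT c e H T)
    (hc : ∀ i j : IdxPos r, c' ⟨emb h i.1, i.2⟩ ⟨emb h j.1, j.2⟩ = c i j)
    (he : ∀ i j : IdxPos r, e' ⟨emb h i.1, i.2⟩ ⟨emb h j.1, j.2⟩ = e i j) :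
    RTT c' e' H fun i a => if hi : ∃ j : IdxPos r, i = ⟨emb h j.1, j.2⟩ then T hi.choose a else 0 := by
  have hin : ∀ (i : IdxPos r) a, (if hi : ∃ j : IdxPos r,
      (⟨emb h i.1, i.2⟩ : IdxPos n) = ⟨emb h j.1, j.2⟩ then T hi.choose a else 0) = T i a := by
    intro i a
    have hi : ∃ j : IdxPos r, (⟨emb h i.1, i.2⟩ : IdxPos n) = ⟨emb h j.1, j.2⟩ := ⟨i, rfl⟩
    rw [dif_pos hi]
    congr 1
    exact (Subtype.ext (emb_injective h (congrArg Subtype.val hi.choose_spec))).symm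
  intro i j a b
  by_cases hi : ∃ k : IdxPos r, i = ⟨emb h k.1, k.2⟩
  · by_cases hj : ∃ k : IdxPos r, j = ⟨emb h k.1, k.2⟩
    · obtain ⟨i, rfl⟩ := hi
      obtain ⟨j, rfl⟩ := hj
      simp only [hin, hc, he]
      exact hT i j a b
    · simp [act, hj]
  · simp [act, hi]

theorem exists_retraction_A {r n N : ℕ} (h : r ≤ n) : ∃ F : A n N →ₐ[Kq] A r N,
    ∀ f, F (inclA h (le_refl N) f) = f := by
  obtain ⟨F, hF⟩ := exists_hom_A _ (rtt_restrict (c' := cA) (e' := eA) h (rtt_Tplus r N)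
    (fun i j => by
      simp only [cA, Subtype.mk.injEq, (emb_injective h).eq_iff, Subtype.ext_iff]) (fun i j => rfl))
  refine ⟨F, fun f => ?_⟩
  have e : F.comp (inclA h (le_refl N)) = AlgHom.id Kq _ := A_hom_ext fun i a => by
    rw [AlgHom.comp_apply, Tplus, inclA_t]
    have e := hF ⟨emb h i.1, i.2⟩ a
    have hi : ∃ j : IdxPos r, (⟨emb h i.1, i.2⟩ : IdxPos n) = ⟨emb h j.1, j.2⟩ := ⟨i, rfl⟩
    rw [dif_pos hi, ← Subtype.ext (emb_injective h (congrArg Subtype.val hi.choose_spec))] at e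
    exact e
  exact DFunLike.congr_fun e f

theorem exists_retraction_Abar {s n N : ℕ} (h : s ≤ n) : ∃ F : Abar n N →ₐ[Kq] Abar s N,
    ∀ f, F (inclAbar h (le_refl N) f) = f := by
  obtain ⟨F, hF⟩ := exists_hom_Abar _ (rtt_restrict (c' := cB) (e' := eB) h (rtt_Tminus s N)
    (fun i j => by
      simp only [cB, Subtype.mk.injEq, (emb_injective h).eq_iff, Subtype.ext_iff]) (fun i j => rfl))
  refine ⟨F, fun f => ?_⟩
  have e : F.comp (inclAbar h (le_refl N)) = AlgHom.id Kq _ := Abar_hom_ext fun i a => by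
    rw [AlgHom.comp_apply, Tminus, inclAbar_tbar]
    have e := hF ⟨emb h i.1, i.2⟩ a
    have hi : ∃ j : IdxPos s, (⟨emb h i.1, i.2⟩ : IdxPos n) = ⟨emb h j.1, j.2⟩ := ⟨i, rfl⟩
    rw [dif_pos hi, ← Subtype.ext (emb_injective h (congrArg Subtype.val hi.choose_spec))] at e
    exact e
  exact DFunLike.congr_fun e f

/-- The tensor product of the two retractions is a left inverse. This is what makes the restriction
of (1 ⊗ S°)Δ° unique. -/
theorem map_incl_injective {r s n : ℕ} (hr : r ≤ n) (hs : s ≤ n) : Function.Injective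
    (TensorProduct.map (inclA hr (le_refl n)).toLinearMap (inclAbar hs (le_refl n)).toLinearMap) := by
  obtain ⟨F, hF⟩ := exists_retraction_A (N := n) hr
  obtain ⟨G, hG⟩ := exists_retraction_Abar (N := n) hs
  apply Function.LeftInverse.injective (g := TensorProduct.map F.toLinearMap G.toLinearMap)
  intro z
  induction z with
  | zero => simp
  | tmul x y => simp [hF, hG]
  | add x y hx hy => simp only [map_add, hx, hy]

theorem IsRestriction.eq_Dmap {r s n : ℕ} {hr : r ≤ n} {hs : s ≤ n}
    {D : A r s →ₗ[Kq] A r n ⊗[Kq] Abar s n}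
    (hD : IsRestriction hr hs (comulL n n n) (antipodeL n n) D) : D = Dmap r s n :=
  LinearMap.ext fun f => map_incl_injective hr hs ((hD f).trans (isRestriction_Dmap hr hs f).symm)

/-! ### Powers of the parity automorphisms -/

section powers

variable {B C : Type} [Ring B] [Algebra Kq B] [Ring C] [Algebra Kq C]

theorem pow_parity_congr {σ : B →ₐ[Kq] B} (hσ : ∀ b, σ (σ b) = b) {k m : ℕ}
    (h : (k : ZMod 2) = (m : ZMod 2)) : σ ^ k = σ ^ m := by
  have h2 : σ ^ 2 = 1 := by
    ext b
    rw [pow_two]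
    exact hσ b
  rw [pow_eq_pow_mod k h2, pow_eq_pow_mod m h2, (ZMod.natCast_eq_natCast_iff' k m 2).1 h]

theorem pow_parity_homog {σ : B →ₐ[Kq] B} {b : B} {m : ℕ} (h : σ b = (-1 : Kq) ^ m • b) (k : ℕ) :
    (σ ^ k) b = (-1 : Kq) ^ (m * k) • b := by
  induction k with
  | zero => simp
  | succ k ih => rw [pow_succ, AlgHom.mul_apply, h, map_smul, ih, smul_smul, ← pow_add, mul_add_one,
      add_comm]

theorem sgnSwap_homog_right {σB : B →ₐ[Kq] B} {σC : C →ₐ[Kq] C} (hC : ∀ c, σC (σC c) = c) {b : B}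
    {k : ℕ} (hb : σB b = (-1 : Kq) ^ k • b) (c : C) :
    sgnSwap σB σC (c ⊗ₜ b) = b ⊗ₜ (σC ^ k) c := by
  rcases Nat.even_or_odd k with hk | hk
  · rw [hk.neg_one_pow, one_smul] at hb
    rw [sgnSwap_even σC hb, pow_parity_congr hC (m := 0)]
    · rfl
    · rw [hk.natCast_zmod_two, Nat.cast_zero]
  · rw [hk.neg_one_pow, neg_one_smul] at hb
    rw [sgnSwap_odd σC hb, pow_parity_congr hC (m := 1), pow_one]
    rw [hk.natCast_zmod_two, Nat.cast_one]

theorem sgnSwap_homog_left {σB : B →ₐ[Kq] B} {σC : C →ₐ[Kq] C} (hB : ∀ b, σB (σB b) = b) {c : C}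
    {k : ℕ} (hc : σC c = (-1 : Kq) ^ k • c) (b : B) :
    sgnSwap σB σC (c ⊗ₜ b) = (σB ^ k) b ⊗ₜ c := by
  rcases Nat.even_or_odd k with hk | hk
  · rw [hk.neg_one_pow, one_smul] at hc
    rw [sgnSwap_even_left hB hc, pow_parity_congr hB (m := 0)]
    · rfl
    · rw [hk.natCast_zmod_two, Nat.cast_zero]
  · rw [hk.neg_one_pow, neg_one_smul] at hc
    rw [sgnSwap_odd_left hB hc, pow_parity_congr hB (m := 1), pow_one]
    rw [hk.natCast_zmod_two, Nat.cast_one]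

theorem sopMul_homog_left {σ : B →ₐ[Kq] B} (hσ : ∀ b, σ (σ b) = b) {x : B} {k : ℕ}
    (hx : σ x = (-1 : Kq) ^ k • x) (y : B) : sopMul σ x y = (σ ^ k) y * x := by
  change LinearMap.mul' Kq B (sgnSwap σ σ (x ⊗ₜ y)) = _
  rw [sgnSwap_homog_left hσ hx]
  rfl

end powers

/-! ### The map `Δ̃` and left multiplication by generators -/

theorem comulGen_parity {r n s : ℕ} (i : Idx r) (α : Idx s) :
    TensorProduct.map (parityA r n).toLinearMap (parityA n s).toLinearMap (comulGen r n s i α) =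
      (-1 : Kq) ^ (par i + par α) • comulGen r n s i α := by
  simp only [comulGen, map_sum, map_smul, TensorProduct.map_tmul, AlgHom.toLinearMap_apply, parityA_t,
    TensorProduct.smul_tmul_smul, Finset.smul_sum, smul_smul]
  refine Finset.sum_congr rfl fun b _ => ?_
  congr 1
  rw [← pow_add, ← pow_add, ← pow_add]
  apply sign_congr_zmod
  push_cast
  generalize (par i : ZMod 2) = x
  generalize (par α : ZMod 2) = y
  generalize (par b : ZMod 2) = z
  decide +revert

theorem comulL_parity {r n s : ℕ} (f : A r s) :
    TensorProduct.map (parityA r n).toLinearMap (parityA n s).toLinearMap (comulL r n s f) =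
      comulL r n s (parityA r s f) := by
  induction f using A_induction with
  | h1 => simp [comulL_one]
  | hs k f hf => simp only [map_smul, hf]
  | ha f g hf hg => simp only [map_add, hf, hg]
  | hm i a f hf =>
    rw [comulL_mul, map_mul, comulL_mul, map_tmulY (map_sgnSwap (fun _ => rfl) (fun _ => rfl)
      parityA_parityA), hf, Tplus, parityA_t, map_smul, comulL_t, comulGen_parity]

theorem comulL_parity_pow {r n s : ℕ} (k : ℕ) (f : A r s) :
    TensorProduct.map (parityA r n ^ k).toLinearMap (parityA n s ^ k).toLinearMap (comulL r n s f) =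
      comulL r n s ((parityA r s ^ k) f) := by
  induction k generalizing f with
  | zero => 
    have e : ∀ {B : Type} [Ring B] [Algebra Kq B], (1 : B →ₐ[Kq] B).toLinearMap = LinearMap.id :=
      fun {_} _ _ => rfl
    simp only [pow_zero, e, TensorProduct.map_id]
    rfl
  | succ k ih =>
    have e : ∀ {B : Type} [Ring B] [Algebra Kq B] (σ : B →ₐ[Kq] B), (σ ^ (k + 1)).toLinearMap =
      (σ ^ k).toLinearMap ∘ₗ σ.toLinearMap := fun {_} _ _ σ => by
        rw [pow_succ]
        rfl
    rw [e, e, TensorProduct.map_comp, LinearMap.comp_apply, comulL_parity, ih, pow_succ]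
    rfl

theorem antipodeL_parity_pow {n s : ℕ} (k : ℕ) (f : A n s) :
    antipodeL n s ((parityA n s ^ k) f) = (parityAbar s n ^ k) (antipodeL n s f) := by
  induction k generalizing f with
  | zero => simp
  | succ k ih => rw [pow_succ, pow_succ, AlgHom.mul_apply, AlgHom.mul_apply, ih, antipodeL_parity]

theorem Dmap_one (r s n : ℕ) : Dmap r s n 1 = 1 ⊗ₜ 1 := by
  simp [Dmap, comulL_one, antipodeL_one]

/-- S° reverses products, so the factor t̄ coming from the generator ends up on the far right while
T stays on the far left. The super signs combine into a parity operator on f, and no braiding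
occurs. -/
theorem Dmap_Tplus_mul {r s n : ℕ} (i : IdxPos r) (α : Idx s) (f : A r s) :
    Dmap r s n (Tplus r s i α * f) = ∑ b, lmul (Tplus r n i b)
      (rmul (tbar s n α b) (Dmap r s n ((parityA r s ^ (par b + par α)) f))) := by
  rw [Dmap, LinearMap.comp_apply, comulL_mul, Tplus, comulL_t, comulGen, tmulY_sum_left, map_sum]
  refine Finset.sum_congr rfl fun b _ => ?_
  rw [tmulY_smul_left, tmulY_tmul, map_smul, LinearMap.comp_apply, ← comulL_parity_pow,
    par_of_pos i.2, zero_add]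
  induction comulL r n s f with
  | zero => simp
  | tmul x y =>
    rw [lAct_tmul, sgnSwap_homog_left parityA_parityA (parityA_t b α)]
    simp only [rmul_tmul, lmul_tmul, LinearMap.lTensor_tmul, TensorProduct.map_tmul,
      AlgHom.toLinearMap_apply, antipodeL_sopMul, antipodeL_parity_pow]
    rw [sopMul_homog_left parityAbar_parityAbar (k := par b + par α), antipodeL_t, mul_smul_comm,
      TensorProduct.tmul_smul, smul_smul, ← pow_add, sign_congr_zmod (b := 0), pow_zero, one_smul]
    · rfl
    · push_cast
      rw [CharTwo.add_self_eq_zero]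
    · rw [← antipodeL_parity, parityA_t, map_smul]
  | add x y hx hy => simp only [map_add, smul_add, hx, hy]

/-- Ψ preserves parity and T_{iα} has parity |α|, so the entry at (α, β) changes parity by |α| +
|β|. -/
theorem coefR_parity {r s : ℕ} (f : A r s) (α β : Idx s) : coefR r s (parityA r s f) α β =
    (-1 : Kq) ^ (par α + par β) • parityA r s (coefR r s f α β) := by
  induction f using A_induction generalizing α β with
  | h1 =>
    by_cases h : α = β
    · subst h
      rw [map_one, map_one, Matrix.one_apply_eq, map_one, ← two_mul, pow_mul]
      simp
    · simp [Matrix.one_apply_ne h]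
  | hs k f hf => simp only [map_smul, Matrix.smul_apply, hf, smul_comm k]
  | ha f g hf hg => simp only [map_add, Matrix.add_apply, hf, hg, smul_add]
  | hm i a f hf =>
    simp only [map_mul, Matrix.mul_apply, hf, map_sum, Finset.smul_sum]
    refine Finset.sum_congr rfl fun γ _ => ?_
    have h : coefR r s (parityA r s (Tplus r s i a)) α γ =
        (-1 : Kq) ^ (par α + par γ) • parityA r s (coefR r s (Tplus r s i a) α γ) := by
      rw [parityA_Tplus, map_smul, Matrix.smul_apply, coefR_Tplus]
      simp only [matR, map_sum, map_smul, parityA_Tplus, Finset.smul_sum, smul_smul]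
      refine Finset.sum_congr rfl fun u _ => ?_
      congr 1
      rw [mul_comm (Hm s _ _) ((-1) ^ _), ← mul_assoc, ← pow_add]
      apply Hm_sign
      intro h
      push_cast at h ⊢
      generalize (par α : ZMod 2) = x at *
      generalize (par γ : ZMod 2) = y at *
      generalize (par a : ZMod 2) = z at *
      generalize (par u : ZMod 2) = w at *
      revert x y z w
      decide
    rw [h, smul_mul_smul_comm, ← pow_add]
    congr 1
    apply sign_congr_zmod
    push_cast
    generalize (par α : ZMod 2) = x at *
    generalize (par γ : ZMod 2) = y at *
    generalize (par β : ZMod 2) = z at *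
    clear h hf
    decide +revert

theorem coefR_parity_pow {r s : ℕ} (k : ℕ) (f : A r s) (α β : Idx s) :
    coefR r s ((parityA r s ^ k) f) α β =
      (-1 : Kq) ^ (k * (par α + par β)) • (parityA r s ^ k) (coefR r s f α β) := by
  induction k generalizing f with
  | zero => simp
  | succ k ih =>
    rw [pow_succ, AlgHom.mul_apply, ih, coefR_parity, map_smul, smul_smul, ← pow_add, add_one_mul]
    rfl

/-- The relations of `Ā_{s,n}` for all rows, in terms of the braid matrices. -/
theorem tbar_mul_tbar_Hm {s n : ℕ} (c d : Idx n) (α β : Idx s) :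
    ∑ b, ∑ u, Hm n (c, d) (b, u) • (-1 : Kq) ^ ((par b + par α) * par β) •
      (tbar s n β u * tbar s n α b) =
    ∑ γ, ∑ α', ((-1 : Kq) ^ (par γ * par α' + par α' * par c) * Hm s (γ, α') (α, β)) •
      (tbar s n α' d * tbar s n γ c) := by
  -- The relations of Ā_{s,n} in all rows are obtained as the image of those of A_{n,s}, with no new
  -- computation of signs from the definition.
  have h := congrArg (antipodeL n s) (t_mul_t_Hm (n := n) (s := s) c d α β)
  have e : ∀ (b c : Idx n) (α β : Idx s), antipodeL n s (t n s b α * t n s c β) =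
      (-1 : Kq) ^ ((par b + par α) * (par c + par β) + par b * (par b + par α) +
        par c * (par c + par β)) • (tbar s n β c * tbar s n α b) := by
    intro b c α β
    rw [antipodeL_sopMul, antipodeL_t, antipodeL_t]
    simp only [map_smul, LinearMap.smul_apply]
    rw [sopMul_homog (parityAbar_tbar β c) (parityAbar_tbar α b), smul_smul, smul_smul, ← pow_add,
      ← pow_add]
    congr 1
    apply sign_congr_zmod
    push_cast
    generalize (par α : ZMod 2) = x
    generalize (par β : ZMod 2) = y
    generalize (par b : ZMod 2) = z
    generalize (par c : ZMod 2) = w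
    decide +revert
  simp only [map_sum, map_smul, e, smul_smul] at h
  refine Eq.trans ?_ (h.trans ?_)
  · refine Finset.sum_congr rfl fun b _ => Finset.sum_congr rfl fun u _ => ?_
    rw [smul_smul, mul_comm, mul_right_comm, ← pow_add]
    congr 2
    apply sign_congr_zmod
    push_cast
    generalize (par α : ZMod 2) = x
    generalize (par β : ZMod 2) = y
    generalize (par b : ZMod 2) = z
    generalize (par u : ZMod 2) = w
    decide +revert
  · refine Finset.sum_congr rfl fun γ _ => Finset.sum_congr rfl fun δ _ => ?_
    rw [mul_right_comm, ← pow_add]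
    congr 2
    apply sign_congr_zmod
    push_cast
    generalize (par c : ZMod 2) = x
    generalize (par d : ZMod 2) = y
    generalize (par γ : ZMod 2) = z
    generalize (par δ : ZMod 2) = w
    decide +revert

/-- The preceding relation is solved for a single product by applying `Hinv`. The result reverses
the order of the labels α and β, as the exchange relation requires. -/
theorem tbar_mul_tbar_Hinv {s n : ℕ} (b u : Idx n) (α β : Idx s) :
    (-1 : Kq) ^ ((par b + par α) * par β) • (tbar s n β u * tbar s n α b) =
    ∑ c, ∑ d, ∑ γ, ∑ α', (Hinv n (b, u) (c, d) *
      ((-1 : Kq) ^ (par γ * par α' + par α' * par c) * Hm s (γ, α') (α, β))) •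
      (tbar s n α' d * tbar s n γ c) := by
  have h : ∀ c d, Hinv n (b, u) (c, d) • ∑ x : Idx n × Idx n, Hm n (c, d) x •
      ((-1 : Kq) ^ ((par x.1 + par α) * par β) • (tbar s n β x.2 * tbar s n α x.1)) =
      ∑ γ, ∑ α', (Hinv n (b, u) (c, d) *
      ((-1 : Kq) ^ (par γ * par α' + par α' * par c) * Hm s (γ, α') (α, β))) •
      (tbar s n α' d * tbar s n γ c) := by
    intro c d
    rw [Fintype.sum_prod_type, tbar_mul_tbar_Hm]
    simp only [Finset.smul_sum, smul_smul]
  simp only [← h]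
  rw [← Fintype.sum_prod_type (f := fun x : Idx n × Idx n => Hinv n (b, u) (x.1, x.2) •
    ∑ y : Idx n × Idx n, Hm n (x.1, x.2) y •
      ((-1 : Kq) ^ ((par y.1 + par α) * par β) • (tbar s n β y.2 * tbar s n α y.1)))]
  simp only [Prod.mk.eta, Finset.smul_sum]
  rw [Finset.sum_comm]
  simp only [smul_smul]
  simp only [← mul_assoc, ← Finset.sum_mul, ← Finset.sum_smul, ← Matrix.mul_apply, Hinv_mul_Hm,
    Matrix.one_apply, ite_mul, one_mul, zero_mul, ite_smul, zero_smul, Finset.sum_ite_eq,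
    Finset.mem_univ, if_true]

/-! ### The map `Δ̃` and the braidings -/

theorem rmul_sum {B C ι : Type} [Ring B] [Algebra Kq B] [Ring C] [Algebra Kq C] (s : Finset ι)
    (y : ι → C) (z : B ⊗[Kq] C) : rmul (∑ i ∈ s, y i) z = ∑ i ∈ s, rmul (y i) z := by
  simp only [← mulRight_tmul, TensorProduct.tmul_sum, map_sum]

theorem rmul_smul {B C : Type} [Ring B] [Algebra Kq B] [Ring C] [Algebra Kq C] (k : Kq)
    (y : C) (z : B ⊗[Kq] C) : rmul (k • y) z = k • rmul y z := by
  simp only [← mulRight_tmul, TensorProduct.tmul_smul, map_smul]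

theorem parityA_pow_Tplus {r s : ℕ} (k : ℕ) (i : IdxPos r) (a : Idx s) :
    (parityA r s ^ k) (Tplus r s i a) = (-1 : Kq) ^ (par a * k) • Tplus r s i a :=
  pow_parity_homog (parityA_Tplus i a) k

/-- The value of Υ at generators read backwards: summed against `Hinv`, the products T t̄ reassemble
into t̄ standing to the left of T. -/
theorem sum_lmul_lAct_tbar {r s n : ℕ} (α : Idx s) (b c : Idx n) (j : IdxPos r)
    (z : A r n ⊗[Kq] Abar s n) :
    ∑ u, ∑ d, Hinv n (b, u) (c, d) •
      lmul (Tplus r n j u) (lAct (braidAbar r s n) (tbar s n α d) z) =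
    (-1 : Kq) ^ (par α * par c) •
      lAct (braidAbar r s n) (tbar s n α b) (lmul (Tplus r n j c) z) := by
  rw [(isTwist_braidAbar r s n).lAct_lmul, braidAbar_tbar_Tplus, braidGen, tmulY_smul_left, smul_smul,
    ← pow_add, sign_congr_zmod (b := 0), pow_zero, one_smul, act, tmulY_sum_left,
    Fintype.sum_prod_type]
  · simp only [tmulY_smul_left, tmulY_tmul, Hdual]
  · push_cast
    exact CharTwo.add_self_eq_zero _

theorem Dmap_pow_Tplus_mul {r s n : ℕ} (k : ℕ) (i : IdxPos r) (α : Idx s) (f : A r s) :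
    Dmap r s n ((parityA r s ^ k) (Tplus r s i α * f)) = (-1 : Kq) ^ (par α * k) •
      ∑ b, lmul (Tplus r n i b)
        (rmul (tbar s n α b) (Dmap r s n ((parityA r s ^ (k + par b + par α)) f))) := by
  rw [map_mul, parityA_pow_Tplus, smul_mul_assoc, map_smul, Dmap_Tplus_mul]
  congr 1
  refine Finset.sum_congr rfl fun b _ => ?_
  rw [← AlgHom.mul_apply, ← pow_add, add_comm _ k, add_assoc]

/-- The exchange relation between `Δ̃` and the generators of `Ā_{s,n}`, for one element. -/
def Exchange (r s n : ℕ) (f : A r s) : Prop := ∀ (α : Idx s) (b : Idx n),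
  rmul (tbar s n α b) (Dmap r s n ((parityA r s ^ (par b + par α)) f)) =
    ∑ α', lAct (braidAbar r s n) (tbar s n α' b)
      (Dmap r s n ((parityA r s ^ par α') (coefR r s f α α')))

/-- Only the inner of the two right factors is exchanged. The outer one commutes with left actions,
and moving its parity operator through `coefR` creates the sign. -/
theorem Exchange.rmul_rmul {r s n : ℕ} {f : A r s}
    (h : ∀ k, Exchange r s n ((parityA r s ^ k) f)) (c d : Idx n) (γ α : Idx s) :
    rmul (tbar s n α d * tbar s n γ c)
      (Dmap r s n ((parityA r s ^ (par d + par α + (par γ + par c))) f)) =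
    ∑ α', (-1 : Kq) ^ ((par γ + par c) * (par α + par α')) •
      lAct (braidAbar r s n) (tbar s n α' d) (rmul (tbar s n γ c)
        (Dmap r s n ((parityA r s ^ (par α' + (par γ + par c))) (coefR r s f α α')))) := by
  rw [← QueerInv.rmul_rmul, pow_add, AlgHom.mul_apply, h _ α d, map_sum]
  refine Finset.sum_congr rfl fun α' _ => ?_
  rw [coefR_parity_pow, map_smul, map_smul, map_smul, map_smul, lAct_rmul, ← AlgHom.mul_apply,
    ← pow_add]

theorem sum_comm_six {M ι κ : Type} [Fintype ι] [Fintype κ] [AddCommMonoid M]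
    (F : ι → ι → ι → κ → κ → κ → M) :
    ∑ u, ∑ c, ∑ d, ∑ γ, ∑ α', ∑ α'', F u c d γ α' α'' =
      ∑ α'', ∑ c, ∑ γ, ∑ α', ∑ u, ∑ d, F u c d γ α' α'' := by
  have h : ∀ u c, ∑ d, ∑ γ, ∑ α', ∑ α'', F u c d γ α' α'' =
      ∑ α'', ∑ γ, ∑ α', ∑ d, F u c d γ α' α'' := by
    intro u c
    rw [Finset.sum_congr rfl fun d _ => Finset.sum_comm_cycle, Finset.sum_comm]
    exact Finset.sum_congr rfl fun α'' _ => Finset.sum_comm_cycle.symm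
  simp only [h]
  rw [Finset.sum_comm_cycle]
  refine Finset.sum_congr rfl fun α'' _ => ?_
  rw [Finset.sum_comm]
  exact Finset.sum_congr rfl fun c _ => Finset.sum_comm_cycle.symm

/-- Expanding Δ̃(T_{jβ} f) puts two generators t̄ on the right. They are reordered with `Hinv` and
`Hm`, and the inner one is exchanged with Δ̃(f). The factor `Hinv` is then consumed by Υ, which
brings t̄ to the left of T, and the factor `Hm` is consumed by the coefficients of Ψ at T_{jβ}. -/
theorem Exchange.Tplus_mul {r s n : ℕ} {f : A r s}
    (h : ∀ k, Exchange r s n ((parityA r s ^ k) f)) (j : IdxPos r) (β : Idx s) :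
    Exchange r s n (Tplus r s j β * f) := by
  intro α b
  have hL : rmul (tbar s n α b)
      (Dmap r s n ((parityA r s ^ (par b + par α)) (Tplus r s j β * f))) =
      ∑ u, ∑ c, ∑ d, ∑ γ, ∑ α', ∑ α'', (Hinv n (b, u) (c, d) *
        (Hm s (γ, α') (α, β) * (-1 : Kq) ^ (par γ * par α'' + par c * par α''))) •
        lmul (Tplus r n j u) (lAct (braidAbar r s n) (tbar s n α'' d) (rmul (tbar s n γ c)
          (Dmap r s n ((parityA r s ^ (par α'' + (par γ + par c))) (coefR r s f α' α''))))) := by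
    rw [Dmap_pow_Tplus_mul, map_smul, map_sum, Finset.smul_sum]
    refine Finset.sum_congr rfl fun u _ => ?_
    rw [rmul_lmul, QueerInv.rmul_rmul, ← map_smul, ← rmul_smul, mul_comm (par β),
      tbar_mul_tbar_Hinv]
    simp only [rmul_sum, map_sum]
    refine Finset.sum_congr rfl fun c _ => Finset.sum_congr rfl fun d _ =>
      Finset.sum_congr rfl fun γ _ => Finset.sum_congr rfl fun α' _ => ?_
    rw [rmul_smul, map_smul]
    by_cases h1 : Hinv n (b, u) (c, d) = 0
    · simp [h1]
    by_cases h2 : Hm s (γ, α') (α, β) = 0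
    · simp [h2]
    -- For nonzero entries of `Hinv` and `Hm` the parities of the indices are tied together, and the
    -- parity operator becomes the one that the exchange relation for f needs.
    rw [pow_parity_congr parityA_parityA (m := par d + par α' + (par γ + par c)),
      Exchange.rmul_rmul h, map_sum, Finset.smul_sum]
    · refine Finset.sum_congr rfl fun α'' _ => ?_
      rw [map_smul, smul_smul, mul_assoc, mul_right_comm, ← pow_add, mul_comm (_ ^ _) (Hm _ _ _)]
      congr 3
      apply sign_congr_zmod
      push_cast
      generalize (par c : ZMod 2) = x
      generalize (par γ : ZMod 2) = y
      generalize (par α' : ZMod 2) = z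
      generalize (par α'' : ZMod 2) = w
      revert x y z w
      decide
    · have p1 := par_add_par_of_Hinv h1
      have p2 := par_add_par_of_Hm h2
      push_cast at p1 p2 ⊢
      grind
  have hR : ∀ α'', Dmap r s n ((parityA r s ^ par α'') (coefR r s (Tplus r s j β * f) α α'')) =
      ∑ c, ∑ γ, ∑ α', (Hm s (γ, α') (α, β) * (-1 : Kq) ^ (par γ * par α'')) •
        lmul (Tplus r n j c) (rmul (tbar s n γ c)
          (Dmap r s n ((parityA r s ^ (par α'' + (par γ + par c))) (coefR r s f α' α'')))) := by
    intro α''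
    rw [map_mul, Matrix.mul_apply, coefR_Tplus]
    simp only [matR, Finset.sum_mul, map_sum, smul_mul_assoc, map_smul, Dmap_pow_Tplus_mul,
      smul_smul, Finset.smul_sum]
    rw [Finset.sum_comm_cycle]
    refine Finset.sum_congr rfl fun c _ => ?_
    rw [Finset.sum_comm]
    refine Finset.sum_congr rfl fun γ _ => Finset.sum_congr rfl fun α' _ => ?_
    rw [add_assoc, add_comm (par c)]
  rw [hL, sum_comm_six]
  simp only [hR, map_sum, map_smul]
  refine Finset.sum_congr rfl fun α'' _ => Finset.sum_congr rfl fun c _ =>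
    Finset.sum_congr rfl fun γ _ => Finset.sum_congr rfl fun α' _ => ?_
  -- At this point the sums over u and d are innermost, so that Υ at the generators applies with the
  -- other four indices fixed.
  have e := sum_lmul_lAct_tbar (r := r) α'' b c j (rmul (tbar s n γ c)
    (Dmap r s n ((parityA r s ^ (par α'' + (par γ + par c))) (coefR r s f α' α''))))
  simp only [mul_comm (Hinv n _ _), mul_smul, ← Finset.smul_sum, e]
  congr 1
  rw [smul_smul, ← pow_add]
  congr 1
  apply sign_congr_zmod
  push_cast
  generalize (par c : ZMod 2) = x
  generalize (par γ : ZMod 2) = y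
  generalize (par α'' : ZMod 2) = z
  revert x y z
  decide

/-- The claim is proved for all parity powers of f at once, because the step `Exchange.Tplus_mul`
uses them. -/
theorem exchange (r s n : ℕ) (f : A r s) : Exchange r s n f := by
  suffices h : ∀ k, Exchange r s n ((parityA r s ^ k) f) from by simpa using h 0
  induction f using A_induction with
  | h1 =>
    intro k α b
    rw [map_one, map_one, Dmap_one, rmul_tmul, one_mul, map_one, Finset.sum_eq_single α]
    · rw [Matrix.one_apply_eq, map_one, Dmap_one, lAct_tmul, (isTwist_braidAbar r s n).tmul_one,
        rmul_tmul, mul_one]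
    · intro α' _ h
      rw [Matrix.one_apply_ne (Ne.symm h), map_zero, map_zero, map_zero]
    · simp
  | hs c f hf =>
    intro k α b
    simp only [map_smul, Matrix.smul_apply, hf k α b, Finset.smul_sum]
  | ha f g hf hg =>
    intro k α b
    simp only [map_add, Matrix.add_apply, hf k α b, hg k α b, Finset.sum_add_distrib]
  | hm i a f hf =>
    intro k α b
    rw [map_mul, parityA_pow_Tplus, smul_mul_assoc]
    simp only [map_smul, Matrix.smul_apply]
    rw [Exchange.Tplus_mul (f := (parityA r s ^ k) f) (fun m => by
      rw [← AlgHom.mul_apply, ← pow_add]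
      exact hf _) i a α b, Finset.smul_sum]

/-! ### The multiplicativity of `Δ̃` -/

/-- The product of the values of `Δ̃` on the two factors, in the opposite order. -/
def mulDmap (r s n : ℕ) : A r s ⊗[Kq] A r s →ₗ[Kq] A r n ⊗[Kq] Abar s n :=
  twistedMul (braidAbar r s n) ∘ₗ TensorProduct.map (Dmap r s n) (Dmap r s n) ∘ₗ superSwap r s

theorem mulDmap_tmul {r s n : ℕ} (g : A r s) {f : A r s} {k : ℕ}
    (hf : parityA r s f = (-1 : Kq) ^ k • f) : mulDmap r s n (g ⊗ₜ f) =
      tmulY (braidAbar r s n) (Dmap r s n f) (Dmap r s n ((parityA r s ^ k) g)) := by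
  rw [mulDmap, LinearMap.comp_apply, LinearMap.comp_apply, superSwap_eq,
    sgnSwap_homog_right parityA_parityA hf]
  rfl

/-- Ψ moves T_{iα} past g at the cost of coefficients of g, and Δ̃ of the product of T with f leaves
t̄_{α'b} between Δ̃(f) and the second factor. The exchange relation, read from right to left,
reunites the sum over α' into Δ̃(g) t̄_{αb}. -/
theorem mulDmap_lAct_homog {r s n : ℕ} (i : IdxPos r) (α : Idx s) (g : A r s) {f : A r s} {k : ℕ}
    (hf : parityA r s f = (-1 : Kq) ^ k • f) :
    mulDmap r s n (lAct (braidA r s) (Tplus r s i α) (g ⊗ₜ f)) =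
      ∑ b, lmul (Tplus r n i b) (rmul (tbar s n α b) (mulDmap r s n (TensorProduct.map
        (parityA r s ^ (par b + par α)).toLinearMap (parityA r s ^ (par b + par α)).toLinearMap
        (g ⊗ₜ f)))) := by
  have hw : ∀ α', parityA r s (Tplus r s i α' * f) =
      (-1 : Kq) ^ (par α' + k) • (Tplus r s i α' * f) := by
    intro α'
    rw [map_mul, parityA_Tplus, hf, smul_mul_smul_comm, ← pow_add]
  have hL : mulDmap r s n (lAct (braidA r s) (Tplus r s i α) (g ⊗ₜ f)) =
      ∑ α', ∑ b, (-1 : Kq) ^ (k * (par b + par α)) • lmul (Tplus r n i b)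
        (tmulY (braidAbar r s n) (Dmap r s n f) (lAct (braidAbar r s n) (tbar s n α' b)
          (Dmap r s n ((parityA r s ^ par α') (coefR r s ((parityA r s ^ k) g) α α'))))) := by
    rw [lAct_tmul, braidA_Tplus_tmul]
    simp only [map_sum, rmul_tmul]
    refine Finset.sum_congr rfl fun α' _ => ?_
    rw [mulDmap_tmul _ (hw α'), Dmap_Tplus_mul, tmulY_sum_left]
    refine Finset.sum_congr rfl fun b _ => ?_
    rw [pow_parity_homog hf, lmul_tmulY, rmul_tmulY _ _ _ (isTwist_braidAbar r s n), map_smul,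
      tmulY_smul_left, map_smul, coefR_parity_pow, map_smul, map_smul, map_smul, tmulY_smul_right,
      map_smul, smul_smul, ← pow_add, pow_add _ (par α') k, AlgHom.mul_apply]
    congr 1
    apply sign_congr_zmod
    push_cast
    grind
  have hR : ∀ b : Idx n, mulDmap r s n (TensorProduct.map (parityA r s ^ (par b + par α)).toLinearMap
      (parityA r s ^ (par b + par α)).toLinearMap (g ⊗ₜ f)) =
      (-1 : Kq) ^ (k * (par b + par α)) • tmulY (braidAbar r s n) (Dmap r s n f)
        (Dmap r s n ((parityA r s ^ (par b + par α)) ((parityA r s ^ k) g))) := by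
    intro b
    rw [TensorProduct.map_tmul, AlgHom.toLinearMap_apply, AlgHom.toLinearMap_apply,
      pow_parity_homog hf, TensorProduct.tmul_smul, map_smul, mulDmap_tmul _ hf, ← AlgHom.mul_apply,
      ← AlgHom.mul_apply, ← pow_add, ← pow_add, add_comm k]
  rw [hL, Finset.sum_comm]
  refine Finset.sum_congr rfl fun b _ => ?_
  rw [hR, map_smul, map_smul, ← tmulY_rmul, exchange, tmulY_sum_right, map_sum, Finset.smul_sum]

theorem mulDmap_lAct {r s n : ℕ} (i : IdxPos r) (α : Idx s) (z : A r s ⊗[Kq] A r s) :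
    mulDmap r s n (lAct (braidA r s) (Tplus r s i α) z) =
      ∑ b, lmul (Tplus r n i b) (rmul (tbar s n α b) (mulDmap r s n (TensorProduct.map
        (parityA r s ^ (par b + par α)).toLinearMap (parityA r s ^ (par b + par α)).toLinearMap
        z))) := by
  induction z with
  | zero => simp
  | tmul g f =>
    obtain ⟨f₀, f₁, h0, h1, rfl⟩ := exists_even_add_odd parityA_parityA f
    have e0 : parityA r s f₀ = (-1 : Kq) ^ 0 • f₀ := by rw [h0, pow_zero, one_smul]
    have e1 : parityA r s f₁ = (-1 : Kq) ^ 1 • f₁ := by rw [h1, pow_one, neg_one_smul]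
    simp only [TensorProduct.tmul_add, map_add, mulDmap_lAct_homog i α g e0,
      mulDmap_lAct_homog i α g e1, Finset.sum_add_distrib]
  | add x y hx hy => simp only [map_add, hx, hy, Finset.sum_add_distrib]

theorem braidA_parity_pow {r s : ℕ} (k : ℕ) (f g : A r s) :
    TensorProduct.map (parityA r s ^ k).toLinearMap (parityA r s ^ k).toLinearMap
      (braidA r s (f ⊗ₜ g)) = braidA r s ((parityA r s ^ k) f ⊗ₜ (parityA r s ^ k) g) := by
  rcases Nat.even_or_odd k with hk | hk
  · rw [pow_parity_congr parityA_parityA (m := 0), pow_zero]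
    · have e : (1 : A r s →ₐ[Kq] A r s).toLinearMap = LinearMap.id := rfl
      rw [e, TensorProduct.map_id]
      rfl
    · rw [hk.natCast_zmod_two, Nat.cast_zero]
  · rw [pow_parity_congr parityA_parityA (m := 1), pow_one, ← braidA_parity]
    · rfl
    · rw [hk.natCast_zmod_two, Nat.cast_one]

/-- As functions of f both sides obey the same recursion, by `Dmap_Tplus_mul` and `mulDmap_lAct`,
and they agree at f = 1. -/
theorem Dmap_mul {r s n : ℕ} (f g : A r s) :
    Dmap r s n (f * g) = mulDmap r s n (braidA r s (f ⊗ₜ g)) := by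
  -- The recursion applies a parity power to both f and g, so both have to vary in the induction.
  suffices h : ∀ k g, Dmap r s n ((parityA r s ^ k) f * g) =
      mulDmap r s n (braidA r s ((parityA r s ^ k) f ⊗ₜ g)) from by simpa using h 0 g
  induction f using A_induction with
  | h1 =>
    intro k g
    rw [map_one, one_mul, (isTwist_braidA r s).one_tmul, mulDmap_tmul (k := 0), Dmap_one,
      (isTwist_braidAbar r s n).one_tmulY]
    · rfl
    · simp
  | hs c f hf =>
    intro k g
    simp only [map_smul, smul_mul_assoc, ← TensorProduct.smul_tmul', hf]
  | ha f₁ f₂ h1 h2 =>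
    intro k g
    simp only [map_add, add_mul, TensorProduct.add_tmul, h1, h2]
  | hm i a f hf =>
    intro k g
    rw [map_mul (parityA r s ^ k), parityA_pow_Tplus]
    simp only [smul_mul_assoc, ← TensorProduct.smul_tmul', map_smul]
    congr 1
    rw [mul_assoc, Dmap_Tplus_mul, (isTwist_braidA r s).mul_tmul, mulDmap_lAct]
    refine Finset.sum_congr rfl fun b _ => ?_
    rw [braidA_parity_pow, map_mul (parityA r s ^ _), ← AlgHom.mul_apply, ← pow_add, hf]

theorem Dmap_mul_eq_twistedMul {r s n : ℕ} (f g : A r s) : Dmap r s n (f * g) =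
    twistedMul (braidAbar r s n) (TensorProduct.map (Dmap r s n) (Dmap r s n)
      ((superSwap r s ∘ₗ braidA r s) (f ⊗ₜ g))) :=
  Dmap_mul f g

end

end QueerInv

theorem proposition5 (r s : ℕ) :
    (∃! Ω : A r s ⊗[Kq] A r s →ₗ[Kq] A r s ⊗[Kq] A r s, IsOmega r s Ω) ∧
    ∀ (n : ℕ) (hr : r ≤ n) (hs : s ≤ n),
      (∃! Y : Abar s n ⊗[Kq] A r n →ₗ[Kq] A r n ⊗[Kq] Abar s n, IsBraiding r s n Y) ∧
      (∃! Δ : A n n →ₗ[Kq] A n n ⊗[Kq] A n n, IsComul n Δ) ∧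
      (∃! Sa : A n n →ₗ[Kq] Abar n n, IsAntipode n Sa) ∧
      (∀ (Δ : A n n →ₗ[Kq] A n n ⊗[Kq] A n n) (Sa : A n n →ₗ[Kq] Abar n n),
        IsComul n Δ → IsAntipode n Sa →
          ∃! D : A r s →ₗ[Kq] A r n ⊗[Kq] Abar s n, IsRestriction hr hs Δ Sa D) ∧
      ∀ (Ω : A r s ⊗[Kq] A r s →ₗ[Kq] A r s ⊗[Kq] A r s)
        (Y : Abar s n ⊗[Kq] A r n →ₗ[Kq] A r n ⊗[Kq] Abar s n)
        (Δ : A n n →ₗ[Kq] A n n ⊗[Kq] A n n) (Sa : A n n →ₗ[Kq] Abar n n)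
        (D : A r s →ₗ[Kq] A r n ⊗[Kq] Abar s n),
        IsOmega r s Ω → IsBraiding r s n Y → IsComul n Δ → IsAntipode n Sa →
          IsRestriction hr hs Δ Sa D →
          ∀ f g : A r s, D (f * g) = twistedMul Y (TensorProduct.map D D (Ω (f ⊗ₜ[Kq] g))) := by
  refine ⟨⟨_, isOmega_superSwap_braidA r s, fun Ω hΩ => hΩ.eq_superSwap_braidA⟩,
    fun n hr hs => ⟨⟨_, isBraiding_braidAbar r s n, fun Y hY => hY.eq_braidAbar⟩,
      ⟨_, isComul_comul n, fun Δ hΔ => hΔ.eq_comul⟩,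
      ⟨_, isAntipode_antipodeL n, fun Sa hSa => hSa.eq_antipodeL⟩,
      fun Δ Sa hΔ hSa => ?_, fun Ω Y Δ Sa D hΩ hY hΔ hSa hD f g => ?_⟩⟩
  -- The uniqueness statements replace arbitrary data by the constructed maps, for which the claims
  -- have been proved.
  · obtain rfl : Δ = comulL n n n := hΔ.eq_comul
    obtain rfl := hSa.eq_antipodeL
    exact ⟨_, isRestriction_Dmap hr hs, fun D hD => hD.eq_Dmap⟩
  · obtain rfl : Δ = comulL n n n := hΔ.eq_comul
    obtain rfl := hSa.eq_antipodeL
    obtain rfl := hD.eq_Dmap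
    obtain rfl := hY.eq_braidAbar
    obtain rfl := hΩ.eq_superSwap_braidA
    exact Dmap_mul_eq_twistedMul f g
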